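/- **Conventions.** Let $1\le\eta\le n$ be integers, $\Lambda>0$, $\varepsilon>0$. Let $a_q,a_q^\dagger$ ($0\le q<n$) be the fermionic annihilation and creation operators on the $n$-qubit occupation-number space, $a_q|j\rangle=(-1)^{j_0+\dots+j_{q-1}}|j\text{ with bit }q\text{ cleared}\rangle$ if $j_q=1$ and $a_q|j\rangle=0$ otherwise. For $k\in\{1,2\}$ and real coefficients $h_{PQ}$, $P,Q\in\{0,\dots,n-1\}^k$, with $|h_{PQ}|\le\Lambda$, let $$\mathcal H=\sum_{P,Q}h_{PQ}\,M_{PQ},\qquad M_{PQ}=a^\dagger_{P_1}\cdots a^\dagger_{P_k}\,a_{Q_1}\cdots a_{Q_k},$$ so $k=1$ is the general one-body and $k=2$ the general two-body Hamiltonian. It has $L=n^{2k}$ coefficients. Put $$m_b=\Big\lceil\log_2\Big\lceil\frac{\Lambda(n\eta)^k}{\varepsilon}\Big\rceil\Big\rceil+1 .$$ A unitary $U$ on $n$ system qubits and some ancilla qubits *block encodes $\mathcal H$ on the $\eta$-particle subspace with subnormalization factor $\alpha$ and error $\varepsilon$* if $\|(\mathcal H-\alpha(\langle 0|\otimes I)U(|0\rangle\otimes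 I))|_{V_\eta}\|\le\varepsilon$ in the spectral norm, where $V_\eta$ is the span of the basis states $|j\rangle$ with $\eta$ ones. Circuits consist of the gates $H,S,X,\mathrm{CNOT},T,T^\dagger$, act on the system and on finitely many ancilla qubits, and the T count is the number of $T$ and $T^\dagger$ gates. Write $add_i(j)$ for the position of the $i$-th one of $j$ ($i=0,1,\dots$). **Construction.** The circuit acts on $k$ registers of $\lceil\log_2 n\rceil$ qubits for the creation indices, $k$ registers of $\lceil\log_2\eta\rceil$ qubits for particle labels, $k$ registers of $\lceil\log_2 n\rceil$ qubits for the annihilation indices, a validation qubit, $m_b$ amplitude qubits, clean work qubits (always $|0\rangle$ below), and the system. It sets the validation qubit to $|1\rangle$, applies Hadamard gates to the creation-index and label registers, then the four oracle circuits $O_{occ},O_A,O_C,O_{uocc}$ in this order, and finally the same Hadamard gates. The oracles satisfy (registers that are not displayed are unchanged, and $j$ has $\eta$ ones in the first and the last item): * $O_{occ}$ exchanges $|i_1..i_k\rangle|0\rangle|j\rangle$ and $|i_1..i_k\rangle|add_{i_1}(j)..add_{i_k}(j)\rangle|j\rangle$. * $O_A$ maps $|P\rangle|Q\rangle|0^{m_b}\rangle$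 to $|P\rangle|Q\rangle|\varphi_{PQ}\rangle$ with $\langle 0^{m_b}|\varphi_{PQ}\rangle=\beta_{PQ}/2^{m_b-1}$, where $\beta_{PQ}$ is an integer, $|\beta_{PQ}|<2^{m_b-1}$ and $|h_{PQ}/\Lambda-\beta_{PQ}/2^{m_b-1}|\le 2^{-(m_b-1)}$ (the state $\varphi_{PQ}$ may depend on the other registers). * $O_C$ maps $|P\rangle|Q\rangle|1\rangle|j\rangle$ to $|P\rangle|Q\rangle|0\rangle M_{PQ}|j\rangle$ if $M_{PQ}|j\rangle\ne0$, and to $\pm|P\rangle|Q\rangle|1\rangle|j\rangle$ if $M_{PQ}|j\rangle=0$. * $O_{uocc}$ erases what depends on the initial state: if $M_{PQ}|j\rangle=\pm|j'\rangle$, $Q_t=add_{i_t}(j)$ and $P_t=add_{i'_t}(j')$ for all $t$, it maps $|P\rangle|i_1..i_k\rangle|Q\rangle|j'\rangle$ to $|Q\rangle|i'_1..i'_k\rangle|0\rangle|j'\rangle$ (validation qubit $|0\rangle$). **Claim.** There is an absolute constant $C>0$ such that for all $n,\eta,\Lambda,\varepsilon$ as above the following holds. 1. For $k\in\{1,2\}$,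 all coefficients $h$ as above and every integer $1\le\lambda\le L$, there are Clifford+T circuits for the four oracles such that the complete circuit block encodes $\mathcal H$ on the $\eta$-particle subspace with error $\varepsilon$, with subnormalization factor $0<\alpha\le C\Lambda(n\eta)^k$ (that is, $O(n\eta)$ for one-body and $O(n^2\eta^2)$ for two-body Hamiltonians with $O(1)$ coefficients) and with T count at most $$C\Big(n\log_2\eta+\frac L\lambda+\lambda m_b\Big).$$ If $m_b\le L$, this can be done (with the optimal $\lambda$) with T count at most $C\big(n\log_2\eta+\sqrt{L m_b}\big)$. 2. For a Hamiltonian that is the sum of a one-body and a two-body Hamiltonian with coefficients bounded by $\Lambda$, there are Clifford+T circuits that block encode it on the $\eta$-particle subspace with error $\varepsilon$, $0<\alpha\le C\Lambda n^2\eta^2$ and the same two T-count bounds with $L=n^4$ and $m_b=\lceil\log_2\lceil\Lambda n^2\eta^2/\varepsilon\rceil\rceil+1$ (the first one for every integer $1\le\lambda\le n^4$, the second one if $m_b\le n^4$). -/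

import Mathlib

open scoped Matrix Matrix.Norms.L2Operator

noncomputable section

namespace EtaParticle

/-! ### Clifford+T circuits

A computational basis state of a register with qubits indexed by `ι` is a map `ι → Bool`. -/

/-- The Clifford+T gate set on qubits indexed by `ι`. -/
inductive Gate (ι : Type) : Type
  | hadamard (q : ι)
  | phaseS (q : ι)
  | pauliX (q : ι)
  | cnot (c t : ι) (hct : c ≠ t)
  | tGate (q : ι)
  | tDagger (q : ι)

/-- A circuit is a list of gates; the head of the list is applied first. -/
abbrev Circuit (ι : Type) : Type := List (Gate ι)

/-- The matrix of a gate in the computational basis. -/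
def Gate.mat {ι : Type} [Fintype ι] [DecidableEq ι] :
    Gate ι → Matrix (ι → Bool) (ι → Bool) ℂ
  | .hadamard q => Matrix.of fun x y =>
      if ∀ r, r ≠ q → x r = y r then
        (if x q = true ∧ y q = true then -1 else 1) / (Real.sqrt 2 : ℂ)
      else 0
  | .phaseS q => Matrix.diagonal fun x => if x q = true then Complex.I else 1
  | .pauliX q => Matrix.of fun x y => if x = Function.update y q (!(y q)) then 1 else 0
  | .cnot c t _ => Matrix.of fun x y =>
      if x = Function.update y t (Bool.xor (y c) (y t)) then 1 else 0
  | .tGate q => Matrix.diagonal fun x =>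
      if x q = true then Complex.exp (Real.pi / 4 * Complex.I) else 1
  | .tDagger q => Matrix.diagonal fun x =>
      if x q = true then Complex.exp (-(Real.pi / 4 * Complex.I)) else 1

/-- The number of `T` gates (a `T†` counts as one). -/
def Gate.tCount {ι : Type} : Gate ι → ℕ
  | .tGate _ => 1
  | .tDagger _ => 1
  | _ => 0

/-- The matrix implemented by a circuit. -/
def Circuit.mat {ι : Type} [Fintype ι] [DecidableEq ι] :
    Circuit ι → Matrix (ι → Bool) (ι → Bool) ℂ
  | [] => 1
  | g :: c => Circuit.mat c * g.mat

/-- The `T` count of a circuit. -/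
def Circuit.tCount {ι : Type} (c : Circuit ι) : ℕ := (c.map Gate.tCount).sum

/-- The computational basis vector `|x⟩`. -/
def ket {κ : Type} [DecidableEq κ] (x : κ) : κ → ℂ := Pi.single x 1

/-! ### Fermions on `n` orbitals -/

/-- The number of particles in the occupation number state `|j⟩ = |j₀ j₁ … j_{n-1}⟩`. -/
def particles {n : ℕ} (j : Fin n → Bool) : ℕ :=
  (Finset.univ.filter fun l => j l = true).card

/-- The number of occupied orbitals of `|j⟩` with index smaller than `q`. -/
def occupiedBelow {n : ℕ} (j : Fin n → Bool) (q : Fin n) : ℕ :=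
  (Finset.univ.filter fun l => l < q ∧ j l = true).card

/-- `q` is `addᵢ(j)`, the index of the `i`-th occupied orbital of `|j⟩`, counted from zero. -/
def IsAddr {n : ℕ} (j : Fin n → Bool) (i : ℕ) (q : Fin n) : Prop :=
  j q = true ∧ occupiedBelow j q = i

/-- The annihilation operator `a_q` in the occupation number basis. -/
def annihilate {n : ℕ} (q : Fin n) : Matrix (Fin n → Bool) (Fin n → Bool) ℂ :=
  Matrix.of fun x y =>
    if y q = true ∧ x = Function.update y q false then (-1) ^ occupiedBelow y q else 0

/-- The creation operator `a_q†`. -/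
def create {n : ℕ} (q : Fin n) : Matrix (Fin n → Bool) (Fin n → Bool) ℂ :=
  (annihilate q)ᴴ

/-- The `k`-body monomial `a†_{P 0} ⋯ a†_{P (k-1)} a_{Q 0} ⋯ a_{Q (k-1)}`. -/
def monomial {n k : ℕ} (P Q : Fin k → Fin n) : Matrix (Fin n → Bool) (Fin n → Bool) ℂ :=
  (List.ofFn fun t => create (P t)).prod * (List.ofFn fun t => annihilate (Q t)).prod

/-- The `k`-body Hamiltonian with coefficients `h`: for `k = 1` it is `∑ h_{pq} a†_p a_q`, for
`k = 2` it is `∑ h_{pqrs} a†_p a†_q a_r a_s`. -/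
def hamiltonian {n k : ℕ} (h : (Fin k → Fin n) → (Fin k → Fin n) → ℝ) :
    Matrix (Fin n → Bool) (Fin n → Bool) ℂ :=
  ∑ P : Fin k → Fin n, ∑ Q : Fin k → Fin n, (h P Q : ℂ) • monomial P Q

/-! ### Block encodings -/

/-- The block `(⟨0| ⊗ I) U (|0⟩ ⊗ I)` of an operator on ancilla qubits `A` and `n` system
qubits. -/
def zeroBlock {A : Type} {n : ℕ} (U : Matrix (A ⊕ Fin n → Bool) (A ⊕ Fin n → Bool) ℂ) :
    Matrix (Fin n → Bool) (Fin n → Bool) ℂ :=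
  Matrix.of fun x y => U (Sum.elim (fun _ => false) x) (Sum.elim (fun _ => false) y)

/-- `U` is a unitary which, on the `η`-particle subspace, block encodes the operator `H` with
subnormalization factor `α` and error `ε`: the spectral norm of `H - α (⟨0| ⊗ I) U (|0⟩ ⊗ I)`
on that subspace is at most `ε`. All rows are kept, so that leakage out of the subspace counts
as an error. -/
def IsBlockEncodingOn {A : Type} [Fintype A] [DecidableEq A] {n : ℕ} (η : ℕ)
    (U : Matrix (A ⊕ Fin n → Bool) (A ⊕ Fin n → Bool) ℂ) (α ε : ℝ)
    (H : Matrix (Fin n → Bool) (Fin n → Bool) ℂ) : Prop :=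
  U ∈ Matrix.unitaryGroup (A ⊕ Fin n → Bool) ℂ ∧
  ‖(H - (α : ℂ) • zeroBlock U).submatrix id
      (Subtype.val : {j : Fin n → Bool // particles j = η} → (Fin n → Bool))‖ ≤ ε

/-! ### The registers and oracles of the `η`-particle circuit -/

/-- The ancilla qubits: `k` registers of `a` qubits for the creation indices, `k` registers of
`e` qubits for the particle labels, `k` registers of `a` qubits for the annihilation indices, a
validation qubit, `m` qubits for the sampled amplitude, and `w` clean work qubits. -/
inductive Anc (k a e m w : ℕ) : Type
  | p (t : Fin k) (b : Fin a)
  | i (t : Fin k) (b : Fin e)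
  | q (t : Fin k) (b : Fin a)
  | valid
  | amp (b : Fin m)
  | work (b : Fin w)
  deriving DecidableEq, Fintype

/-- The basis state `|P⟩|I⟩|Q⟩|v⟩|s⟩|0⟩|j⟩`, integers being written in binary. -/
def config {k a e m w n : ℕ} (P I Q : Fin k → ℕ) (v : Bool) (s : Fin m → Bool)
    (j : Fin n → Bool) : Anc k a e m w ⊕ Fin n → Bool :=
  Sum.elim
    (fun r => match r with
      | .p t b => (P t).testBit b
      | .i t b => (I t).testBit b
      | .q t b => (Q t).testBit b
      | .valid => v
      | .amp b => s b
      | .work _ => false)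
    j

/-- Operators on all the qubits. -/
abbrev Op (k a e m w n : ℕ) : Type :=
  Matrix (Anc k a e m w ⊕ Fin n → Bool) (Anc k a e m w ⊕ Fin n → Bool) ℂ

/-- The occupation detection oracle: on `η`-particle states `|j⟩` it maps
`|i⟩|0⟩|j⟩ ↦ |i⟩|addᵢ(j)⟩|j⟩` and `|i⟩|addᵢ(j)⟩|j⟩ ↦ |i⟩|0⟩|j⟩` (in `k` registers at once). -/
def IsOccOracle {k a e m w n : ℕ} (η : ℕ) (U : Op k a e m w n) : Prop :=
  ∀ (P I : Fin k → ℕ) (Q : Fin k → Fin n) (v : Bool) (s : Fin m → Bool) (j : Fin n → Bool),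
    particles j = η → (∀ t, IsAddr j (I t) (Q t)) →
    U *ᵥ ket (config P I (fun _ => 0) v s j) = ket (config P I (fun t => Q t) v s j) ∧
    U *ᵥ ket (config P I (fun t => Q t) v s j) = ket (config P I (fun _ => 0) v s j)

/-- The amplitude oracle: a signed `m`-bit number `β P Q` with `β P Q / 2^(m-1)` within
`2^(-(m-1))` of the coefficient `h P Q / Λ` is turned into the amplitude of the all-zero state of
the amplitude register; the table data are uncomputed. -/
def IsAmplitudeOracle {k a e m w n : ℕ} (h : (Fin k → Fin n) → (Fin k → Fin n) → ℝ) (Λ : ℝ)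
    (U : Op k a e m w n) : Prop :=
  ∃ β : (Fin k → Fin n) → (Fin k → Fin n) → ℤ,
    (∀ P Q, |β P Q| < 2 ^ (m - 1) ∧
      |h P Q / Λ - (β P Q : ℝ) / 2 ^ (m - 1)| ≤ 1 / 2 ^ (m - 1)) ∧
    ∀ (P Q : Fin k → Fin n) (I : Fin k → ℕ) (v : Bool) (j : Fin n → Bool),
      ∃ φ : (Fin m → Bool) → ℂ, φ (fun _ => false) = (β P Q : ℂ) / 2 ^ (m - 1) ∧
        U *ᵥ ket (config (fun t => P t) I (fun t => Q t) v (fun _ => false) j) =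
          ∑ s : Fin m → Bool, φ s • ket (config (fun t => P t) I (fun t => Q t) v s j)

/-- The sparsity oracle: with `M` the monomial of the indices `P, Q`, it maps
`|P⟩|Q⟩|1⟩|j⟩ ↦ |P⟩|Q⟩|0⟩ M|j⟩` if `M|j⟩ ≠ 0`; otherwise the validation qubit stays `|1⟩`. -/
def IsSparsityOracle {k a e m w n : ℕ} (U : Op k a e m w n) : Prop :=
  ∀ (P Q : Fin k → Fin n) (I : Fin k → ℕ) (s : Fin m → Bool) (j : Fin n → Bool),
    (monomial P Q *ᵥ ket j ≠ 0 →
      U *ᵥ ket (config (fun t => P t) I (fun t => Q t) true s j) =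
        ∑ j' : Fin n → Bool, monomial P Q j' j •
          ket (config (fun t => P t) I (fun t => Q t) false s j')) ∧
    (monomial P Q *ᵥ ket j = 0 →
      ∃ c : ℂ, (c = 1 ∨ c = -1) ∧
        U *ᵥ ket (config (fun t => P t) I (fun t => Q t) true s j) =
          c • ket (config (fun t => P t) I (fun t => Q t) true s j))

/-- The uncompute oracle: after a transition `|j⟩ → |j'⟩` by the monomial of the indices `P, Q`
it erases everything that depends on the initial state `|j⟩` except for the annihilation indices:
`|P⟩|I⟩|Q⟩|j'⟩ ↦ |Q⟩|I'⟩|0⟩|j'⟩`, where `Q t` is the `I t`-th occupied orbital of `j` and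
`P t` is the `I' t`-th occupied orbital of `j'`. -/
def IsUncomputeOracle {k a e m w n : ℕ} (η : ℕ) (U : Op k a e m w n) : Prop :=
  ∀ (P Q : Fin k → Fin n) (I I' : Fin k → ℕ) (s : Fin m → Bool) (j j' : Fin n → Bool),
    particles j = η → monomial P Q j' j ≠ 0 →
    (∀ t, IsAddr j (I t) (Q t)) → (∀ t, IsAddr j' (I' t) (P t)) →
    U *ᵥ ket (config (fun t => P t) I (fun t => Q t) false s j') =
      ket (config (fun t => Q t) I' (fun _ => 0) false s j')

/-- Clifford+T circuits for the four oracles of the `η`-particle circuit for `k`-body operators on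
`n` orbitals; the index registers have `⌈log₂ n⌉` and `⌈log₂ η⌉` qubits. -/
structure EtaCircuit (k n η m : ℕ) : Type where
  w : ℕ
  occ : Circuit (Anc k (Nat.clog 2 n) (Nat.clog 2 η) m w ⊕ Fin n)
  amplitude : Circuit (Anc k (Nat.clog 2 n) (Nat.clog 2 η) m w ⊕ Fin n)
  sparsity : Circuit (Anc k (Nat.clog 2 n) (Nat.clog 2 η) m w ⊕ Fin n)
  uncompute : Circuit (Anc k (Nat.clog 2 n) (Nat.clog 2 η) m w ⊕ Fin n)

/-- Hadamard gates on the creation index registers and on the particle label registers. -/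
def diffusion (k a e m w n : ℕ) : Circuit (Anc k a e m w ⊕ Fin n) :=
  ((List.finRange k).flatMap fun t =>
    (List.finRange a).map fun b => Gate.hadamard (Sum.inl (Anc.p t b))) ++
  ((List.finRange k).flatMap fun t =>
    (List.finRange e).map fun b => Gate.hadamard (Sum.inl (Anc.i t b)))

/-- The complete circuit: the validation qubit is set to `|1⟩`, indirect diffusion (Hadamard
gates, then occupation detection), amplitude oracle, sparsity oracle, uncompute oracle, Hadamard
gates. -/
def EtaCircuit.circuit {k n η m : ℕ} (E : EtaCircuit k n η m) :
    Circuit (Anc k (Nat.clog 2 n) (Nat.clog 2 η) m E.w ⊕ Fin n) :=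
  [Gate.pauliX (Sum.inl Anc.valid)] ++
    diffusion k (Nat.clog 2 n) (Nat.clog 2 η) m E.w n ++ E.occ ++
    E.amplitude ++ E.sparsity ++ E.uncompute ++
    diffusion k (Nat.clog 2 n) (Nat.clog 2 η) m E.w n

/-- The four circuits implement the four oracles for the coefficients `h`, scaled by `Λ`. -/
def EtaCircuit.Implements {k n η m : ℕ} (E : EtaCircuit k n η m)
    (h : (Fin k → Fin n) → (Fin k → Fin n) → ℝ) (Λ : ℝ) : Prop :=
  IsOccOracle η (Circuit.mat E.occ) ∧
  IsAmplitudeOracle h Λ (Circuit.mat E.amplitude) ∧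
  IsSparsityOracle (Circuit.mat E.sparsity) ∧
  IsUncomputeOracle η (Circuit.mat E.uncompute)

/-- The number of bits `m_b = ⌈log₂ ⌈Λ (nη)^k / ε⌉⌉ + 1` that is used for a coefficient. -/
def bits (k n η : ℕ) (Λ ε : ℝ) : ℕ :=
  Nat.clog 2 ⌈Λ * ((n : ℝ) * η) ^ k / ε⌉₊ + 1

/-- The `η`-particle circuit block encodes the `k`-body Hamiltonian with coefficients `h` on the
`η`-particle subspace with error `ε`, subnormalization factor at most `A` and at most `T` many
`T` gates. -/
def EtaBlockEncodes (k n η : ℕ) (h : (Fin k → Fin n) → (Fin k → Fin n) → ℝ)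
    (Λ ε A T : ℝ) : Prop :=
  ∃ (α : ℝ) (E : EtaCircuit k n η (bits k n η Λ ε)),
    0 < α ∧ α ≤ A ∧ E.Implements h Λ ∧
    IsBlockEncodingOn η (Circuit.mat E.circuit) α ε (hamiltonian h) ∧
    (Circuit.tCount E.circuit : ℝ) ≤ T

/-- Some Clifford+T circuit block encodes the operator `H` on the `η`-particle subspace with error
`ε`, subnormalization factor at most `A` and at most `T` many `T` gates. -/
def BlockEncodes (n η : ℕ) (H : Matrix (Fin n → Bool) (Fin n → Bool) ℂ) (ε A T : ℝ) : Prop :=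
  ∃ (α : ℝ) (w : ℕ) (c : Circuit (Fin w ⊕ Fin n)),
    0 < α ∧ α ≤ A ∧ IsBlockEncodingOn η (Circuit.mat c) α ε H ∧
    (Circuit.tCount c : ℝ) ≤ T

end EtaParticle

end

open EtaParticle

/-!
Each oracle is a reversible classical computation, possibly combined with a phase, and it is bounded
through the number of AND gates that its Boolean functions need when sums modulo two are free.
This number is modelled by `Ext c V W`: starting from a space `V` of functions with values in
`ZMod 2`, the product of two available functions is adjoined `c` times. If the functions to be added
to some qubits lie in `W`, and `V` consists of the affine functions of the input qubits,
`Ext.exists_circuit` gives a circuit with `14 c` `T` gates: every product is computed by a Toffoli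
gate into fresh clean work qubits, sums are CNOT gates, and at the end everything but the result is
uncomputed. Kickback on a further work qubit turns such a computation into a phase.

The costs of the oracles are then as follows.

* Occupation detection and the erasure of labels run a counter with `⌈log₂ η⌉` digits through the
  `n` orbitals and compare it with the labels, or read it off at given orbitals: `O(n log η + n)`
  products.
* The monomials are evaluated one factor at a time on one-hot encodings of the orbital indices,
  which cost `O(n)` products per index.
* The table of rounded coefficients is read by splitting the index bits into two groups of `d` and
  `r` bits, with `2 ^ r ≤ lam < 2 ^ (r + 1)`: the data depend linearly on the one-hot code of the
  first group, and one product with the one-hot code of the second group selects each digit. The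
  entry is compared with a uniform superposition in the amplitude register, which gives the
  amplitude `β / 2 ^ (m_b - 1)`. This costs `O(L / lam + lam * m_b)` products.
* As `n ^ 2 ≤ L`, terms of size `n` are dominated by `L / lam + lam * m_b`.

For the block (`OracleSpec.zeroBlock_apply`), each term of the superposition over the creation
indices `P` and the labels `I` leads to a state that the final projection removes, unless all
registers are valid and the monomial does not annihilate the system state: labels from `η` on raise
a flag in the work space, creation indices from `n` on and vanishing monomials leave the validation
qubit equal to one, and neither is undone later. The other terms end in `|Q⟩|I'⟩|0⟩|j'⟩`, whose
overlap with the uniform superposition in the first two registers does not depend on `P` and `Q`.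
Hence the block is the sum of the `β P Q / 2 ^ (m_b - 1) * M_{PQ}`, divided by the number
`2 ^ (k (⌈log₂ n⌉ + ⌈log₂ η⌉)) ≤ 16 (n η) ^ k` of terms of the superposition. By the Schur test
(`norm_restrict_le`), rounding the coefficients costs at most `ε`: each row and each column of the
error receives at most `(n η) ^ k` contributions.

For the sum of a one-body and a two-body operator and `η ≥ 2`, the identity
`(η - 1) a†_p a_q = ∑ r, a†_p a†_r a_r a_q` on the `η`-particle subspace turns the one-body part
into a two-body operator, so that the coefficients are at most doubled. For `η = 1` the two-body
part vanishes. The choice `lam ≈ √(L / m_b)` gives the bounds with a square root.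
-/

namespace EtaParticle

/-! ### Gates acting on basis states -/

section Gates

variable {ι : Type} [Fintype ι] [DecidableEq ι]

theorem mulVec_ket {κ : Type} [Fintype κ] [DecidableEq κ] (M : Matrix κ κ ℂ) (y : κ) :
    M *ᵥ ket y = fun x => M x y :=
  Matrix.mulVec_single_one M y

theorem mulVec_ket_apply {κ : Type} [Fintype κ] [DecidableEq κ] (M : Matrix κ κ ℂ) (x y : κ) :
    (M *ᵥ ket y) x = M x y :=
  congrFun (mulVec_ket M y) x

theorem ket_apply {κ : Type} [DecidableEq κ] (x y : κ) : ket x y = if y = x then 1 else 0 := by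
  simp [ket, Pi.single_apply]

theorem Circuit.mat_append (c d : Circuit ι) :
    Circuit.mat (c ++ d) = Circuit.mat d * Circuit.mat c := by
  induction c with
  | nil => simp [Circuit.mat]
  | cons g c ih => rw [List.cons_append, Circuit.mat, ih, Circuit.mat, Matrix.mul_assoc]

theorem Circuit.mat_append_mulVec (c d : Circuit ι) (v : (ι → Bool) → ℂ) :
    Circuit.mat (c ++ d) *ᵥ v = Circuit.mat d *ᵥ (Circuit.mat c *ᵥ v) := by
  rw [Circuit.mat_append, Matrix.mulVec_mulVec]

theorem Circuit.mat_singleton (g : Gate ι) : Circuit.mat [g] = g.mat := by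
  simp [Circuit.mat]

theorem Circuit.tCount_append {ι : Type} (c d : Circuit ι) :
    Circuit.tCount (c ++ d) = Circuit.tCount c + Circuit.tCount d := by
  simp [Circuit.tCount]

theorem pauliX_ket (q : ι) (y : ι → Bool) :
    (Gate.pauliX q).mat *ᵥ ket y = ket (Function.update y q (!(y q))) := by
  rw [mulVec_ket]; ext x; simp [Gate.mat, ket_apply]

theorem cnot_ket (c t : ι) (h : c ≠ t) (y : ι → Bool) :
    (Gate.cnot c t h).mat *ᵥ ket y = ket (Function.update y t (Bool.xor (y c) (y t))) := by
  rw [mulVec_ket]; ext x; simp [Gate.mat, ket_apply]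

theorem diagonal_ket {κ : Type} [Fintype κ] [DecidableEq κ] (d : κ → ℂ) (y : κ) :
    Matrix.diagonal d *ᵥ ket y = d y • ket y := by
  rw [mulVec_ket]; ext x
  by_cases h : x = y
  · subst h; simp [ket_apply]
  · simp [ket_apply, h]

theorem hadamard_ket (q : ι) (y : ι → Bool) :
    (Gate.hadamard q).mat *ᵥ ket y = (1 / (Real.sqrt 2 : ℂ)) •
      (ket (Function.update y q false) +
        (if y q = true then (-1 : ℂ) else 1) • ket (Function.update y q true)) := by
  rw [mulVec_ket]; ext x
  simp only [Gate.mat, Matrix.of_apply, Pi.smul_apply, Pi.add_apply, ket_apply, smul_eq_mul]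
  have key : ∀ b : Bool, x = Function.update y q b ↔ (∀ r, r ≠ q → x r = y r) ∧ x q = b := by
    intro b
    constructor
    · rintro rfl
      exact ⟨fun r hr => Function.update_of_ne hr _ _, Function.update_self ..⟩
    · rintro ⟨h1, h2⟩
      ext r
      by_cases hr : r = q
      · subst hr; simp [h2]
      · simp [Function.update_of_ne hr, h1 r hr]
  simp only [key]
  by_cases h : ∀ r, r ≠ q → x r = y r
  · cases hx : x q <;> cases hy : y q <;> simp [div_eq_mul_inv, mul_comm]
  · simp [h]

/-- A matrix is determined by its action on basis states. -/
theorem ext_ket {κ : Type} [Fintype κ] [DecidableEq κ] {M N : Matrix κ κ ℂ}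
    (h : ∀ y, M *ᵥ ket y = N *ᵥ ket y) : M = N := by
  ext x y
  have := congrFun (h y) x
  rwa [mulVec_ket, mulVec_ket] at this

theorem sqrt_two_inv_mul : (1 / (Real.sqrt 2 : ℂ)) * (1 / (Real.sqrt 2 : ℂ)) = 1 / 2 := by
  rw [div_mul_div_comm, ← Complex.ofReal_mul, Real.mul_self_sqrt (by norm_num)]
  norm_num

theorem star_exp_pi_div_four :
    star (Complex.exp (Real.pi / 4 * Complex.I)) = Complex.exp (-(Real.pi / 4 * Complex.I)) := by
  rw [Complex.star_def, ← Complex.exp_conj]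
  have : (Real.pi / 4 * Complex.I : ℂ) = ((Real.pi / 4 : ℝ) : ℂ) * Complex.I := by push_cast; rfl
  rw [this, map_mul, Complex.conj_ofReal, Complex.conj_I, mul_neg]

theorem Gate.conjTranspose_mul_self (g : Gate ι) : g.matᴴ * g.mat = 1 := by
  cases g with
  | hadamard q =>
    have hs : ((Gate.hadamard q).mat)ᴴ = (Gate.hadamard q).mat := by
      ext x y
      simp only [Gate.mat, Matrix.conjTranspose_apply, Matrix.of_apply]
      have : (∀ r, r ≠ q → y r = x r) ↔ (∀ r, r ≠ q → x r = y r) := by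
        simp only [eq_comm]
      rw [apply_ite star]
      simp only [this, star_div₀, star_zero, and_comm (a := y q = true)]
      split_ifs <;> simp
    rw [hs]
    refine ext_ket fun y => ?_
    rw [← Matrix.mulVec_mulVec, hadamard_ket, Matrix.mulVec_smul, Matrix.mulVec_add,
      Matrix.mulVec_smul, hadamard_ket, hadamard_ket, Matrix.one_mulVec]
    simp only [Function.update_idem, Function.update_self, smul_add, smul_smul]
    have e : y = Function.update y q (y q) := by simp
    conv_rhs => rw [e]
    ext z
    have h2 := sqrt_two_inv_mul
    simp only [Pi.add_apply, Pi.smul_apply, smul_eq_mul]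
    cases y q
    · simp only [Bool.false_eq_true, if_false, if_true]
      linear_combination (2 * ket (Function.update y q false) z) * h2
    · simp only [Bool.false_eq_true, if_false, if_true]
      linear_combination (2 * ket (Function.update y q true) z) * h2
  | phaseS q =>
    simp only [Gate.mat, Matrix.diagonal_conjTranspose, Matrix.diagonal_mul_diagonal]
    rw [← Matrix.diagonal_one]; congr 1; ext x
    simp only [Pi.star_apply]; split_ifs <;> simp
  | pauliX q =>
    refine ext_ket fun y => ?_
    have hs : ((Gate.pauliX q).mat)ᴴ = (Gate.pauliX q).mat := by
      ext x y
      simp only [Gate.mat, Matrix.conjTranspose_apply, Matrix.of_apply]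
      have : y = Function.update x q (!(x q)) ↔ x = Function.update y q (!(y q)) := by
        constructor <;> · rintro rfl; simp
      simp only [this]; split_ifs <;> simp
    rw [hs, ← Matrix.mulVec_mulVec, pauliX_ket, pauliX_ket]; simp
  | cnot c t h =>
    refine ext_ket fun y => ?_
    have hs : ((Gate.cnot c t h).mat)ᴴ = (Gate.cnot c t h).mat := by
      ext x y
      simp only [Gate.mat, Matrix.conjTranspose_apply, Matrix.of_apply]
      have : y = Function.update x t (Bool.xor (x c) (x t)) ↔
          x = Function.update y t (Bool.xor (y c) (y t)) := by
        constructor <;> · rintro rfl; simp [Function.update_of_ne h]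
      simp only [this]; split_ifs <;> simp
    rw [hs, ← Matrix.mulVec_mulVec, cnot_ket, cnot_ket]; simp [Function.update_of_ne h]
  | tGate q =>
    simp only [Gate.mat, Matrix.diagonal_conjTranspose, Matrix.diagonal_mul_diagonal]
    rw [← Matrix.diagonal_one]; congr 1; ext x
    simp only [Pi.star_apply]; split_ifs
    · rw [star_exp_pi_div_four, ← Complex.exp_add]; simp
    · simp
  | tDagger q =>
    simp only [Gate.mat, Matrix.diagonal_conjTranspose, Matrix.diagonal_mul_diagonal]
    rw [← Matrix.diagonal_one]; congr 1; ext x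
    simp only [Pi.star_apply]; split_ifs
    · rw [← star_exp_pi_div_four, star_star, star_exp_pi_div_four, ← Complex.exp_add]; simp
    · simp

theorem Circuit.mat_mem_unitaryGroup (c : Circuit ι) :
    Circuit.mat c ∈ Matrix.unitaryGroup (ι → Bool) ℂ := by
  induction c with
  | nil => exact one_mem _
  | cons g c ih =>
    exact mul_mem ih (Matrix.mem_unitaryGroup_iff'.2 g.conjTranspose_mul_self)

/-! ### The Toffoli gate -/

/-- The circuit multiplies every basis state `|y⟩` by the phase `φ y`. -/
def IsPhase (c : Circuit ι) (φ : (ι → Bool) → ℂ) : Prop :=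
  ∀ y, Circuit.mat c *ᵥ ket y = φ y • ket y

theorem IsPhase.append {c d : Circuit ι} {φ ψ : (ι → Bool) → ℂ} (hc : IsPhase c φ)
    (hd : IsPhase d ψ) : IsPhase (c ++ d) (fun y => φ y * ψ y) := fun y => by
  rw [Circuit.mat_append_mulVec, hc, Matrix.mulVec_smul, hd, smul_smul]

theorem IsPhase.conj_cnot {c : Circuit ι} {φ : (ι → Bool) → ℂ} (hc : IsPhase c φ)
    (a t : ι) (h : a ≠ t) :
    IsPhase ([Gate.cnot a t h] ++ c ++ [Gate.cnot a t h])
      (fun y => φ (Function.update y t (Bool.xor (y a) (y t)))) := fun y => by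
  rw [Circuit.mat_append_mulVec, Circuit.mat_append_mulVec, Circuit.mat_singleton, cnot_ket, hc,
    Matrix.mulVec_smul, cnot_ket]
  simp [Function.update_of_ne h]

theorem IsPhase.tGate (q : ι) : IsPhase [Gate.tGate q]
    (fun y => if y q = true then Complex.exp (Real.pi / 4 * Complex.I) else 1) := fun y => by
  rw [Circuit.mat_singleton, Gate.mat, diagonal_ket]

theorem IsPhase.tDagger (q : ι) : IsPhase [Gate.tDagger q]
    (fun y => if y q = true then Complex.exp (-(Real.pi / 4 * Complex.I)) else 1) := fun y => by
  rw [Circuit.mat_singleton, Gate.mat, diagonal_ket]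

theorem IsPhase.pauliZ (q : ι) : IsPhase [Gate.phaseS q, Gate.phaseS q]
    (fun y => if y q = true then -1 else 1) := fun y => by
  rw [Circuit.mat, Circuit.mat_singleton, ← Matrix.mulVec_mulVec, Gate.mat, diagonal_ket,
    Matrix.mulVec_smul, diagonal_ket, smul_smul]
  by_cases h : y q = true <;> simp [h]

/-- The doubly controlled `Z` gate, from the phase polynomial
`4abc = a + b + c - (a ⊕ b) - (b ⊕ c) - (a ⊕ c) + (a ⊕ b ⊕ c)`: one `T` or `T†` gate for each of
the seven parities. -/
theorem exists_ccz (a b t : ι) (hab : a ≠ b) (hat : a ≠ t) (hbt : b ≠ t) :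
    ∃ c : Circuit ι, Circuit.tCount c = 7 ∧
      IsPhase c (fun y => if y a = true ∧ y b = true ∧ y t = true then -1 else 1) := by
  have h := ((((((IsPhase.tGate a).append (IsPhase.tGate b)).append (IsPhase.tGate t)).append
    ((IsPhase.tDagger b).conj_cnot a b hab)).append
    ((IsPhase.tDagger t).conj_cnot b t hbt)).append
    ((IsPhase.tDagger t).conj_cnot a t hat)).append
    (((IsPhase.tGate t).conj_cnot a t hat).conj_cnot b t hbt)
  refine ⟨_, ?_, fun y => (h y).trans ?_⟩
  · simp [Circuit.tCount, Gate.tCount]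
  · congr 1
    set ω := Complex.exp (Real.pi / 4 * Complex.I) with hω
    have h1 : Complex.exp (-(Real.pi / 4 * Complex.I)) = ω⁻¹ := Complex.exp_neg _
    have h0 : ω ≠ 0 := Complex.exp_ne_zero _
    have h4 : ω ^ 4 = -1 := by
      rw [hω, ← Complex.exp_nat_mul, ← Complex.exp_pi_mul_I]
      congr 1; push_cast; ring
    simp only [h1, Function.update_self, Function.update_of_ne hat]
    cases y a <;> cases y b <;> cases y t <;> simp [h0]
    rw [← h4]; ring

/-- A circuit with at most `T` many `T` gates implements the classical map `f`. -/
def Impl (T : ℕ) (f : (ι → Bool) → (ι → Bool)) : Prop :=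
  ∃ c : Circuit ι, Circuit.tCount c ≤ T ∧ ∀ y, Circuit.mat c *ᵥ ket y = ket (f y)

theorem Impl.comp {S T : ℕ} {f g : (ι → Bool) → (ι → Bool)} (hg : Impl S g) (hf : Impl T f) :
    Impl (S + T) (g ∘ f) := by
  obtain ⟨c, hc, hc'⟩ := hg
  obtain ⟨d, hd, hd'⟩ := hf
  refine ⟨d ++ c, ?_, fun y => ?_⟩
  · rw [Circuit.tCount_append]; omega
  · rw [Circuit.mat_append_mulVec, hd', hc']; rfl

theorem Impl.id : Impl 0 (id : (ι → Bool) → (ι → Bool)) :=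
  ⟨[], by simp [Circuit.tCount], fun y => by simp [Circuit.mat]⟩

theorem Impl.not (q : ι) : Impl 0 (fun y : ι → Bool => Function.update y q (!(y q))) :=
  ⟨[Gate.pauliX q], by simp [Circuit.tCount, Gate.tCount], fun y => by
    rw [Circuit.mat_singleton, pauliX_ket]⟩

theorem Impl.cnot (a t : ι) (h : a ≠ t) :
    Impl 0 (fun y : ι → Bool => Function.update y t (Bool.xor (y a) (y t))) :=
  ⟨[Gate.cnot a t h], by simp [Circuit.tCount, Gate.tCount], fun y => by
    rw [Circuit.mat_singleton, cnot_ket]⟩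

/-- The Toffoli gate costs seven `T` gates. -/
theorem Impl.toffoli (a b t : ι) (hab : a ≠ b) (hat : a ≠ t) (hbt : b ≠ t) :
    Impl 7 (fun y : ι → Bool => Function.update y t (Bool.xor (y a && y b) (y t))) := by
  obtain ⟨c, hc, hc'⟩ := exists_ccz a b t hab hat hbt
  refine ⟨[Gate.hadamard t] ++ c ++ [Gate.hadamard t], ?_, fun y => ?_⟩
  · rw [Circuit.tCount_append, Circuit.tCount_append, hc]
    simp [Circuit.tCount, Gate.tCount]
  · rw [Circuit.mat_append_mulVec, Circuit.mat_append_mulVec, Circuit.mat_singleton, hadamard_ket]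
    simp only [Matrix.mulVec_smul, Matrix.mulVec_add, hc' _, hadamard_ket, Function.update_idem,
      Function.update_self, Function.update_of_ne hat, Function.update_of_ne hbt]
    have h2 := sqrt_two_inv_mul
    ext z
    simp only [Pi.add_apply, Pi.smul_apply, smul_eq_mul]
    cases y a <;> cases y b <;> cases y t <;>
      simp only [Bool.false_eq_true, and_true, and_false, if_false, if_true,
        Bool.and_true, Bool.and_false, Bool.xor_false, Bool.xor_true, Bool.not_true,
        Bool.not_false]
    all_goals first
      | linear_combination (2 * ket (Function.update y t false) z) * h2
      | linear_combination (2 * ket (Function.update y t true) z) * h2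

end Gates

/-! ### Multiplicative complexity of Boolean functions -/

/-- The bit `b` as an element of the field with two elements. -/
def ind (b : Bool) : ZMod 2 := if b then 1 else 0

@[simp] theorem ind_true : ind true = 1 := rfl
@[simp] theorem ind_false : ind false = 0 := rfl

theorem ind_xor (a b : Bool) : ind (a ^^ b) = ind a + ind b := by
  cases a <;> cases b <;> decide

theorem ind_and (a b : Bool) : ind (a && b) = ind a * ind b := by
  cases a <;> cases b <;> decide

theorem ind_not (a : Bool) : ind (!a) = ind a + 1 := by
  cases a <;> decide

theorem ind_injective : Function.Injective ind := by
  intro a b; cases a <;> cases b <;> decide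

theorem ind_decide_eq_one (z : ZMod 2) [Decidable (z = 1)] : ind (decide (z = 1)) = z := by
  rcases (by decide : ∀ z : ZMod 2, z = 0 ∨ z = 1) z with rfl | rfl <;> simp

theorem decide_ind_eq_one (b : Bool) [Decidable (ind b = 1)] : decide (ind b = 1) = b := by
  cases b <;> simp

section Complexity

variable {X : Type}

/-- `Ext c V W`: the space `W` of Boolean functions (with values in the field with two elements)
arises from the space `V` by `c` times adjoining the product of two functions that are already
there. Sums are free, as they cost only CNOT gates, so that `c` counts AND gates. -/
inductive Ext : ℕ → Submodule (ZMod 2) (X → ZMod 2) → Submodule (ZMod 2) (X → ZMod 2) → Prop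
  | refl (V : Submodule (ZMod 2) (X → ZMod 2)) : Ext 0 V V
  | step {c : ℕ} {V W : Submodule (ZMod 2) (X → ZMod 2)} {u v : X → ZMod 2} :
      Ext c V W → u ∈ W → v ∈ W → Ext (c + 1) V (W ⊔ Submodule.span (ZMod 2) {u * v})

variable {V W U : Submodule (ZMod 2) (X → ZMod 2)} {c d : ℕ}

theorem Ext.le (h : Ext c V W) : V ≤ W := by
  induction h with
  | refl => exact le_rfl
  | step _ _ _ ih => exact ih.trans le_sup_left

theorem Ext.trans (h : Ext c V W) (h' : Ext d W U) : Ext (c + d) V U := by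
  induction h' with
  | refl => exact h
  | step _ hu hv ih => exact (ih h).step hu hv

theorem Ext.sup (h : Ext c V W) (U : Submodule (ZMod 2) (X → ZMod 2)) :
    Ext c (V ⊔ U) (W ⊔ U) := by
  induction h with
  | refl => exact .refl _
  | step _ hu hv ih =>
    rw [sup_right_comm]
    exact ih.step (Submodule.mem_sup_left hu) (Submodule.mem_sup_left hv)

theorem Ext.mono (h : Ext c V W) (hcd : c ≤ d) : Ext d V W := by
  induction hcd with
  | refl => exact h
  | step _ ih => simpa using ih.step (zero_mem _) (zero_mem _)

/-- Functions that are computable from `V` separately are computable jointly at the sum of the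
costs. -/
theorem Ext.family {ι : Type*} (s : Finset ι) (S : ι → Set (X → ZMod 2))
    (h : ∀ i ∈ s, ∃ W, Ext c V W ∧ S i ⊆ W) :
    ∃ W, Ext (s.card * c) V W ∧ ∀ i ∈ s, S i ⊆ W := by
  classical
  induction s using Finset.induction_on with
  | empty => exact ⟨V, by simpa using Ext.refl V, by simp⟩
  | insert a s ha ih =>
    obtain ⟨W, hW, hS⟩ := ih fun i hi => h i (Finset.mem_insert_of_mem hi)
    obtain ⟨W', hW', hS'⟩ := h a (Finset.mem_insert_self ..)
    refine ⟨W' ⊔ W, ?_, ?_⟩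
    · rw [Finset.card_insert_of_notMem ha, add_mul, one_mul]
      have := hW'.sup W
      rw [sup_eq_right.2 hW.le] at this
      exact hW.trans this
    · intro i hi
      rcases Finset.mem_insert.1 hi with rfl | hi
      · exact hS'.trans (SetLike.coe_subset_coe.2 le_sup_left)
      · exact (hS i hi).trans (SetLike.coe_subset_coe.2 le_sup_right)

theorem Ext.mul {u v : X → ZMod 2} (hu : u ∈ V) (hv : v ∈ V) : ∃ W, Ext 1 V W ∧ u * v ∈ W :=
  ⟨_, (Ext.refl V).step hu hv,
    Submodule.mem_sup_right (Submodule.mem_span_singleton_self _)⟩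

theorem Ext.products {ι : Type*} [Fintype ι] (f : ι → X → ZMod 2)
    (h : ∀ i, ∃ u ∈ V, ∃ v ∈ V, f i = u * v) :
    ∃ W, Ext (Fintype.card ι) V W ∧ ∀ i, f i ∈ W := by
  obtain ⟨W, hW, hS⟩ := Ext.family (c := 1) (V := V) Finset.univ (fun i => {f i}) (by
    intro i _
    obtain ⟨u, hu, v, hv, e⟩ := h i
    obtain ⟨W, hW, hm⟩ := Ext.mul hu hv
    exact ⟨W, hW, by simpa [e] using hm⟩)
  exact ⟨W, by simpa using hW, fun i => by simpa using hS i (Finset.mem_univ i)⟩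

theorem Ext.prod_range (f : ℕ → X → ZMod 2) (e : ℕ) (h1 : 1 ∈ V) (hf : ∀ b < e, f b ∈ V) :
    ∃ W, Ext e V W ∧ ∏ b ∈ Finset.range e, f b ∈ W := by
  induction e with
  | zero => exact ⟨V, .refl V, by simpa using h1⟩
  | succ e ih =>
    obtain ⟨W, hW, hm⟩ := ih fun b hb => hf b (hb.trans e.lt_succ_self)
    obtain ⟨W', hW', hm'⟩ := Ext.mul hm (hW.le (hf e e.lt_succ_self))
    exact ⟨W', hW.trans hW', by rwa [Finset.prod_range_succ]⟩

/-! ### One-hot codes and table lookup -/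

theorem ind_mul_eq (a : Bool) : ∀ x : ZMod 2, x + ind a + 1 = ind (decide (x = ind a)) := by
  cases a <;> decide

/-- The indicator function of the points where the functions `B b` have the values `v b`. -/
def oneHot {β : Type*} [Fintype β] (B : β → X → ZMod 2) (v : β → Bool) : X → ZMod 2 :=
  ∏ b, (B b + (fun _ => ind (v b)) + 1)

theorem oneHot_apply {β : Type*} [Fintype β] [DecidableEq β] (B : β → X → ZMod 2)
    (v : β → Bool) (x : X) : oneHot B v x = ind (decide (∀ b, B b x = ind (v b))) := by
  simp only [oneHot, Finset.prod_apply, Pi.add_apply, Pi.one_apply, ind_mul_eq]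
  by_cases h : ∀ b, B b x = ind (v b)
  · simp [h]
  · obtain ⟨b, hb⟩ := not_forall.1 h
    rw [Finset.prod_eq_zero (Finset.mem_univ b) (by simp [hb])]
    simp [h]

theorem const_mem (h1 : 1 ∈ V) (b : Bool) : (fun _ => ind b) ∈ V := by
  cases b
  · exact zero_mem V
  · exact h1

theorem Ext.oneHot (h1 : 1 ∈ V) (d : ℕ) (B : Fin d → X → ZMod 2) (hB : ∀ b, B b ∈ V) :
    ∃ W, Ext (2 ^ (d + 1)) V W ∧ ∀ v, oneHot B v ∈ W := by
  induction d with
  | zero =>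
    exact ⟨V, (Ext.refl V).mono (Nat.zero_le _), fun v => by simpa [EtaParticle.oneHot] using h1⟩
  | succ d ih =>
    obtain ⟨W, hW, hm⟩ := ih (fun b => B b.castSucc) fun b => hB _
    obtain ⟨W', hW', hm'⟩ := Ext.products (V := W)
      (fun v : Fin (d + 1) → Bool => EtaParticle.oneHot B v) fun v =>
        ⟨_, hm fun b => v b.castSucc, B (Fin.last d) + (fun _ => ind (v (Fin.last d))) + 1,
          hW.le (add_mem (add_mem (hB _) (const_mem h1 _)) h1), by
            simp [EtaParticle.oneHot, Fin.prod_univ_castSucc]⟩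
    refine ⟨W', ?_, hm'⟩
    have := hW.trans hW'
    simp only [Fintype.card_pi, Fintype.card_bool, Finset.prod_const, Finset.card_univ,
      Fintype.card_fin] at this
    rwa [← two_mul, ← pow_succ'] at this

/-- Table lookup: one-hot codes of the two halves of the address select a row and a word of the
row. The words of the selected row are sums of one-hot functions, hence free, so that only
`2 ^ r` products are left for each output bit. -/
theorem Ext.lookup {β : Type} [Fintype β] {m d r : ℕ} (h1 : 1 ∈ V) (e : β ≃ Fin d ⊕ Fin r)
    (B : β → X → ZMod 2) (hB : ∀ b, B b ∈ V) (G : (β → Bool) → Fin m → Bool) :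
    ∃ W, Ext (2 ^ (d + 1) + 2 ^ (r + 1) + 2 ^ r * m) V W ∧
      ∀ i, (fun x => ind (G (fun b => decide (B b x = 1)) i)) ∈ W := by
  obtain ⟨W₁, hW₁, hm₁⟩ := Ext.oneHot h1 d (fun b => B (e.symm (.inl b))) fun b => hB _
  obtain ⟨W₂, hW₂, hm₂⟩ := Ext.oneHot (hW₁.le h1) r (fun b => B (e.symm (.inr b)))
    fun b => hW₁.le (hB _)
  obtain ⟨W₃, hW₃, hm₃⟩ := Ext.products (V := W₂)
    (fun p : (Fin r → Bool) × Fin m =>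
      EtaParticle.oneHot (fun b => B (e.symm (.inr b))) p.1 *
        ∑ v : Fin d → Bool, if G (fun b => Sum.elim v p.1 (e b)) p.2 then
          EtaParticle.oneHot (fun b => B (e.symm (.inl b))) v else 0)
    fun p => ⟨_, hm₂ p.1, _, Submodule.sum_mem _ fun v _ => by
      split_ifs
      · exact hW₂.le (hm₁ v)
      · exact zero_mem _, rfl⟩
  refine ⟨W₃, ?_, fun i => ?_⟩
  · have := (hW₁.trans hW₂).trans hW₃
    simpa using this
  · have : (fun x => ind (G (fun b => decide (B b x = 1)) i)) =
        ∑ w : Fin r → Bool, EtaParticle.oneHot (fun b => B (e.symm (.inr b))) w *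
          ∑ v : Fin d → Bool, if G (fun b => Sum.elim v w (e b)) i then
            EtaParticle.oneHot (fun b => B (e.symm (.inl b))) v else 0 := by
      ext x
      have hz : ∀ (z : ZMod 2) (b : Bool), z = ind b ↔ b = decide (z = 1) := by decide
      simp only [Finset.sum_apply, Pi.mul_apply, oneHot_apply, hz, ← funext_iff]
      have h2 : ∀ (P : Prop) [Decidable P] (f : X → ZMod 2), (if P then f else 0) x =
          if P then f x else 0 := by intros; split_ifs <;> rfl
      simp only [h2, oneHot_apply, hz, ← funext_iff]
      rw [Finset.sum_eq_single (fun b => decide (B (e.symm (.inr b)) x = 1))]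
      · rw [Finset.sum_eq_single (fun b => decide (B (e.symm (.inl b)) x = 1))]
        · have : (fun b => Sum.elim (fun b => decide (B (e.symm (.inl b)) x = 1))
              (fun b => decide (B (e.symm (.inr b)) x = 1)) (e b)) =
              fun b => decide (B b x = 1) := by
            ext b
            obtain ⟨s, rfl⟩ := e.symm.surjective b
            cases s <;> simp
          simp [this, ind]
        · intro v _ hv; simp [hv]
        · simp
      · intro v _ hv; simp [hv]
      · simp
    rw [this]
    exact Submodule.sum_mem _ fun w _ => hm₃ (w, i)

/-! ### Binary arithmetic -/

/-- The function that gives the `b`-th binary digit of `N`. -/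
def bitF (N : X → ℕ) (b : ℕ) : X → ZMod 2 := fun x => ind ((N x).testBit b)

theorem testBit_add_of_le_one (N u b : ℕ) (hu : u ≤ 1) :
    (N + u).testBit b = (N.testBit b ^^ decide (2 ^ b ≤ N % 2 ^ b + u)) := by
  simp only [Nat.testBit_eq_decide_div_mod_eq]
  have : (N + u) / 2 ^ b = N / 2 ^ b + if 2 ^ b ≤ N % 2 ^ b + u then 1 else 0 := by
    rcases Nat.eq_zero_or_pos b with rfl | hb
    · interval_cases u <;> simp [Nat.mod_one]
    · have h2 : u < 2 ^ b := lt_of_le_of_lt hu (Nat.one_lt_two_pow hb.ne')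
      rw [Nat.add_div (by positivity), Nat.div_eq_of_lt h2, Nat.mod_eq_of_lt h2, add_zero]
  rw [this]
  split_ifs with h
  · rcases Nat.mod_two_eq_zero_or_one (N / 2 ^ b) with h0 | h0 <;> simp [h, Nat.add_mod, h0]
  · simp [h]

theorem carry_succ (N u b : ℕ) (hu : u ≤ 1) :
    decide (2 ^ (b + 1) ≤ N % 2 ^ (b + 1) + u) =
      (N.testBit b && decide (2 ^ b ≤ N % 2 ^ b + u)) := by
  simp only [Nat.testBit_eq_decide_div_mod_eq]
  rw [Nat.mod_pow_succ, pow_succ, ← Bool.decide_and, decide_eq_decide]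
  have h3 := Nat.mod_lt N (show 0 < 2 ^ b by positivity)
  rcases Nat.mod_two_eq_zero_or_one (N / 2 ^ b) with h0 | h0 <;> rw [h0] <;> omega

theorem ZMod.val_le_one_of_two (z : ZMod 2) : z.val ≤ 1 := Nat.le_of_lt_succ (ZMod.val_lt z)

/-- A ripple-carry increment costs one AND gate for each digit. -/
theorem Ext.increment (N : X → ℕ) (u : X → ZMod 2) (e : ℕ) (hN : ∀ b < e, bitF N b ∈ V)
    (hu : u ∈ V) :
    ∃ W, Ext e V W ∧ ∀ b < e, bitF (fun x => N x + (u x).val) b ∈ W := by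
  suffices H : ∃ W, Ext e V W ∧
      (fun x => ind (decide (2 ^ e ≤ N x % 2 ^ e + (u x).val))) ∈ W ∧
      ∀ b < e, bitF (fun x => N x + (u x).val) b ∈ W by
    obtain ⟨W, h1, -, h2⟩ := H
    exact ⟨W, h1, h2⟩
  induction e with
  | zero =>
    refine ⟨V, .refl V, ?_, by simp⟩
    have : ∀ z : ZMod 2, ind (decide (1 ≤ z.val)) = z := by decide
    simpa [Nat.mod_one, this] using hu
  | succ e ih =>
    obtain ⟨W, hW, hc, hb⟩ := ih fun b hb => hN b (hb.trans e.lt_succ_self)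
    have hNe := hW.le (hN e e.lt_succ_self)
    obtain ⟨W', hW', hm⟩ := Ext.mul hNe hc
    refine ⟨W', hW.trans hW', ?_, fun b hb' => ?_⟩
    · convert hm using 1
      ext x
      rw [carry_succ _ _ _ (ZMod.val_le_one_of_two _), ind_and]
      rfl
    · rcases Nat.lt_succ_iff_lt_or_eq.1 hb' with hb' | rfl
      · exact hW'.le (hb b hb')
      · have : bitF (fun x => N x + (u x).val) b = bitF N b +
            fun x => ind (decide (2 ^ b ≤ N x % 2 ^ b + (u x).val)) := by
          ext x
          rw [bitF, testBit_add_of_le_one _ _ _ (ZMod.val_le_one_of_two _), ind_xor]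
          rfl
        rw [this]
        exact hW'.le (add_mem hNe hc)

/-- The number of functions among the first `l` ones that have the value one. -/
def cnt (g : ℕ → X → ZMod 2) (l : ℕ) : X → ℕ := fun x => ∑ l' ∈ Finset.range l, (g l' x).val

theorem Ext.cnt (g : ℕ → X → ZMod 2) (hg : ∀ l, g l ∈ V) (n e : ℕ) :
    ∃ W, Ext (n * e) V W ∧ ∀ l ≤ n, ∀ b < e, bitF (cnt g l) b ∈ W := by
  induction n with
  | zero =>
    refine ⟨V, by simpa using Ext.refl V, fun l hl b _ => ?_⟩
    obtain rfl := Nat.le_zero.1 hl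
    have : bitF (EtaParticle.cnt g 0) b = 0 := by ext x; simp [bitF, EtaParticle.cnt]
    rw [this]; exact zero_mem V
  | succ n ih =>
    obtain ⟨W, hW, hm⟩ := ih
    obtain ⟨W', hW', hm'⟩ := Ext.increment (EtaParticle.cnt g n) (g n) e (hm n le_rfl)
      (hW.le (hg n))
    refine ⟨W', by rw [add_mul, one_mul]; exact hW.trans hW', fun l hl b hb => ?_⟩
    rcases Nat.le_succ_iff.1 hl with hl | rfl
    · exact hW'.le (hm l hl b hb)
    · convert hm' b hb using 2
      ext x; simp [EtaParticle.cnt, Finset.sum_range_succ]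

theorem mod_lt_mod_succ (s c b : ℕ) :
    ind (decide (s % 2 ^ (b + 1) < c % 2 ^ (b + 1))) =
      ind (decide (s % 2 ^ b < c % 2 ^ b)) + (ind (s.testBit b) + ind (c.testBit b)) *
        (ind (decide (s % 2 ^ b < c % 2 ^ b)) + ind (c.testBit b)) := by
  simp only [Nat.testBit_eq_decide_div_mod_eq, Nat.mod_pow_succ]
  have h3 := Nat.mod_lt s (show 0 < 2 ^ b by positivity)
  have h4 := Nat.mod_lt c (show 0 < 2 ^ b by positivity)
  generalize s % 2 ^ b = s₀ at *
  generalize c % 2 ^ b = c₀ at *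
  generalize 2 ^ b = p at *
  rcases Nat.mod_two_eq_zero_or_one (s / p) with h0 | h0 <;>
  rcases Nat.mod_two_eq_zero_or_one (c / p) with h1 | h1 <;> rw [h0, h1]
  · simp
  · have : s₀ + p * 0 < c₀ + p * 1 := by omega
    simp only [this]
    generalize ind (decide (s₀ < c₀)) = z
    revert z; decide
  · have : ¬ (s₀ + p * 1 < c₀ + p * 0) := by omega
    simp only [this]
    generalize ind (decide (s₀ < c₀)) = z
    revert z; decide
  · have : s₀ + p * 1 < c₀ + p * 1 ↔ s₀ < c₀ := by omega
    simp only [this]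
    generalize ind (decide (s₀ < c₀)) = z
    revert z; decide

/-- Comparison of two numbers costs one AND gate for each digit. -/
theorem Ext.lt (S C : X → ℕ) (m : ℕ) (hS : ∀ b < m, bitF S b ∈ V) (hC : ∀ b < m, bitF C b ∈ V) :
    ∃ W, Ext m V W ∧ (fun x => ind (decide (S x % 2 ^ m < C x % 2 ^ m))) ∈ W := by
  induction m with
  | zero => exact ⟨V, .refl V, by simp [Nat.mod_one]; exact zero_mem V⟩
  | succ m ih =>
    obtain ⟨W, hW, hm⟩ := ih (fun b hb => hS b (hb.trans m.lt_succ_self))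
      (fun b hb => hC b (hb.trans m.lt_succ_self))
    have hSm := hW.le (hS m m.lt_succ_self)
    have hCm := hW.le (hC m m.lt_succ_self)
    obtain ⟨W', hW', hm'⟩ := Ext.mul (add_mem hSm hCm) (add_mem hm hCm)
    refine ⟨W', hW.trans hW', ?_⟩
    convert add_mem (hW'.le hm) hm' using 1
    ext x
    exact mod_lt_mod_succ _ _ _

/-- The address of an occupied orbital from its label: the orbital `l` is selected if it is
occupied and the digits of the running counter agree with the label. -/
theorem Ext.select (g : ℕ → X → ZMod 2) (hg : ∀ l, g l ∈ V) (h1 : 1 ∈ V) (n e : ℕ)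
    (N : X → ℕ) (hN : ∀ b < e, bitF N b ∈ V)
    (hc : ∀ l ≤ n, ∀ b < e, bitF (EtaParticle.cnt g l) b ∈ V) :
    ∃ W, Ext (n * (e + 1)) V W ∧ ∀ l < n,
      (fun x => g l x * ind (decide (EtaParticle.cnt g l x % 2 ^ e = N x % 2 ^ e))) ∈ W := by
  have key := Ext.family (c := e + 1) (V := V) (Finset.range n)
    (fun l => {fun x => g l x * ind (decide (EtaParticle.cnt g l x % 2 ^ e = N x % 2 ^ e))}) (by
    intro l hl
    obtain ⟨W, hW, hm⟩ := Ext.prod_range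
      (fun b => bitF (EtaParticle.cnt g l) b + bitF N b + 1) e h1
      (fun b hb => add_mem (add_mem (hc l (Finset.mem_range.1 hl).le b hb) (hN b hb)) h1)
    obtain ⟨W', hW', hm'⟩ := Ext.mul (hW.le (hg l)) hm
    refine ⟨W', hW.trans hW', ?_⟩
    rw [Set.singleton_subset_iff, SetLike.mem_coe]
    convert hm' using 1
    ext x
    simp only [Pi.mul_apply, Finset.prod_apply, Pi.add_apply, Pi.one_apply, bitF, ind_mul_eq]
    congr 1
    by_cases h : EtaParticle.cnt g l x % 2 ^ e = N x % 2 ^ e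
    · symm
      simp only [h, decide_true]
      refine Finset.prod_eq_one fun b hb => ?_
      have := congrArg (fun z => z.testBit b) h
      simp only [Nat.testBit_mod_two_pow, Finset.mem_range.1 hb, decide_true,
        Bool.true_and] at this
      simp [this]
    · symm
      simp only [h, decide_false]
      have : ∃ b < e, (EtaParticle.cnt g l x).testBit b ≠ (N x).testBit b := by
        by_contra! hcon
        refine h (Nat.eq_of_testBit_eq fun b => ?_)
        simp only [Nat.testBit_mod_two_pow]
        by_cases hb : b < e
        · rw [hcon b hb]
        · simp [hb]
      obtain ⟨b, hb, hne⟩ := this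
      refine Finset.prod_eq_zero (Finset.mem_range.2 hb) ?_
      simp [ind_injective.eq_iff, hne])
  obtain ⟨W, hW, hm⟩ := key
  exact ⟨W, by simpa using hW, fun l hl => by simpa using hm l (Finset.mem_range.2 hl)⟩

end Complexity

/-! ### Circuits from Boolean functions -/

section Compile

variable {κ : Type}

/-- The function that reads the qubit `q`. -/
def coord (q : κ) : (κ → Bool) → ZMod 2 := fun y => ind (y q)

theorem decide_coord_eq_one (q : κ) (y : κ → Bool) : decide (coord q y = 1) = y q :=
  decide_ind_eq_one (y q)

/-- The affine functions of the qubits in `In`. -/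
def affine (In : Set κ) : Submodule (ZMod 2) ((κ → Bool) → ZMod 2) :=
  Submodule.span (ZMod 2) (insert 1 (coord '' In))

theorem one_mem_affine (In : Set κ) : 1 ∈ affine In :=
  Submodule.subset_span (Set.mem_insert _ _)

theorem coord_mem_affine {In : Set κ} {q : κ} (h : q ∈ In) : coord q ∈ affine In :=
  Submodule.subset_span (Set.mem_insert_of_mem _ ⟨q, h, rfl⟩)

/-- Adds the function `f q` of the current basis state to each qubit `q`. -/
def addFun (f : κ → (κ → Bool) → ZMod 2) (y : κ → Bool) : κ → Bool :=
  fun q => y q ^^ decide (f q y = 1)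

/-- The functions of `V` are affine functions of the qubits in `s` after the map `σ`, when the
qubits in `wk` are clean before. -/
def Readable (V : Submodule (ZMod 2) ((κ → Bool) → ZMod 2)) (wk s : Set κ)
    (σ : (κ → Bool) → κ → Bool) : Prop :=
  ∀ f ∈ V, ∃ (b : Bool) (l : List κ), (∀ q ∈ l, q ∈ s) ∧
    ∀ y : κ → Bool, (∀ q ∈ wk, y q = false) → f y = ind b + (l.map fun q => ind (σ y q)).sum

theorem Readable.affine (In wk : Set κ) : Readable (affine In) wk In id := by
  intro f hf
  induction hf using Submodule.span_induction with
  | mem f hf =>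
    rcases hf with rfl | ⟨q, hq, rfl⟩
    · exact ⟨true, [], by simp, fun y _ => by simp⟩
    · exact ⟨false, [q], by simpa using hq, fun y _ => by simp [coord]⟩
  | zero => exact ⟨false, [], by simp, fun y _ => by simp⟩
  | add f g _ _ hf hg =>
    obtain ⟨b, l, hl, h⟩ := hf
    obtain ⟨b', l', hl', h'⟩ := hg
    refine ⟨b ^^ b', l ++ l', ?_, fun y hy => ?_⟩
    · intro q hq
      rcases List.mem_append.1 hq with hq | hq
      exacts [hl q hq, hl' q hq]
    · rw [Pi.add_apply, h y hy, h' y hy, ind_xor]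
      simp only [List.map_append, List.sum_append]
      ring
  | smul r f _ hf =>
    obtain rfl | rfl : r = 0 ∨ r = 1 := (by decide : ∀ z : ZMod 2, z = 0 ∨ z = 1) r
    · exact ⟨false, [], by simp, fun y _ => by simp⟩
    · simpa using hf

variable [Fintype κ] [DecidableEq κ]

/-- CNOT and NOT gates add an affine function of other qubits to the qubit `t`. -/
theorem Impl.addAffine (t : κ) (b : Bool) (l : List κ) (hl : ∀ q ∈ l, q ≠ t) :
    Impl 0 (fun y : κ → Bool => Function.update y t
      (y t ^^ decide (ind b + (l.map fun q => ind (y q)).sum = 1))) := by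
  induction l with
  | nil =>
    cases b
    · convert Impl.id (ι := κ) using 1
      ext y q; simp
    · convert Impl.not (ι := κ) t using 1
      ext y q; simp
  | cons q l ih =>
    convert (Impl.cnot q t (hl q (List.mem_cons_self ..))).comp
      (ih fun r hr => hl r (List.mem_cons_of_mem _ hr)) using 1
    ext y
    have hq := hl q (List.mem_cons_self ..)
    simp only [Function.comp, Function.update_self, Function.update_of_ne hq,
      Function.update_idem]
    congr 1
    apply ind_injective
    simp only [ind_xor, ind_decide_eq_one, List.map_cons, List.sum_cons]
    ring

/-- Affine functions of qubits outside the list `ts` of targets are added to the targets. -/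
theorem Impl.addAffines (b : κ → Bool) (l : κ → List κ) (ts : List κ) (hts : ts.Nodup)
    (hl : ∀ t ∈ ts, ∀ q ∈ l t, q ∉ ts) :
    Impl 0 (fun (y : κ → Bool) t => y t ^^
      decide (t ∈ ts ∧ ind (b t) + ((l t).map fun q => ind (y q)).sum = 1)) := by
  induction ts with
  | nil =>
    convert Impl.id (ι := κ) using 1
    ext y t; simp
  | cons a ts ih =>
    have hn := List.nodup_cons.1 hts
    convert (Impl.addAffine a (b a) (l a) (fun q hq h => hl a (List.mem_cons_self ..) q hq
      (h ▸ List.mem_cons_self ..))).comp (ih hn.2 fun t ht q hq h =>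
        hl t (List.mem_cons_of_mem _ ht) q hq (List.mem_cons_of_mem _ h)) using 1
    ext y t
    simp only [Function.comp]
    have h2 : ((l a).map fun q => ind (y q ^^ decide (q ∈ ts ∧
        ind (b q) + ((l q).map fun q => ind (y q)).sum = 1))) =
        (l a).map fun q => ind (y q) := by
      refine List.map_congr_left fun q hq => ?_
      have : q ∉ ts := fun h =>
        hl a (List.mem_cons_self ..) q hq (List.mem_cons_of_mem _ h)
      simp [this]
    by_cases hta : t = a
    · subst hta
      rw [Function.update_self, h2]
      simp [hn.1]
    · simp [hta]

/-- A computation with `c` AND gates as a reversible circuit. Each AND gate takes three clean work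
qubits: two for its inputs, which are affine functions of earlier qubits, and one for its output.
The circuit reads only the qubits in `In`, which is expressed by its commuting with changes `δ` of
all other qubits outside the work space. -/
theorem Ext.exists_compute {c : ℕ} {In : Set κ}
    {V W : Submodule (ZMod 2) ((κ → Bool) → ZMod 2)} (hE : Ext c V W) (hV : V = affine In)
    (wk : ℕ → Fin 3 → κ)
    (hinj : ∀ i < c, ∀ r i' r', i' < c → wk i r = wk i' r' → i = i' ∧ r = r')
    (hIn : ∀ i < c, ∀ r, wk i r ∉ In) :
    ∃ σ τ : (κ → Bool) → κ → Bool, Impl (7 * c) σ ∧ Impl (7 * c) τ ∧ (∀ y, τ (σ y) = y) ∧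
      (∀ y q, (∀ i < c, ∀ r, q ≠ wk i r) → σ y q = y q) ∧
      Readable W {q | ∃ i < c, ∃ r, q = wk i r} (In ∪ {q | ∃ i < c, ∃ r, q = wk i r}) σ ∧
      ∀ y δ : κ → Bool, (∀ q ∈ In, δ q = false) → (∀ i < c, ∀ r, δ (wk i r) = false) →
        σ (fun q => y q ^^ δ q) = fun q => σ y q ^^ δ q := by
  induction hE with
  | refl =>
    subst hV
    refine ⟨id, id, Impl.id, Impl.id, fun _ => rfl, fun _ _ _ => rfl, ?_, fun _ _ _ _ => rfl⟩
    intro f hf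
    obtain ⟨b, l, hl, h⟩ := Readable.affine In {q | ∃ i < 0, ∃ r, q = wk i r} f hf
    exact ⟨b, l, fun q hq => Or.inl (hl q hq), h⟩
  | @step c V W u v hE hu hv ih =>
    obtain ⟨σ, τ, hσ, hτ, hτσ, hfix, hread, hδ⟩ := ih hV
      (fun i hi r i' r' hi' => hinj i (hi.trans c.lt_succ_self) r i' r'
        (hi'.trans c.lt_succ_self)) fun i hi => hIn i (hi.trans c.lt_succ_self)
    obtain ⟨bu, lu, hlu, hu'⟩ := hread u hu
    obtain ⟨bv, lv, hlv, hv'⟩ := hread v hv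
    have hnew : ∀ r, ∀ q ∈ In ∪ {q | ∃ i < c, ∃ r, q = wk i r}, q ≠ wk c r := by
      rintro r q (hq | ⟨i, hi, r', rfl⟩) h
      · exact hIn c c.lt_succ_self r (h ▸ hq)
      · have := (hinj i (hi.trans c.lt_succ_self) r' c r c.lt_succ_self h).1
        omega
    have hne : ∀ r r', r ≠ r' → wk c r ≠ wk c r' := fun r r' h h' =>
      h (hinj c c.lt_succ_self r c r' c.lt_succ_self h').2
    have h01 := hne 0 1 (by decide)
    have h02 := hne 0 2 (by decide)
    have h12 := hne 1 2 (by decide)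
    set A := wk c 0
    set B := wk c 1
    set C := wk c 2
    have gA := Impl.addAffine A bu lu fun q hq => hnew 0 q (hlu q hq)
    have gB := Impl.addAffine B bv lv fun q hq => hnew 1 q (hlv q hq)
    have gC := Impl.toffoli A B C h01 h02 h12
    set fA := fun y : κ → Bool => Function.update y A
      (y A ^^ decide (ind bu + (lu.map fun q => ind (y q)).sum = 1)) with hfA
    set fB := fun y : κ → Bool => Function.update y B
      (y B ^^ decide (ind bv + (lv.map fun q => ind (y q)).sum = 1)) with hfB
    set fC := fun y : κ → Bool => Function.update y C (Bool.xor (y A && y B) (y C)) with hfC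
    have sumA : ∀ (y : κ → Bool) (l : List κ) (r : Fin 3) (b : Bool),
        (∀ q ∈ l, q ∈ In ∪ {q | ∃ i < c, ∃ r, q = wk i r}) →
        (l.map fun q => ind (Function.update y (wk c r) b q)) = l.map fun q => ind (y q) := by
      intro y l r b hl
      refine List.map_congr_left fun q hq => ?_
      rw [Function.update_of_ne (hnew r q (hl q hq))]
    have iA : ∀ y, fA (fA y) = y := fun y => by
      simp only [hfA]; rw [sumA _ _ _ _ hlu]; simp
    have iB : ∀ y, fB (fB y) = y := fun y => by
      simp only [hfB]; rw [sumA _ _ _ _ hlv]; simp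
    have iC : ∀ y, fC (fC y) = y := fun y => by
      simp [hfC, Function.update_of_ne h02, Function.update_of_ne h12]
    have fixAll : ∀ y q, (∀ r, q ≠ wk c r) → fC (fB (fA y)) q = y q := fun y q hq => by
      simp only [hfA, hfB, hfC]
      rw [Function.update_of_ne (hq 2), Function.update_of_ne (hq 1), Function.update_of_ne (hq 0)]
    refine ⟨fC ∘ fB ∘ fA ∘ σ, τ ∘ fA ∘ fB ∘ fC, ?_, ?_, ?_, ?_, ?_, ?_⟩
    · convert gC.comp (gB.comp (gA.comp hσ)) using 1; omega
    · convert hτ.comp (gA.comp (gB.comp gC)) using 1; omega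
    · intro y; simp [Function.comp, iA, iB, iC, hτσ]
    · intro y q hq
      simp only [Function.comp]
      rw [fixAll _ _ (hq c c.lt_succ_self), hfix y q fun i hi => hq i (hi.trans c.lt_succ_self)]
    · intro f hf
      obtain ⟨f₀, hf₀, g, hg, rfl⟩ := Submodule.mem_sup.1 hf
      obtain ⟨z, rfl⟩ := Submodule.mem_span_singleton.1 hg
      obtain ⟨b, l, hl, h⟩ := hread f₀ hf₀
      have hmem : ∀ q ∈ In ∪ {q | ∃ i < c, ∃ r, q = wk i r},
          q ∈ In ∪ {q | ∃ i < c + 1, ∃ r, q = wk i r} := by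
        rintro q (hq | ⟨i, hi, r, rfl⟩)
        exacts [Or.inl hq, Or.inr ⟨i, hi.trans c.lt_succ_self, r, rfl⟩]
      have hclean : ∀ y : κ → Bool, (∀ q ∈ {q | ∃ i < c + 1, ∃ r, q = wk i r}, y q = false) →
          ∀ q ∈ {q | ∃ i < c, ∃ r, q = wk i r}, y q = false := by
        rintro y hy q ⟨i, hi, r, rfl⟩
        exact hy _ ⟨i, hi.trans c.lt_succ_self, r, rfl⟩
      have hl' : ∀ y, (l.map fun q => ind ((fC ∘ fB ∘ fA ∘ σ) y q)) =
          l.map fun q => ind (σ y q) := fun y => List.map_congr_left fun q hq => by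
        simp only [Function.comp]; rw [fixAll _ _ fun r => hnew r q (hl q hq)]
      obtain rfl | rfl : z = 0 ∨ z = 1 := (by decide : ∀ z : ZMod 2, z = 0 ∨ z = 1) z
      · refine ⟨b, l, fun q hq => hmem q (hl q hq), fun y hy => ?_⟩
        rw [hl' y, ← h y (hclean y hy)]; simp
      · refine ⟨b, C :: l, ?_, fun y hy => ?_⟩
        · intro q hq
          rcases List.mem_cons.1 hq with rfl | hq
          exacts [Or.inr ⟨c, c.lt_succ_self, 2, rfl⟩, hmem q (hl q hq)]
        · rw [List.map_cons, hl' y, List.sum_cons]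
          have hw : ∀ r, σ y (wk c r) = false := fun r => by
            rw [hfix y _ fun i hi r' h => by
              have := (hinj c c.lt_succ_self r i r' (hi.trans c.lt_succ_self) h).1; omega]
            exact hy _ ⟨c, c.lt_succ_self, r, rfl⟩
          have hCval : ind ((fC ∘ fB ∘ fA ∘ σ) y C) = u y * v y := by
            rw [hu' y (hclean y hy), hv' y (hclean y hy)]
            simp only [Function.comp, hfA, hfB, hfC, Function.update_self,
              Function.update_of_ne h01, Function.update_of_ne h02.symm,
              Function.update_of_ne h12.symm, Function.update_of_ne h01.symm]
            rw [sumA _ _ 0 _ hlv]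
            rw [show σ y A = false from hw 0, show σ y B = false from hw 1,
              show σ y C = false from hw 2]
            simp only [Bool.false_xor, Bool.xor_false, ind_and, ind_decide_eq_one]
          rw [hCval, Pi.add_apply, h y (hclean y hy), Pi.smul_apply, one_smul, Pi.mul_apply]
          ring
    · intro y δ hd1 hd2
      simp only [Function.comp]
      rw [hδ y δ hd1 fun i hi => hd2 i (hi.trans c.lt_succ_self)]
      have hdw : ∀ r, δ (wk c r) = false := hd2 c c.lt_succ_self
      have hdl : ∀ (y : κ → Bool) (l : List κ),
          (∀ q ∈ l, q ∈ In ∪ {q | ∃ i < c, ∃ r, q = wk i r}) →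
          (l.map fun q => ind (y q ^^ δ q)) = l.map fun q => ind (y q) := by
        intro y l hl
        refine List.map_congr_left fun q hq => ?_
        have : δ q = false := by
          rcases hl q hq with h | ⟨i, hi, r, rfl⟩
          exacts [hd1 q h, hd2 i (hi.trans c.lt_succ_self) r]
        simp [this]
      have upd : ∀ (y : κ → Bool) r b, Function.update (fun q => y q ^^ δ q) (wk c r) b =
          fun q => Function.update y (wk c r) b q ^^ δ q := by
        intro y r b; ext q
        by_cases hq : q = wk c r
        · subst hq; simp [hdw]
        · simp [Function.update_of_ne hq]
      have cA : ∀ y, fA (fun q => y q ^^ δ q) = fun q => fA y q ^^ δ q := fun y => by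
        simp only [hfA]
        rw [upd, hdl _ _ hlu, show δ A = false from hdw 0]; simp; rfl
      have cB : ∀ y, fB (fun q => y q ^^ δ q) = fun q => fB y q ^^ δ q := fun y => by
        simp only [hfB]
        rw [upd, hdl _ _ hlv, show δ B = false from hdw 1]; simp; rfl
      have cC : ∀ y, fC (fun q => y q ^^ δ q) = fun q => fC y q ^^ δ q := fun y => by
        simp only [hfC]
        rw [upd, show δ A = false from hdw 0, show δ B = false from hdw 1,
          show δ C = false from hdw 2]; simp; rfl
      rw [cA, cB, cC]

/-- A family of functions of the qubits `In` that is computed with `c` AND gates can be added to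
other qubits with `14 c` many `T` gates: the functions are computed into the work space, added by
CNOT gates, and uncomputed. -/
theorem Ext.exists_circuit {c : ℕ} {In : Set κ} {W : Submodule (ZMod 2) ((κ → Bool) → ZMod 2)}
    (hE : Ext c (affine In) W) (wk : ℕ → Fin 3 → κ)
    (hinj : ∀ i < c, ∀ r i' r', i' < c → wk i r = wk i' r' → i = i' ∧ r = r')
    (hIn : ∀ i < c, ∀ r, wk i r ∉ In) (f : κ → (κ → Bool) → ZMod 2) (hf : ∀ q, f q ∈ W)
    (hsupp : ∀ q, q ∈ In ∨ (∃ i < c, ∃ r, q = wk i r) → f q = 0) :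
    ∃ C : Circuit κ, Circuit.tCount C ≤ 14 * c ∧
      ∀ y : κ → Bool, (∀ i < c, ∀ r, y (wk i r) = false) →
        Circuit.mat C *ᵥ ket y = ket (addFun f y) := by
  classical
  obtain ⟨σ, τ, hσ, hτ, hτσ, hfix, hread, hδ⟩ := hE.exists_compute rfl wk hinj hIn
  choose b l hl h using fun q => hread (f q) (hf q)
  set ts : List κ := (Finset.univ.filter fun q => f q ≠ 0).toList with hts
  have hmem : ∀ q, q ∈ ts ↔ f q ≠ 0 := fun q => by simp [hts]
  have hadd := Impl.addAffines b l ts (Finset.nodup_toList _) (by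
    intro t _ q hq hq'
    rcases hl t q hq with h | ⟨i, hi, r, rfl⟩
    · exact (hmem q).1 hq' (hsupp q (Or.inl h))
    · exact (hmem _).1 hq' (hsupp _ (Or.inr ⟨i, hi, r, rfl⟩)))
  obtain ⟨C, hC, hC'⟩ := hτ.comp (hadd.comp hσ)
  refine ⟨C, by omega, fun y hy => ?_⟩
  rw [hC' y]
  congr 1
  have e1 : (fun t => σ y t ^^ decide (t ∈ ts ∧
      ind (b t) + ((l t).map fun q => ind (σ y q)).sum = 1)) =
      fun t => σ y t ^^ decide (f t y = 1) := by
    ext t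
    rw [← h t y (by rintro q ⟨i, hi, r, rfl⟩; exact hy i hi r)]
    by_cases h0 : f t = 0 <;> simp [hmem, h0]
  have e2 := hδ y (fun q => decide (f q y = 1))
    (fun q hq => by simp [hsupp q (Or.inl hq)])
    (fun i hi r => by simp [hsupp _ (Or.inr ⟨i, hi, r, rfl⟩)])
  simp only [Function.comp]
  rw [e1, ← e2, hτσ]
  rfl

end Compile

/-! ### Products of creation and annihilation operators -/

section Ladder

variable {n k : ℕ}

/-- The sign `(-1)^b`. -/
def sg (b : Bool) : ℂ := if b then -1 else 1

theorem sg_xor (a b : Bool) : sg (a ^^ b) = sg a * sg b := by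
  cases a <;> cases b <;> simp [sg]

theorem neg_one_pow_eq_sg (m : ℕ) : (-1 : ℂ) ^ m = sg (decide (m % 2 = 1)) := by
  rcases Nat.even_or_odd m with h | h
  · simp [h.neg_one_pow, sg, Nat.even_iff.1 h]
  · simp [h.neg_one_pow, sg, Nat.odd_iff.1 h]

theorem norm_sg (b : Bool) : ‖sg b‖ = 1 := by cases b <;> simp [sg]

theorem sg_ne_zero (b : Bool) : sg b ≠ 0 := by cases b <;> simp [sg]

/-- The creation operator (`b = true`) or annihilation operator (`b = false`) of an orbital. -/
noncomputable def ladder (b : Bool) (q : Fin n) : Matrix (Fin n → Bool) (Fin n → Bool) ℂ :=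
  if b then create q else annihilate q

theorem occupiedBelow_update (j : Fin n → Bool) (q : Fin n) (b : Bool) :
    occupiedBelow (Function.update j q b) q = occupiedBelow j q := by
  unfold occupiedBelow
  congr 1
  ext l
  simp only [Finset.mem_filter, Finset.mem_univ, true_and]
  refine and_congr_right fun h => ?_
  rw [Function.update_of_ne h.ne]

theorem ladder_ket (b : Bool) (q : Fin n) (j : Fin n → Bool) :
    ladder b q *ᵥ ket j = (if j q = !b then sg (decide (occupiedBelow j q % 2 = 1)) else 0) •
      ket (Function.update j q b) := by
  rw [mulVec_ket]
  ext x
  rw [← neg_one_pow_eq_sg, Pi.smul_apply, ket_apply, smul_eq_mul]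
  cases b
  · simp only [ladder, annihilate, Matrix.of_apply, Bool.false_eq_true, if_false, Bool.not_false]
    by_cases h : j q = true <;> simp [h]
  · have key : x q = true ∧ j = Function.update x q false ↔
        j q = false ∧ x = Function.update j q true := by
      constructor
      · rintro ⟨h, rfl⟩
        simp [← h]
      · rintro ⟨h, rfl⟩
        simp [← h]
    simp only [ladder, create, annihilate, Matrix.conjTranspose_apply, Matrix.of_apply, if_true,
      key, Bool.not_true]
    by_cases h : j q = false
    · by_cases h' : x = Function.update j q true
      · simp [h, h', occupiedBelow_update]
      · simp [h, h']
    · simp [h]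

/-! The operators in a product are indexed by a flag, `true` for a creation operator, and by a
position; `r` assigns an orbital to each operator, and the head of a list is applied last. -/

/-- The orbitals that are flipped by a product of creation and annihilation operators. -/
def flips (r : Bool × Fin k → Fin n) : List (Bool × Fin k) → Fin n → Bool
  | [], _ => false
  | τ :: L, l => flips r L l ^^ decide (r τ = l)

/-- The state, up to a sign, that arises from `|j⟩`. -/
def moved (r : Bool × Fin k → Fin n) (L : List (Bool × Fin k)) (j : Fin n → Bool) : Fin n → Bool :=
  fun l => j l ^^ flips r L l

/-- Whether `|j⟩` is not annihilated by the product. -/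
def survives (r : Bool × Fin k → Fin n) (j : Fin n → Bool) : List (Bool × Fin k) → Bool
  | [] => true
  | τ :: L => survives r j L && (moved r L j (r τ) ^^ τ.1)

/-- Whether the sign of the image of `|j⟩` is negative. -/
def negative (r : Bool × Fin k → Fin n) (j : Fin n → Bool) : List (Bool × Fin k) → Bool
  | [] => false
  | τ :: L => negative r j L ^^ decide (occupiedBelow (moved r L j) (r τ) % 2 = 1)

theorem moved_cons (r : Bool × Fin k → Fin n) (τ : Bool × Fin k) (L : List (Bool × Fin k))
    (j : Fin n → Bool) :
    moved r (τ :: L) j = Function.update (moved r L j) (r τ) (!(moved r L j (r τ))) := by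
  ext l
  by_cases h : r τ = l
  · subst h; simp [moved, flips]
  · rw [Function.update_of_ne (Ne.symm h)]; simp [moved, flips, h]

theorem prod_ladder_ket (r : Bool × Fin k → Fin n) (L : List (Bool × Fin k)) (j : Fin n → Bool) :
    (L.map fun τ => ladder τ.1 (r τ)).prod *ᵥ ket j =
      (if survives r j L then sg (negative r j L) else 0) • ket (moved r L j) := by
  induction L with
  | nil =>
    have : moved r [] j = j := by ext l; simp [moved, flips]
    simp [survives, negative, sg, this]
  | cons τ L ih =>
    rw [List.map_cons, List.prod_cons, ← Matrix.mulVec_mulVec, ih, Matrix.mulVec_smul, ladder_ket,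
      moved_cons, smul_smul]
    by_cases h : moved r L j (r τ) = !τ.1
    · simp only [survives, negative, h, sg_xor, if_true]
      by_cases h' : survives r j L = true <;> simp [h']
    · have h2 : moved r L j (r τ) = τ.1 := by
        revert h; cases moved r L j (r τ) <;> cases τ.1 <;> simp
      simp [survives, h2]

/-- The positions of the operators in a `k`-body monomial. -/
def positions (k : ℕ) : List (Bool × Fin k) :=
  (List.ofFn fun t => (true, t)) ++ List.ofFn fun t => (false, t)

/-- The orbitals of the operators in a `k`-body monomial. -/
def orbitals (P Q : Fin k → Fin n) (τ : Bool × Fin k) : Fin n := if τ.1 then P τ.2 else Q τ.2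

theorem monomial_ket (P Q : Fin k → Fin n) (j : Fin n → Bool) :
    monomial P Q *ᵥ ket j =
      (if survives (orbitals P Q) j (positions k) then
        sg (negative (orbitals P Q) j (positions k)) else 0) •
      ket (moved (orbitals P Q) (positions k) j) := by
  rw [← prod_ladder_ket]
  congr 1
  simp [monomial, positions, orbitals, ladder, List.map_ofFn, Function.comp_def]

theorem monomial_apply (P Q : Fin k → Fin n) (x j : Fin n → Bool) :
    monomial P Q x j = if survives (orbitals P Q) j (positions k) = true ∧
        x = moved (orbitals P Q) (positions k) j then
      sg (negative (orbitals P Q) j (positions k)) else 0 := by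
  have := congrFun (monomial_ket P Q j) x
  rw [mulVec_ket] at this
  refine this.trans ?_
  rw [Pi.smul_apply, ket_apply, smul_eq_mul]
  by_cases h : survives (orbitals P Q) j (positions k) = true <;> simp [h]

theorem monomial_ne_zero_iff (P Q : Fin k → Fin n) (x j : Fin n → Bool) :
    monomial P Q x j ≠ 0 ↔ survives (orbitals P Q) j (positions k) = true ∧
      x = moved (orbitals P Q) (positions k) j := by
  rw [monomial_apply]
  split_ifs with h <;> simp [h, sg_ne_zero]

theorem monomial_ket_eq_zero_iff (P Q : Fin k → Fin n) (j : Fin n → Bool) :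
    monomial P Q *ᵥ ket j = 0 ↔ survives (orbitals P Q) j (positions k) = false := by
  rw [monomial_ket]
  have : ket (moved (orbitals P Q) (positions k) j) ≠ 0 := by
    simp [ket]
  by_cases h : survives (orbitals P Q) j (positions k) = true
  · simp [h, this, sg_ne_zero]
  · simp [h]

theorem norm_monomial_apply_le (P Q : Fin k → Fin n) (x j : Fin n → Bool) :
    ‖monomial P Q x j‖ ≤ 1 := by
  rw [monomial_apply]; split_ifs <;> simp [norm_sg]

theorem flips_append (r : Bool × Fin k → Fin n) (L L' : List (Bool × Fin k)) (l : Fin n) :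
    flips r (L ++ L') l = (flips r L' l ^^ flips r L l) := by
  induction L with
  | nil => simp [flips]
  | cons τ L ih => simp [flips, ih]

theorem moved_append (r : Bool × Fin k → Fin n) (L L' : List (Bool × Fin k)) (j : Fin n → Bool) :
    moved r (L ++ L') j = moved r L (moved r L' j) := by
  ext l; simp [moved, flips_append]

theorem survives_append (r : Bool × Fin k → Fin n) (L L' : List (Bool × Fin k))
    (j : Fin n → Bool) :
    survives r j (L ++ L') = (survives r j L' && survives r (moved r L' j) L) := by
  induction L with
  | nil => simp [survives]
  | cons τ L ih => simp [survives, ih, moved_append, Bool.and_assoc]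

theorem survives_annihilation (r : Bool × Fin k → Fin n) (L : List (Bool × Fin k))
    (hL : ∀ τ ∈ L, τ.1 = false) (j : Fin n → Bool) (h : survives r j L = true) :
    (∀ l, moved r L j l = true → j l = true) ∧ ∀ τ ∈ L, j (r τ) = true := by
  induction L with
  | nil => simp [moved, flips]
  | cons τ L ih =>
    simp only [survives, Bool.and_eq_true, hL τ (List.mem_cons_self ..), Bool.xor_false] at h
    obtain ⟨h1, h2⟩ := ih (fun τ hτ => hL τ (List.mem_cons_of_mem _ hτ)) h.1
    refine ⟨fun l hl => ?_, fun τ' hτ' => ?_⟩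
    · rw [moved_cons] at hl
      by_cases hq : l = r τ
      · subst hq; simp [h.2] at hl
      · rw [Function.update_of_ne hq] at hl; exact h1 l hl
    · rcases List.mem_cons.1 hτ' with rfl | hτ'
      exacts [h1 _ h.2, h2 _ hτ']

theorem survives_creation (r : Bool × Fin k → Fin n) (L : List (Bool × Fin k))
    (hL : ∀ τ ∈ L, τ.1 = true) (j : Fin n → Bool) (h : survives r j L = true) :
    ∀ τ ∈ L, moved r L j (r τ) = true := by
  induction L with
  | nil => simp
  | cons τ L ih =>
    simp only [survives, Bool.and_eq_true, hL τ (List.mem_cons_self ..), Bool.xor_true,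
      Bool.not_eq_true'] at h
    have h2 := ih (fun τ hτ => hL τ (List.mem_cons_of_mem _ hτ)) h.1
    intro τ' hτ'
    rw [moved_cons]
    by_cases hq : r τ' = r τ
    · rw [hq]; simp [h.2]
    · rw [Function.update_of_ne hq]
      rcases List.mem_cons.1 hτ' with rfl | hτ'
      exacts [absurd rfl hq, h2 _ hτ']

theorem particles_update_true (j : Fin n → Bool) (q : Fin n) (h : j q = false) :
    particles (Function.update j q true) = particles j + 1 := by
  unfold particles
  rw [← Finset.card_insert_of_notMem (a := q) (by simp [h])]
  congr 1
  ext l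
  by_cases hl : l = q
  · subst hl; simp
  · simp [hl]

theorem particles_update_false (j : Fin n → Bool) (q : Fin n) (h : j q = true) :
    particles (Function.update j q false) + 1 = particles j := by
  rw [← particles_update_true _ q (by simp), Function.update_idem, ← h, Function.update_eq_self]

theorem particles_moved (r : Bool × Fin k → Fin n) (L : List (Bool × Fin k)) (j : Fin n → Bool)
    (h : survives r j L = true) :
    particles (moved r L j) + L.countP (fun τ => !τ.1) =
      particles j + L.countP (fun τ => τ.1) := by
  induction L with
  | nil =>
    have : moved r [] j = j := by ext l; simp [moved, flips]
    simp [this]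
  | cons τ L ih =>
    simp only [survives, Bool.and_eq_true] at h
    have ih := ih h.1
    rw [moved_cons, List.countP_cons, List.countP_cons]
    have h2 := h.2
    cases hm : moved r L j (r τ)
    · have hτ : τ.1 = true := by rw [hm] at h2; simpa using h2
      have := particles_update_true _ _ hm
      simp [hτ] at *; omega
    · have hτ : τ.1 = false := by rw [hm] at h2; simpa using h2
      have := particles_update_false _ _ hm
      simp [hτ] at *; omega

theorem particles_of_monomial_ne_zero {P Q : Fin k → Fin n} {x j : Fin n → Bool}
    (h : monomial P Q x j ≠ 0) : particles x = particles j := by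
  obtain ⟨h', rfl⟩ := (monomial_ne_zero_iff ..).1 h
  replace h := h'
  have := particles_moved _ _ _ h
  have h1 : ∀ p : Bool, (List.ofFn fun t : Fin k => ((p, t) : Bool × Fin k)).countP
      (fun τ => τ.1) = if p then k else 0 := by
    intro p; cases p
    · simp [List.countP_eq_zero, List.mem_ofFn]
    · simp only [if_true]
      rw [List.countP_eq_length.2 (by simp [List.mem_ofFn]), List.length_ofFn]
  have h2 : ∀ p : Bool, (List.ofFn fun t : Fin k => ((p, t) : Bool × Fin k)).countP
      (fun τ => !τ.1) = if p then 0 else k := by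
    intro p; cases p
    · simp only [Bool.false_eq_true, if_false]
      rw [List.countP_eq_length.2 (by simp [List.mem_ofFn]), List.length_ofFn]
    · simp [List.countP_eq_zero, List.mem_ofFn]
  simp only [positions, List.countP_append, h1, h2] at this ⊢
  simpa using this

theorem occupied_of_monomial_ne_zero {P Q : Fin k → Fin n} {x j : Fin n → Bool}
    (h : monomial P Q x j ≠ 0) (t : Fin k) : j (Q t) = true ∧ x (P t) = true := by
  obtain ⟨h', rfl⟩ := (monomial_ne_zero_iff ..).1 h
  replace h := h'
  rw [positions, survives_append, Bool.and_eq_true] at h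
  constructor
  · have := (survives_annihilation _ _ (by simp [List.mem_ofFn]) _ h.1).2 (false, t)
      (by simp [List.mem_ofFn])
    simpa [orbitals] using this
  · have := survives_creation _ _ (by simp [List.mem_ofFn]) _ h.2 (true, t)
      (by simp [List.mem_ofFn])
    simpa [orbitals, positions, moved_append] using this

/-! The same data as Boolean functions: `o τ l` is the function that says whether the operator `τ`
belongs to the orbital `l`, and `G l` whether the orbital `l` is occupied. -/

variable {X : Type}

/-- The functions that compute `flips`. -/
def flipsF (o : Bool × Fin k → Fin n → X → ZMod 2) (L : List (Bool × Fin k)) (l : Fin n) :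
    X → ZMod 2 :=
  (L.map fun τ => o τ l).sum

/-- The function that computes `survives`. -/
def survivesF (o : Bool × Fin k → Fin n → X → ZMod 2) (G : Fin n → X → ZMod 2) :
    List (Bool × Fin k) → X → ZMod 2
  | [] => 1
  | τ :: L => survivesF o G L * ∑ l, o τ l * (G l + flipsF o L l + fun _ => ind τ.1)

/-- The function that computes `negative`. -/
def negativeF (o : Bool × Fin k → Fin n → X → ZMod 2) (G : Fin n → X → ZMod 2) :
    List (Bool × Fin k) → X → ZMod 2
  | [] => 0
  | τ :: L => negativeF o G L +
      ∑ l, o τ l * ∑ l' ∈ Finset.univ.filter (· < l), (G l' + flipsF o L l')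

theorem flipsF_mem {V : Submodule (ZMod 2) (X → ZMod 2)} {o : Bool × Fin k → Fin n → X → ZMod 2}
    (ho : ∀ τ l, o τ l ∈ V) (L : List (Bool × Fin k)) (l : Fin n) : flipsF o L l ∈ V :=
  list_sum_mem fun f hf => by
    obtain ⟨τ, -, rfl⟩ := List.mem_map.1 hf
    exact ho τ l

theorem Ext.ladder {V : Submodule (ZMod 2) (X → ZMod 2)} {o : Bool × Fin k → Fin n → X → ZMod 2}
    {G : Fin n → X → ZMod 2} (h1 : 1 ∈ V) (ho : ∀ τ l, o τ l ∈ V) (hG : ∀ l, G l ∈ V)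
    (L : List (Bool × Fin k)) :
    ∃ W, Ext (L.length * (2 * n + 1)) V W ∧ survivesF o G L ∈ W ∧ negativeF o G L ∈ W := by
  induction L with
  | nil => exact ⟨V, by simpa using Ext.refl V, h1, zero_mem V⟩
  | cons τ L ih =>
    obtain ⟨W, hW, hs, hn⟩ := ih
    obtain ⟨W₁, hW₁, hm₁⟩ := Ext.products (V := W)
      (fun l => o τ l * (G l + flipsF o L l + fun _ => ind τ.1)) fun l =>
        ⟨_, hW.le (ho τ l), _, hW.le (add_mem (add_mem (hG l) (flipsF_mem ho L l))
          (const_mem h1 _)), rfl⟩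
    obtain ⟨W₂, hW₂, hm₂⟩ := Ext.products (V := W₁)
      (fun l => o τ l * ∑ l' ∈ Finset.univ.filter (· < l), (G l' + flipsF o L l')) fun l =>
        ⟨_, hW₁.le (hW.le (ho τ l)), _, hW₁.le (hW.le (sum_mem fun l' _ =>
          add_mem (hG l') (flipsF_mem ho L l'))), rfl⟩
    obtain ⟨W₃, hW₃, hm₃⟩ := Ext.mul (hW₂.le (hW₁.le hs))
      (hW₂.le (sum_mem fun l (_ : l ∈ Finset.univ) => hm₁ l))
    refine ⟨W₃, ?_, hm₃, ?_⟩
    · have := ((hW.trans hW₁).trans hW₂).trans hW₃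
      simp only [Fintype.card_fin] at this
      refine this.mono (le_of_eq ?_)
      rw [List.length_cons]; ring
    · exact hW₃.le (add_mem (hW₂.le (hW₁.le hn)) (sum_mem fun l _ => hm₂ l))

variable {o : Bool × Fin k → Fin n → X → ZMod 2} {G : Fin n → X → ZMod 2} {x : X}
  {r : Bool × Fin k → Fin n} {j : Fin n → Bool}

theorem flipsF_apply (ho : ∀ τ l, o τ l x = ind (decide (r τ = l))) (L : List (Bool × Fin k))
    (l : Fin n) : flipsF o L l x = ind (flips r L l) := by
  induction L with
  | nil => simp [flipsF, flips]
  | cons τ L ih =>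
    rw [flips, ind_xor, ← ih, ← ho]
    simp [flipsF, add_comm]

theorem survivesF_apply (ho : ∀ τ l, o τ l x = ind (decide (r τ = l)))
    (hG : ∀ l, G l x = ind (j l)) (L : List (Bool × Fin k)) :
    survivesF o G L x = ind (survives r j L) := by
  induction L with
  | nil => simp [survivesF, survives]
  | cons τ L ih =>
    rw [survives, ind_and, ← ih, survivesF, Pi.mul_apply, Finset.sum_apply]
    congr 1
    rw [Finset.sum_eq_single (r τ)]
    · simp [ho, hG, flipsF_apply ho, ind_xor, moved, add_assoc]
    · intro l _ hl; simp [ho, hl.symm]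
    · simp

theorem survivesF_eq_zero {τ : Bool × Fin k} (ho : ∀ l, o τ l x = 0) {L : List (Bool × Fin k)}
    (hτ : τ ∈ L) : survivesF o G L x = 0 := by
  induction L with
  | nil => simp at hτ
  | cons τ' L ih =>
    rw [survivesF, Pi.mul_apply]
    rcases List.mem_cons.1 hτ with rfl | hτ
    · simp [Finset.sum_apply, ho]
    · rw [ih hτ, zero_mul]

theorem sum_ind_eq_card {ι : Type*} (s : Finset ι) (f : ι → Bool) :
    ∑ l ∈ s, ind (f l) = ind (decide ((s.filter fun l => f l = true).card % 2 = 1)) := by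
  have h1 : ∑ l ∈ s, ind (f l) = ((s.filter fun l => f l = true).card : ZMod 2) := by
    rw [Finset.card_filter, Nat.cast_sum]
    refine Finset.sum_congr rfl fun l _ => ?_
    cases f l <;> simp
  rw [h1]
  generalize (s.filter fun l => f l = true).card = m
  rcases Nat.even_or_odd m with h | h
  · rw [(ZMod.natCast_eq_zero_iff_even).2 h]; simp [Nat.even_iff.1 h]
  · rw [(ZMod.natCast_eq_one_iff_odd).2 h]; simp [Nat.odd_iff.1 h]

theorem negativeF_apply (ho : ∀ τ l, o τ l x = ind (decide (r τ = l)))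
    (hG : ∀ l, G l x = ind (j l)) (L : List (Bool × Fin k)) :
    negativeF o G L x = ind (negative r j L) := by
  induction L with
  | nil => simp [negativeF, negative]
  | cons τ L ih =>
    rw [negative, ind_xor, ← ih, negativeF, Pi.add_apply, Finset.sum_apply]
    congr 1
    rw [Finset.sum_eq_single (r τ)]
    · simp only [Pi.mul_apply, ho, decide_true, ind_true, one_mul, Finset.sum_apply, Pi.add_apply,
        hG, flipsF_apply ho, ← ind_xor]
      rw [sum_ind_eq_card, occupiedBelow, Finset.filter_filter]
      rfl
    · intro l _ hl; simp [ho, hl.symm]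
    · simp

end Ladder

/-! ### Layers of Hadamard gates -/

section Hadamards

theorem eq_extend_iff {κ β : Type} {g : β → κ} (hg : Function.Injective g) (y z : κ → Bool)
    (s : β → Bool) :
    z = Function.extend g s y ↔ (∀ q, (∀ b, g b ≠ q) → z q = y q) ∧ s = z ∘ g := by
  constructor
  · rintro rfl
    refine ⟨fun q hq => Function.extend_apply' _ _ _ ?_, ?_⟩
    · rintro ⟨b, hb⟩; exact hq b hb
    · ext b; simp [hg.extend_apply]
  · rintro ⟨h, rfl⟩
    ext q
    by_cases hq : ∃ b, g b = q
    · obtain ⟨b, rfl⟩ := hq; simp [hg.extend_apply]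
    · rw [Function.extend_apply' _ _ _ hq]
      exact h q fun b hb => hq ⟨b, hb⟩

variable {κ : Type} [Fintype κ] [DecidableEq κ]

theorem hadamards_apply (L : List κ) (hL : L.Nodup) (x y : κ → Bool) :
    Circuit.mat (L.map Gate.hadamard) x y =
      if ∀ r, r ∉ L → x r = y r then
        (L.map fun q => sg (x q && y q)).prod / (Real.sqrt 2 : ℂ) ^ L.length
      else 0 := by
  induction L generalizing y with
  | nil => simp [Circuit.mat, Matrix.one_apply, funext_iff]
  | cons q L ih =>
    have hn := List.nodup_cons.1 hL
    have h := congrFun (mulVec_ket (Circuit.mat ((q :: L).map Gate.hadamard)) y) x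
    refine h.symm.trans ?_
    rw [List.map_cons, Circuit.mat, ← Matrix.mulVec_mulVec, hadamard_ket, Matrix.mulVec_smul,
      Matrix.mulVec_add, Matrix.mulVec_smul, mulVec_ket, mulVec_ket]
    simp only [Pi.smul_apply, Pi.add_apply, smul_eq_mul]
    rw [ih hn.2, ih hn.2]
    have key : ∀ b, (∀ r, r ∉ L → x r = Function.update y q b r) ↔
        (∀ r, r ∉ q :: L → x r = y r) ∧ x q = b := by
      intro b
      constructor
      · intro h
        refine ⟨fun r hr => ?_, by simpa using h q hn.1⟩
        rw [List.mem_cons, not_or] at hr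
        rw [h r hr.2, Function.update_of_ne hr.1]
      · rintro ⟨h, h'⟩ r hr
        by_cases hq : r = q
        · subst hq; simpa using h'
        · rw [Function.update_of_ne hq]
          exact h r (by simp [hq, hr])
    have hprod : ∀ b, (L.map fun r => sg (x r && Function.update y q b r)) =
        L.map fun r => sg (x r && y r) := fun b => List.map_congr_left fun r hr => by
      rw [Function.update_of_ne]
      rintro rfl
      exact hn.1 hr
    simp only [key, hprod, List.map_cons, List.prod_cons, List.length_cons, pow_succ]
    by_cases hx : ∀ r, r ∉ q :: L → x r = y r
    · simp only [eq_true hx, true_and, if_true]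
      cases h1 : x q <;> cases h2 : y q <;> simp [sg] <;> field_simp
    · simp only [eq_false hx, false_and, if_false, mul_zero, add_zero]

/-- Hadamard gates on the qubits in the range of `g` turn a basis state into a uniform
superposition, up to signs, of the basis states that agree with it on the other qubits. -/
theorem hadamards_ket {β : Type} [Fintype β] [DecidableEq β] {g : β → κ}
    (hg : Function.Injective g) (L : List κ) (hL : L.Nodup) (hmem : ∀ q, q ∈ L ↔ ∃ b, g b = q)
    (y : κ → Bool) :
    Circuit.mat (L.map Gate.hadamard) *ᵥ ket y =
      ∑ s : β → Bool, ((∏ b, sg (s b && y (g b))) / (Real.sqrt 2 : ℂ) ^ Fintype.card β) •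
        ket (Function.extend g s y) := by
  have hset : L.toFinset = Finset.univ.image g := by ext q; simp [hmem]
  have hlen : L.length = Fintype.card β := by
    rw [← List.toFinset_card_of_nodup hL, hset, Finset.card_image_of_injective _ hg,
      Finset.card_univ]
  rw [mulVec_ket]
  ext z
  rw [hadamards_apply L hL, Finset.sum_apply]
  simp only [Pi.smul_apply, ket_apply, eq_extend_iff hg, smul_eq_mul]
  have hcond : (∀ r, r ∉ L → z r = y r) ↔ ∀ q, (∀ b, g b ≠ q) → z q = y q := by
    simp only [hmem, not_exists, ne_eq]
  simp only [hcond]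
  by_cases h : ∀ q, (∀ b, g b ≠ q) → z q = y q
  · rw [if_pos h, Finset.sum_eq_single (z ∘ g)]
    · rw [hlen, ← List.prod_toFinset _ hL, hset, Finset.prod_image hg.injOn, if_pos ⟨h, rfl⟩]
      simp
    · intro s _ hs; simp [hs]
    · simp
  · rw [if_neg h]
    symm
    refine Finset.sum_eq_zero fun s _ => ?_
    rw [if_neg fun h' => h h'.1, mul_zero]

theorem hadamards_tCount {κ : Type} (L : List κ) :
    Circuit.tCount (L.map Gate.hadamard) = 0 := by
  induction L with
  | nil => rfl
  | cons q L ih => simpa [Circuit.tCount, Gate.tCount] using ih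

end Hadamards

/-! ### The layout of the qubits -/

section Layout

variable {k a e m c n : ℕ}

/-- The qubits of the circuit. The work qubits are a flag that is raised by invalid particle
labels, a qubit for phase kickback, and three qubits for each of `c` AND gates. -/
abbrev Wire (k a e m c n : ℕ) : Type := Anc k a e m (3 * c + 2) ⊕ Fin n

/-- The qubits for the AND gate number `i`. -/
def scratch (i : ℕ) (r : Fin 3) : Wire k a e m c n :=
  Sum.inl (Anc.work (Fin.ofNat (3 * c + 2) (3 * i + r + 2)))

/-- The flag for invalid particle labels. -/
def flag : Wire k a e m c n := Sum.inl (Anc.work 0)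

/-- The qubit for phase kickback. -/
def kick : Wire k a e m c n := Sum.inl (Anc.work 1)

theorem scratch_val {i : ℕ} (hi : i < c) (r : Fin 3) :
    (Fin.ofNat (3 * c + 2) (3 * i + r + 2)).val = 3 * i + r + 2 := by
  rw [Fin.val_ofNat]
  exact Nat.mod_eq_of_lt (by omega)

theorem scratch_injective {i : ℕ} (hi : i < c) (r : Fin 3) (i' : ℕ) (r' : Fin 3) (hi' : i' < c)
    (h : (scratch i r : Wire k a e m c n) = scratch i' r') : i = i' ∧ r = r' := by
  simp only [scratch, Sum.inl.injEq, Anc.work.injEq] at h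
  have := congrArg Fin.val h
  rw [scratch_val hi, scratch_val hi'] at this
  exact ⟨by omega, by ext; omega⟩

theorem flag_ne_scratch {i : ℕ} (hi : i < c) (r : Fin 3) :
    (flag : Wire k a e m c n) ≠ scratch i r := by
  simp only [flag, scratch, ne_eq, Sum.inl.injEq, Anc.work.injEq]
  intro h
  have := congrArg Fin.val h
  rw [scratch_val hi] at this
  simp at this

theorem kick_ne_scratch {i : ℕ} (hi : i < c) (r : Fin 3) :
    (kick : Wire k a e m c n) ≠ scratch i r := by
  simp only [kick, scratch, ne_eq, Sum.inl.injEq, Anc.work.injEq]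
  intro h
  have := congrArg Fin.val h
  rw [scratch_val hi] at this
  simp at this

/-- The basis state with the given contents of the registers and the flag, all other work qubits
being clean. -/
def st (P I Q : Fin k → ℕ) (v : Bool) (s : Fin m → Bool) (fl : Bool) (j : Fin n → Bool) :
    Wire k a e m c n → Bool :=
  Sum.elim
    (fun r => match r with
      | .p t b => (P t).testBit b
      | .i t b => (I t).testBit b
      | .q t b => (Q t).testBit b
      | .valid => v
      | .amp b => s b
      | .work b => decide (b = 0) && fl)
    j

theorem config_eq_st (P I Q : Fin k → ℕ) (v : Bool) (s : Fin m → Bool) (j : Fin n → Bool) :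
    (config P I Q v s j : Wire k a e m c n → Bool) = st P I Q v s false j := by
  ext r
  rcases r with r | l
  · cases r <;> simp [config, st]
  · rfl

theorem st_scratch (P I Q : Fin k → ℕ) (v : Bool) (s : Fin m → Bool) (fl : Bool)
    (j : Fin n → Bool) {i : ℕ} (hi : i < c) (r : Fin 3) :
    (st P I Q v s fl j : Wire k a e m c n → Bool) (scratch i r) = false := by
  have : ¬ (Fin.ofNat (3 * c + 2) (3 * i + r + 2)) = 0 := fun h => by
    have := congrArg Fin.val h
    rw [scratch_val hi] at this
    simp at this
  change (decide (_ = 0) && fl) = false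
  rw [decide_eq_false this, Bool.false_and]

/-- Every basis state with clean work space is given by the contents of its registers. -/
theorem exists_eq_st (y : Wire k a e m c n → Bool)
    (hy : ∀ b, b ≠ 0 → y (Sum.inl (Anc.work b)) = false) :
    ∃ P I Q : Fin k → ℕ, y = st P I Q (y (Sum.inl Anc.valid)) (fun b => y (Sum.inl (Anc.amp b)))
      (y flag) (fun l => y (Sum.inr l)) := by
  refine ⟨fun t => Nat.ofBits fun b => y (Sum.inl (Anc.p t b)),
    fun t => Nat.ofBits fun b => y (Sum.inl (Anc.i t b)),
    fun t => Nat.ofBits fun b => y (Sum.inl (Anc.q t b)), ?_⟩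
  ext r
  rcases r with r | l
  · cases r with
    | work b =>
      by_cases hb : b = 0
      · subst hb; simp [st, flag]
      · simp [st, hb, hy b hb]
    | _ => simp [st]
  · rfl

/-- The functions in `W` can be added to other qubits. -/
theorem exists_add_circuit {In : Set (Wire k a e m c n)}
    {W : Submodule (ZMod 2) ((Wire k a e m c n → Bool) → ZMod 2)} (hE : Ext c (affine In) W)
    (hIn : ∀ b, Sum.inl (Anc.work b) ∉ In)
    (f : Wire k a e m c n → (Wire k a e m c n → Bool) → ZMod 2) (hf : ∀ q, f q ∈ W)
    (hsupp : ∀ q ∈ In, f q = 0) (hscr : ∀ i < c, ∀ r, f (scratch i r) = 0) :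
    ∃ C : Circuit (Wire k a e m c n), Circuit.tCount C ≤ 14 * c ∧
      ∀ y : Wire k a e m c n → Bool, (∀ i < c, ∀ r, y (scratch i r) = false) →
        Circuit.mat C *ᵥ ket y = ket (addFun f y) := by
  refine hE.exists_circuit scratch (fun i hi r i' r' hi' h => scratch_injective hi r i' r' hi' h)
    (fun i _ r => hIn _) f hf ?_
  rintro q (hq | ⟨i, hi, r, rfl⟩)
  exacts [hsupp q hq, hscr i hi r]

theorem Ext.congr_of_agree {κ : Type} {In : Set κ} {d : ℕ}
    {V W : Submodule (ZMod 2) ((κ → Bool) → ZMod 2)} (hE : Ext d V W) (hV : V = affine In)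
    {y y' : κ → Bool} (h : ∀ q ∈ In, y q = y' q) : ∀ f ∈ W, f y = f y' := by
  induction hE with
  | refl =>
    subst hV
    intro f hf
    induction hf using Submodule.span_induction with
    | mem f hf =>
      rcases hf with rfl | ⟨q, hq, rfl⟩
      · rfl
      · simp [coord, h q hq]
    | zero => rfl
    | add f g _ _ hf hg => simp [hf, hg]
    | smul r f _ hf => simp [hf]
  | step hE hu hv ih =>
    intro f hf
    obtain ⟨f₀, hf₀, g, hg, rfl⟩ := Submodule.mem_sup.1 hf
    obtain ⟨z, rfl⟩ := Submodule.mem_span_singleton.1 hg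
    simp [ih hV _ hf₀, ih hV _ hu, ih hV _ hv]

/-- A function in `W` can be turned into a phase: it is added to a clean qubit, which is acted upon
by the gate `Z = S²` and cleaned up. -/
theorem exists_phase_circuit {In : Set (Wire k a e m c n)}
    {W : Submodule (ZMod 2) ((Wire k a e m c n → Bool) → ZMod 2)} (hE : Ext c (affine In) W)
    (hIn : ∀ b, Sum.inl (Anc.work b) ∉ In)
    (f : (Wire k a e m c n → Bool) → ZMod 2) (hf : f ∈ W) :
    ∃ C : Circuit (Wire k a e m c n), Circuit.tCount C ≤ 28 * c ∧
      ∀ P I Q v s fl j, Circuit.mat C *ᵥ ket (st P I Q v s fl j) =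
        sg (decide (f (st P I Q v s fl j) = 1)) • ket (st P I Q v s fl j) := by
  obtain ⟨C, hC, hC'⟩ := exists_add_circuit hE hIn (fun q => if q = kick then f else 0)
    (fun q => by
      split_ifs
      exacts [hf, zero_mem W])
    (fun q hq => if_neg fun h => hIn 1 (by rw [h] at hq; exact hq))
    (fun i hi r => if_neg (kick_ne_scratch hi r).symm)
  refine ⟨C ++ [Gate.phaseS kick, Gate.phaseS kick] ++ C, ?_, fun P I Q v s fl j => ?_⟩
  · rw [Circuit.tCount_append, Circuit.tCount_append]
    have : Circuit.tCount [Gate.phaseS (kick : Wire k a e m c n), Gate.phaseS kick] = 0 := rfl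
    omega
  · set y : Wire k a e m c n → Bool := st P I Q v s fl j with hy
    have hclean : ∀ i < c, ∀ r, y (scratch i r) = false :=
      fun i hi r => st_scratch _ _ _ _ _ _ _ hi r
    set g : Wire k a e m c n → (Wire k a e m c n → Bool) → ZMod 2 :=
      fun q => if q = kick then f else 0 with hg
    have hk : y kick = false := by simp [hy, st, kick]
    have hne : ∀ q, q ≠ kick → addFun g y q = y q := fun q hq => by simp [addFun, hg, hq]
    have hkick : addFun g y kick = decide (f y = 1) := by simp [addFun, hg, hk]
    rw [Circuit.mat_append_mulVec, Circuit.mat_append_mulVec, hC' y hclean, IsPhase.pauliZ,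
      Matrix.mulVec_smul, hC' _ fun i hi r => by
        rw [hne _ (kick_ne_scratch hi r).symm]; exact hclean i hi r]
    have hfy : f (addFun g y) = f y := hE.congr_of_agree rfl (fun q hq => hne q fun h =>
      hIn 1 (by rw [h] at hq; exact hq)) f hf
    have hback : addFun g (addFun g y) = y := by
      ext q
      by_cases hq : q = kick
      · subst hq
        have h2 : addFun g (addFun g y) kick =
            (addFun g y kick ^^ decide (f (addFun g y) = 1)) := by
          conv_lhs => rw [addFun]
          simp [hg]
        rw [h2, hfy, hkick, hk, Bool.xor_self]
      · have h2 : addFun g (addFun g y) q = addFun g y q := by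
          conv_lhs => rw [addFun]
          simp [hg, hq]
        rw [h2, hne q hq]
    rw [hback]
    simp only [hkick]
    rfl

end Layout

/-! ### Addresses and labels of particles -/

section Address

variable {n : ℕ}

theorem occupiedBelow_lt_particles {j : Fin n → Bool} {q : Fin n} (h : j q = true) :
    occupiedBelow j q < particles j := by
  refine Finset.card_lt_card ⟨fun l hl => ?_, fun hs => ?_⟩
  · simp only [Finset.mem_filter, Finset.mem_univ, true_and] at hl ⊢
    exact hl.2
  · have := hs (x := q) (by simp [h])
    simp at this

theorem occupiedBelow_lt_of_lt {j : Fin n → Bool} {q q' : Fin n} (h : j q = true) (hlt : q < q') :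
    occupiedBelow j q < occupiedBelow j q' := by
  refine Finset.card_lt_card ⟨fun l hl => ?_, fun hs => ?_⟩
  · simp only [Finset.mem_filter, Finset.mem_univ, true_and] at hl ⊢
    exact ⟨hl.1.trans hlt, hl.2⟩
  · have := hs (x := q) (by simp [h, hlt])
    simp at this

theorem IsAddr.unique {j : Fin n → Bool} {i : ℕ} {q q' : Fin n} (h : IsAddr j i q)
    (h' : IsAddr j i q') : q = q' := by
  rcases lt_trichotomy q q' with hlt | rfl | hlt
  · have := occupiedBelow_lt_of_lt h.1 hlt
    rw [h.2, h'.2] at this; omega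
  · rfl
  · have := occupiedBelow_lt_of_lt h'.1 hlt
    rw [h.2, h'.2] at this; omega

theorem IsAddr.lt_particles {j : Fin n → Bool} {i : ℕ} {q : Fin n} (h : IsAddr j i q) :
    i < particles j := h.2 ▸ occupiedBelow_lt_particles h.1

theorem exists_isAddr {j : Fin n → Bool} {i : ℕ} (hi : i < particles j) : ∃ q, IsAddr j i q := by
  have hsurj := Finset.surjOn_of_injOn_of_card_le (s := Finset.univ.filter fun l => j l = true)
    (t := Finset.range (particles j)) (fun q => occupiedBelow j q)
    (fun q hq => by
      simp only [Finset.coe_filter, Finset.mem_univ, true_and, Set.mem_ofPred_eq] at hq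
      simpa using occupiedBelow_lt_particles hq)
    (fun q hq q' hq' h => by
      simp only [Finset.coe_filter, Finset.mem_univ, true_and, Set.mem_ofPred_eq] at hq hq'
      exact IsAddr.unique (j := j) ⟨hq, rfl⟩ ⟨hq', h.symm⟩)
    (by simp [particles])
  obtain ⟨q, hq, h⟩ := hsurj (by simpa using hi : i ∈ (Finset.range (particles j) : Set ℕ))
  exact ⟨q, by simpa using hq, h⟩

variable {X : Type}

/-- A family of functions that is indexed by orbitals, continued by zero. -/
def extendF (G : Fin n → X → ZMod 2) (l : ℕ) : X → ZMod 2 := if h : l < n then G ⟨l, h⟩ else 0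

theorem cnt_extendF {G : Fin n → X → ZMod 2} {x : X} {j : Fin n → Bool}
    (hG : ∀ l, G l x = ind (j l)) (l : Fin n) : cnt (extendF G) l x = occupiedBelow j l := by
  have hval : ∀ b : Bool, (ind b).val = if b = true then 1 else 0 := by decide
  have h1 : occupiedBelow j l =
      ∑ i : Fin n, if (i : ℕ) < l then (extendF G (i : ℕ) x).val else 0 := by
    rw [occupiedBelow, Finset.card_filter]
    refine Finset.sum_congr rfl fun i _ => ?_
    simp only [extendF, i.2, dif_pos, Fin.eta, hG, hval, Fin.lt_def]
    by_cases h : (i : ℕ) < l <;> simp [h]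
  rw [h1, Fin.sum_univ_eq_sum_range (fun i => if i < (l : ℕ) then (extendF G i x).val else 0) n,
    ← Finset.sum_filter, cnt]
  congr 1
  ext i
  simp only [Finset.mem_filter, Finset.mem_range]
  have := l.2
  omega

/-- The function that says whether the orbital `l` belongs to the particle with the label `N`,
labels being compared modulo `2 ^ e`. -/
def selF (G : Fin n → X → ZMod 2) (e : ℕ) (N : X → ℕ) (l : Fin n) : X → ZMod 2 :=
  fun x => G l x * ind (decide (cnt (extendF G) l x % 2 ^ e = N x % 2 ^ e))

theorem selF_apply {G : Fin n → X → ZMod 2} {e : ℕ} {N : X → ℕ} {x : X} {j : Fin n → Bool} {i : ℕ}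
    (hG : ∀ l, G l x = ind (j l)) (hj : particles j ≤ 2 ^ e) (hN : N x % 2 ^ e = i) (l : Fin n) :
    selF G e N l x = ind (j l && decide (occupiedBelow j l = i)) := by
  rw [selF, hG, cnt_extendF hG, hN, ind_and]
  cases h : j l
  · simp
  · rw [Nat.mod_eq_of_lt ((occupiedBelow_lt_particles h).trans_le hj)]

theorem sum_selF {G : Fin n → X → ZMod 2} {e : ℕ} {N : X → ℕ} {x : X} {j : Fin n → Bool} {i : ℕ}
    {q : Fin n} (hG : ∀ l, G l x = ind (j l)) (hj : particles j ≤ 2 ^ e) (hN : N x % 2 ^ e = i)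
    (hq : IsAddr j i q) (b : Fin n → Bool) :
    ∑ l, (if b l then selF G e N l else 0) x = ind (b q) := by
  rw [Finset.sum_eq_single q]
  · cases h : b q
    · simp
    · simp [selF_apply hG hj hN, hq.1, hq.2]
  · intro l _ hl
    split_ifs
    · rw [selF_apply hG hj hN]
      by_cases h : j l = true ∧ occupiedBelow j l = i
      · exact absurd (IsAddr.unique h hq) hl
      · have : (j l && decide (occupiedBelow j l = i)) = false := by
          rw [Bool.eq_false_iff]; simpa using h
        rw [this, ind_false]
    · rfl
  · simp

theorem selF_eq_zero {G : Fin n → X → ZMod 2} {e : ℕ} {N : X → ℕ} {x : X} {j : Fin n → Bool}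
    {i : ℕ} (hG : ∀ l, G l x = ind (j l)) (hj : particles j ≤ 2 ^ e) (hN : N x % 2 ^ e = i)
    (hi : particles j ≤ i) (l : Fin n) : selF G e N l x = 0 := by
  rw [selF_apply hG hj hN]
  cases h : j l
  · rfl
  · have := occupiedBelow_lt_particles h
    simp [show occupiedBelow j l ≠ i by omega]

variable {V : Submodule (ZMod 2) (X → ZMod 2)}

theorem extendF_mem {G : Fin n → X → ZMod 2} (hG : ∀ l, G l ∈ V) (l : ℕ) : extendF G l ∈ V := by
  rw [extendF]; split_ifs
  exacts [hG _, zero_mem V]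

theorem Ext.selF {k e : ℕ} {G : Fin n → X → ZMod 2} (h1 : 1 ∈ V) (hG : ∀ l, G l ∈ V)
    (N : Fin k → X → ℕ) (hN : ∀ t, ∀ b < e, bitF (N t) b ∈ V) :
    ∃ W, Ext (n * e + k * (n * (e + 1))) V W ∧ ∀ t l, selF G e (N t) l ∈ W := by
  obtain ⟨W, hW, hm⟩ := Ext.cnt (extendF G) (extendF_mem hG) n e
  obtain ⟨W', hW', hm'⟩ := Ext.family (c := n * (e + 1)) (V := W) Finset.univ
    (fun t : Fin k => Set.range fun l => EtaParticle.selF G e (N t) l) (by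
    intro t _
    obtain ⟨U, hU, hs⟩ := Ext.select (extendF G) (fun l => hW.le (extendF_mem hG l)) (hW.le h1) n e
      (N t) (fun b hb => hW.le (hN t b hb)) hm
    refine ⟨U, hU, ?_⟩
    rintro _ ⟨l, rfl⟩
    change EtaParticle.selF G e (N t) l ∈ U
    convert hs l l.2 using 1
    ext x
    simp [EtaParticle.selF, extendF])
  exact ⟨W', by simpa using hW.trans hW', fun t l => hm' t (Finset.mem_univ t) ⟨l, rfl⟩⟩

/-- The function that gives the `b`-th digit of the label of the particle in the orbital that is
encoded by `o`. -/
def rankF (G : Fin n → X → ZMod 2) (o : Fin n → X → ZMod 2) (b : ℕ) : X → ZMod 2 :=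
  ∑ l : Fin n, o l * bitF (cnt (extendF G) l) b

theorem rankF_apply {G : Fin n → X → ZMod 2} {o : Fin n → X → ZMod 2} {x : X} {j : Fin n → Bool}
    {q : Fin n} (hG : ∀ l, G l x = ind (j l)) (ho : ∀ l, o l x = ind (decide (q = l))) (b : ℕ) :
    rankF G o b x = ind ((occupiedBelow j q).testBit b) := by
  rw [rankF, Finset.sum_apply, Finset.sum_eq_single q]
  · simp [ho, bitF, cnt_extendF hG]
  · intro l _ hl; simp [ho, hl.symm]
  · simp

theorem Ext.rankF {k e : ℕ} {G : Fin n → X → ZMod 2} {o : Fin k → Fin n → X → ZMod 2}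
    (hG : ∀ l, G l ∈ V) (ho : ∀ t l, o t l ∈ V) :
    ∃ W, Ext (n * e + k * (n * e)) V W ∧ ∀ t, ∀ b : Fin e, rankF G (o t) b ∈ W := by
  obtain ⟨W, hW, hm⟩ := Ext.cnt (extendF G) (extendF_mem hG) n e
  obtain ⟨W', hW', hm'⟩ := Ext.products (V := W)
    (fun p : Fin k × Fin n × Fin e => o p.1 p.2.1 * bitF (EtaParticle.cnt (extendF G) p.2.1) p.2.2)
    fun p => ⟨_, hW.le (ho p.1 p.2.1), _, hm _ p.2.1.2.le _ p.2.2.2, rfl⟩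
  exact ⟨W', by simpa using hW.trans hW', fun t b => sum_mem fun l _ => hm' (t, l, b)⟩

end Address

/-! ### The occupation detection oracle -/

section Oracles

variable {k a e m c n : ℕ}

/-- The functions that read the occupations of the orbitals. -/
def occF (l : Fin n) : (Wire k a e m c n → Bool) → ZMod 2 := coord (Sum.inr l)

/-- The label register `t` as a number. -/
def labelN (t : Fin k) (y : Wire k a e m c n → Bool) : ℕ :=
  Nat.ofBits fun b => y (Sum.inl (Anc.i t b))

theorem labelN_st (t : Fin k) (P I Q : Fin k → ℕ) (v : Bool) (s : Fin m → Bool) (fl : Bool)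
    (j : Fin n → Bool) :
    labelN t (st P I Q v s fl j : Wire k a e m c n → Bool) = I t % 2 ^ e :=
  Nat.ofBits_testBit _ _

theorem bitF_labelN (t : Fin k) {b : ℕ} (hb : b < e) :
    bitF (labelN t) b = (coord (Sum.inl (Anc.i t ⟨b, hb⟩)) :
      (Wire k a e m c n → Bool) → ZMod 2) := by
  ext y
  simp [bitF, labelN, coord, hb]

/-- The functions that are added by the occupation detection circuit: addresses to the annihilation
index registers, and, if `raise` is set, the invalidity of some label to the flag. -/
def detectF (raise : Bool) : Wire k a e m c n → (Wire k a e m c n → Bool) → ZMod 2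
  | Sum.inl (Anc.q t b) => ∑ l : Fin n, if (l : ℕ).testBit b then selF occF e (labelN t) l else 0
  | Sum.inl (Anc.work b) => if b = 0 ∧ raise = true then
      1 + ∏ t ∈ Finset.range k, (if h : t < k then ∑ l, selF occF e (labelN ⟨t, h⟩) l else 1) else 0
  | _ => 0

theorem addFun_eq_st {P I Q P' I' Q' : Fin k → ℕ} {v v' : Bool} {s s' : Fin m → Bool}
    {fl fl' : Bool} {j j' : Fin n → Bool}
    {f : Wire k a e m c n → (Wire k a e m c n → Bool) → ZMod 2}
    (hP : ∀ t b, f (Sum.inl (Anc.p t b)) (st P I Q v s fl j) =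
      ind ((P t ^^^ P' t).testBit b))
    (hI : ∀ t b, f (Sum.inl (Anc.i t b)) (st P I Q v s fl j) =
      ind ((I t ^^^ I' t).testBit b))
    (hQ : ∀ t b, f (Sum.inl (Anc.q t b)) (st P I Q v s fl j) =
      ind ((Q t ^^^ Q' t).testBit b))
    (hv : f (Sum.inl Anc.valid) (st P I Q v s fl j) = ind (v ^^ v'))
    (hs : ∀ b, f (Sum.inl (Anc.amp b)) (st P I Q v s fl j) = ind (s b ^^ s' b))
    (hfl : f flag (st P I Q v s fl j) = ind (fl ^^ fl'))
    (hw : ∀ b, b ≠ 0 → f (Sum.inl (Anc.work b)) (st P I Q v s fl j) = 0)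
    (hj : ∀ l, f (Sum.inr l) (st P I Q v s fl j) = ind (j l ^^ j' l)) :
    addFun f (st P I Q v s fl j) = st P' I' Q' v' s' fl' j' := by
  ext r
  rw [addFun]
  rcases r with r | l
  · cases r with
    | p t b => rw [hP, decide_ind_eq_one]; simp [st]
    | i t b => rw [hI, decide_ind_eq_one]; simp [st]
    | q t b => rw [hQ, decide_ind_eq_one]; simp [st]
    | valid => rw [hv, decide_ind_eq_one]; simp [st]
    | amp b => rw [hs, decide_ind_eq_one]; simp [st]
    | work b =>
      by_cases hb : b = 0
      · subst hb
        have := hfl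
        rw [flag] at this
        rw [this, decide_ind_eq_one]; simp [st]
      · rw [hw b hb]; simp [st, hb]
  · rw [hj, decide_ind_eq_one]; simp [st]

/-- The occupation detection circuit: a counter runs through the orbitals and is compared with the
labels. -/
theorem exists_detect_circuit (raise : Bool) (hc : n * e + k * (n * (e + 1)) + k ≤ c) :
    ∃ C : Circuit (Wire k a e m c n), Circuit.tCount C ≤ 14 * c ∧
      (∀ (P I Q : Fin k → ℕ) (L : Fin k → Fin n) v s fl j, particles j ≤ 2 ^ e →
        (∀ t, IsAddr j (I t) (L t)) → Circuit.mat C *ᵥ ket (st P I Q v s fl j) =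
          ket (st P I (fun t => Q t ^^^ L t) v s fl j)) ∧
      (raise = true → ∀ (P I Q : Fin k → ℕ) v s fl j t, particles j ≤ 2 ^ e → I t < 2 ^ e →
        particles j ≤ I t → ∃ P' I' Q', Circuit.mat C *ᵥ ket (st P I Q v s fl j) =
          ket (st P' I' Q' v s (!fl) j)) ∧
      (raise = false → ∀ (P I Q : Fin k → ℕ) v s fl j, ∃ P' I' Q',
        Circuit.mat C *ᵥ ket (st P I Q v s fl j) = ket (st P' I' Q' v s fl j)) := by
  set In : Set (Wire k a e m c n) :=
    {q | (∃ t b, q = Sum.inl (Anc.i t b)) ∨ ∃ l, q = Sum.inr l} with hInd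
  have h1 := one_mem_affine In
  obtain ⟨W, hW, hm⟩ := Ext.selF (e := e) h1 (G := occF)
    (fun l => coord_mem_affine (Or.inr ⟨l, rfl⟩)) labelN
    (fun t b hb => by rw [bitF_labelN t hb]; exact coord_mem_affine (Or.inl ⟨t, _, rfl⟩))
  obtain ⟨W', hW', hm'⟩ := Ext.prod_range (V := W) (fun t => if h : t < k then
    ∑ l, EtaParticle.selF occF e (labelN ⟨t, h⟩) l else 1) k (hW.le h1) (fun t ht => by
      rw [dif_pos ht]; exact sum_mem fun l _ => hm _ l)
  have hIn : ∀ b, Sum.inl (Anc.work b) ∉ In := by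
    rintro b (⟨t, b, h⟩ | ⟨l, h⟩) <;> simp at h
  obtain ⟨C, hC, hC'⟩ := exists_add_circuit ((hW.trans hW').mono hc) hIn (detectF raise) (by
      rintro ((_ | _ | ⟨t, b⟩ | _ | _ | b) | _)
      all_goals try exact zero_mem W'
      · refine hW'.le (sum_mem fun l _ => ?_)
        split_ifs
        exacts [hm t l, zero_mem W]
      · simp only [detectF]
        split_ifs
        exacts [add_mem (hW'.le (hW.le h1)) hm', zero_mem W'])
    (by rintro q (⟨t, b, rfl⟩ | ⟨l, rfl⟩) <;> rfl)
    (by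
      intro i hi r
      have := (flag_ne_scratch (k := k) (a := a) (e := e) (m := m) (n := n) hi r)
      simp only [scratch, detectF]
      rw [if_neg]
      rintro ⟨h, -⟩
      exact this (by rw [flag, scratch, h]))
  have hocc : ∀ (P I Q : Fin k → ℕ) v s fl j l,
      occF l (st P I Q v s fl j : Wire k a e m c n → Bool) = ind (j l) := fun _ _ _ _ _ _ _ _ => rfl
  refine ⟨C, hC, ?_, ?_, ?_⟩
  · intro P I Q L v s fl j hj hL
    have hN : ∀ t, labelN t (st P I Q v s fl j : Wire k a e m c n → Bool) % 2 ^ e = I t := by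
      intro t
      rw [labelN_st, Nat.mod_mod, Nat.mod_eq_of_lt ((hL t).lt_particles.trans_le hj)]
    rw [hC' _ fun i hi r => st_scratch _ _ _ _ _ _ _ hi r]
    congr 1
    have key := fun t => sum_selF (hocc P I Q v s fl j) hj (hN t) (hL t)
    refine addFun_eq_st ?_ ?_ ?_ ?_ ?_ ?_ ?_ ?_
    · intro t b; simp [detectF]
    · intro t b; simp [detectF]
    · intro t b
      rw [detectF, Finset.sum_apply, key t fun l => (l : ℕ).testBit b]
      simp
    · simp [detectF]
    · simp [detectF]
    · rw [flag, detectF]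
      split_ifs
      · rw [Pi.add_apply, Finset.prod_apply, Finset.prod_eq_one]
        · simp only [Pi.one_apply, Bool.xor_self]; decide
        · intro t ht
          rw [dif_pos (Finset.mem_range.1 ht), Finset.sum_apply]
          simpa using key ⟨t, Finset.mem_range.1 ht⟩ fun _ => true
      · simp
    · intro b hb; simp [detectF, hb]
    · intro l; simp [detectF]
  · intro hr P I Q v s fl j t hj hI hI'
    have hN : labelN t (st P I Q v s fl j : Wire k a e m c n → Bool) % 2 ^ e = I t := by
      rw [labelN_st, Nat.mod_mod, Nat.mod_eq_of_lt hI]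
    rw [hC' _ fun i hi r => st_scratch _ _ _ _ _ _ _ hi r]
    obtain ⟨P', I', Q', h⟩ := exists_eq_st (addFun (detectF raise)
      (st P I Q v s fl j : Wire k a e m c n → Bool)) (fun b hb => by
        simp [addFun, detectF, hb, st])
    refine ⟨P', I', Q', ?_⟩
    rw [h]
    congr 2
    · simp [addFun, detectF, st]
    · ext b; simp [addFun, detectF, st]
    · have hz : (∏ t ∈ Finset.range k, (if h : t < k then
          ∑ l, selF occF e (labelN ⟨t, h⟩) l else 1)
          (st P I Q v s fl j : Wire k a e m c n → Bool)) = 0 := by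
        refine Finset.prod_eq_zero (Finset.mem_range.2 t.2) ?_
        rw [dif_pos t.2, Finset.sum_apply]
        exact Finset.sum_eq_zero fun l _ => selF_eq_zero (hocc P I Q v s fl j) hj hN hI' l
      rw [addFun, flag, detectF, if_pos ⟨rfl, hr⟩, Pi.add_apply, Finset.prod_apply, hz]
      simp [st]
    · ext l; simp [addFun, detectF, st]
  · intro hr P I Q v s fl j
    rw [hC' _ fun i hi r => st_scratch _ _ _ _ _ _ _ hi r]
    obtain ⟨P', I', Q', h⟩ := exists_eq_st (addFun (detectF raise)
      (st P I Q v s fl j : Wire k a e m c n → Bool)) (fun b hb => by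
        simp [addFun, detectF, hb, st])
    refine ⟨P', I', Q', ?_⟩
    rw [h]
    congr 2
    · simp [addFun, detectF, st]
    · ext b; simp [addFun, detectF, st]
    · simp [addFun, detectF, st, flag, hr]
    · ext l; simp [addFun, detectF, st]

end Oracles

/-! ### The amplitude oracle -/

theorem sum_ofBits {M : Type*} [AddCommMonoid M] (m : ℕ) (F : ℕ → M) :
    ∑ s : Fin m → Bool, F (Nat.ofBits s) = ∑ i ∈ Finset.range (2 ^ m), F i := by
  refine Finset.sum_bij' (fun s _ => Nat.ofBits s) (fun i _ b => i.testBit b)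
    (fun s _ => Finset.mem_range.2 (Nat.ofBits_lt_two_pow s)) (fun _ _ => Finset.mem_univ _)
    (fun s _ => ?_) (fun i hi => ?_) (fun _ _ => rfl)
  · ext b; simp
  · rw [Nat.ofBits_testBit, Nat.mod_eq_of_lt (Finset.mem_range.1 hi)]

theorem sum_sign_lt (N t : ℕ) (h : t ≤ N) :
    ∑ i ∈ Finset.range N, (if i < t then (1 : ℂ) else -1) = 2 * t - N := by
  induction N with
  | zero => simp [Nat.le_zero.1 h]
  | succ N ih =>
    rw [Finset.sum_range_succ]
    rcases Nat.le_succ_iff.1 h with h' | rfl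
    · rw [ih h', if_neg (by omega)]; push_cast; ring
    · rw [if_pos (Nat.lt_succ_self _), Finset.sum_congr rfl fun i hi => if_pos
        ((Finset.mem_range.1 hi).trans (Nat.lt_succ_self _))]
      simp; ring

section Amplitude

variable {k a e m c n : ℕ}

/-- The qubits of the index registers, the flag being `true` for the creation indices. -/
def indexWire (τ : Bool × Fin k) (b : Fin a) : Wire k a e m c n :=
  Sum.inl (if τ.1 then Anc.p τ.2 b else Anc.q τ.2 b)

/-- The contents of an index register. -/
def index (P Q : Fin k → ℕ) (τ : Bool × Fin k) : ℕ := if τ.1 then P τ.2 else Q τ.2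

theorem st_indexWire (P I Q : Fin k → ℕ) (v : Bool) (s : Fin m → Bool) (fl : Bool)
    (j : Fin n → Bool) (τ : Bool × Fin k) (b : Fin a) :
    (st P I Q v s fl j : Wire k a e m c n → Bool) (indexWire τ b) =
      (index P Q τ).testBit b := by
  rcases τ with ⟨_ | _, t⟩ <;> rfl

/-- The amplitude register as a number. -/
def ampN (y : Wire k a e m c n → Bool) : ℕ := Nat.ofBits fun b => y (Sum.inl (Anc.amp b))

theorem bitF_ampN {b : ℕ} (hb : b < m) : bitF ampN b = (coord (Sum.inl (Anc.amp ⟨b, hb⟩)) :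
    (Wire k a e m c n → Bool) → ZMod 2) := by
  ext y
  simp [bitF, ampN, coord, hb]

/-- The entry of the table `T` at the contents of the index registers. -/
def tableN (T : (Fin k → ℕ) → (Fin k → ℕ) → ℕ) (y : Wire k a e m c n → Bool) : ℕ :=
  T (fun t => Nat.ofBits fun b => y (indexWire (true, t) b))
    (fun t => Nat.ofBits fun b => y (indexWire (false, t) b))

/-- A phase circuit that compares the amplitude register with a table entry. -/
theorem exists_compare_circuit {d r : ℕ} (T : (Fin k → ℕ) → (Fin k → ℕ) → ℕ)
    (hT : ∀ P Q, T P Q < 2 ^ m) (hd : 2 * (k * a) = d + r)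
    (hc : 2 ^ (d + 1) + 2 ^ (r + 1) + 2 ^ r * m + m ≤ c) :
    ∃ C : Circuit (Wire k a e m c n), Circuit.tCount C ≤ 28 * c ∧
      ∀ P I Q v s fl j, Circuit.mat C *ᵥ ket (st P I Q v s fl j) =
        (if Nat.ofBits s < T (fun t => P t % 2 ^ a) (fun t => Q t % 2 ^ a) then (1 : ℂ) else -1) •
          ket (st P I Q v s fl j) := by
  set In : Set (Wire k a e m c n) :=
    {q | (∃ τ b, q = indexWire τ b) ∨ ∃ b, q = Sum.inl (Anc.amp b)} with hInd
  have hIn : ∀ b, Sum.inl (Anc.work b) ∉ In := by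
    rintro b (⟨⟨_ | _, t⟩, b, h⟩ | ⟨l, h⟩) <;> simp [indexWire] at h
  have h1 := one_mem_affine In
  have hcard : Fintype.card ((Bool × Fin k) × Fin a) = Fintype.card (Fin d ⊕ Fin r) := by
    simp only [Fintype.card_prod, Fintype.card_bool, Fintype.card_fin, Fintype.card_sum, ← hd]
    ring
  obtain ⟨W, hW, hm⟩ := Ext.lookup h1 (m := m) (Fintype.equivOfCardEq hcard)
    (fun q => (coord (indexWire q.1 q.2) : (Wire k a e m c n → Bool) → ZMod 2))
    (fun q => coord_mem_affine (Or.inl ⟨_, _, rfl⟩))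
    (fun z i => (T (fun t => Nat.ofBits fun b => z ((true, t), b))
      (fun t => Nat.ofBits fun b => z ((false, t), b))).testBit i)
  obtain ⟨W', hW', hm'⟩ := Ext.lt (V := W) ampN (tableN T) m
    (fun b hb => hW.le (by rw [bitF_ampN hb]; exact coord_mem_affine (Or.inr ⟨_, rfl⟩)))
    (fun b hb => by
      convert hm ⟨b, hb⟩ using 1
      ext y
      simp only [bitF, tableN, decide_coord_eq_one])
  obtain ⟨C, hC, hC'⟩ := exists_phase_circuit ((hW.trans hW').mono hc) hIn _
    (add_mem (hW'.le (hW.le h1)) hm')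
  refine ⟨C, hC, fun P I Q v s fl j => ?_⟩
  rw [hC']
  congr 1
  have e1 : ampN (st P I Q v s fl j : Wire k a e m c n → Bool) = Nat.ofBits s := rfl
  have e2 : tableN T (st P I Q v s fl j : Wire k a e m c n → Bool) =
      T (fun t => P t % 2 ^ a) (fun t => Q t % 2 ^ a) := by
    simp only [tableN, st_indexWire, index, if_true, Bool.false_eq_true, if_false,
      Nat.ofBits_testBit]
  simp only [Pi.add_apply, Pi.one_apply, e1, e2, Nat.mod_eq_of_lt (hT _ _),
    Nat.mod_eq_of_lt (Nat.ofBits_lt_two_pow s)]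
  split_ifs with h
  · simp [h, sg, show ¬((1 : ZMod 2) + 1 = 1) by decide]
  · simp [h, sg]

/-- The qubits of the amplitude register. -/
def ampWires (k a e m c n : ℕ) : List (Wire k a e m c n) :=
  (List.finRange m).map fun b => Sum.inl (Anc.amp b)

theorem extend_amp (P I Q : Fin k → ℕ) (v : Bool) (s s' : Fin m → Bool) (fl : Bool)
    (j : Fin n → Bool) :
    Function.extend (fun b => Sum.inl (Anc.amp b)) s' (st P I Q v s fl j) =
      (st P I Q v s' fl j : Wire k a e m c n → Bool) := by
  symm
  rw [eq_extend_iff (fun b b' h => by simpa using h)]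
  refine ⟨fun q hq => ?_, rfl⟩
  rcases q with q | l
  · cases q with
    | amp b => exact absurd rfl (hq b)
    | _ => rfl
  · rfl

theorem hadamards_amp_ket (P I Q : Fin k → ℕ) (v : Bool) (s : Fin m → Bool) (fl : Bool)
    (j : Fin n → Bool) :
    Circuit.mat ((ampWires k a e m c n).map Gate.hadamard) *ᵥ ket (st P I Q v s fl j) =
      ∑ s' : Fin m → Bool, ((∏ b, sg (s' b && s b)) / (Real.sqrt 2 : ℂ) ^ m) •
        ket (st P I Q v s' fl j) := by
  have := hadamards_ket (g := fun b : Fin m => (Sum.inl (Anc.amp b) : Wire k a e m c n))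
    (fun b b' h => by simpa using h) (ampWires k a e m c n)
    ((List.nodup_finRange m).map fun b b' h => by simpa using h)
    (fun q => by simp [ampWires]) (st P I Q v s fl j)
  rw [this]
  simp only [extend_amp, Fintype.card_fin]
  rfl

/-- The amplitude circuit: the uniform superposition in the amplitude register is compared with the
table entry, so that the amplitude of the all-zero state is the average of `T` signs `+1` and of
`2 ^ m - T` signs `-1`. -/
theorem exists_amplitude_circuit {d r : ℕ} (T : (Fin k → ℕ) → (Fin k → ℕ) → ℕ)
    (hT : ∀ P Q, T P Q < 2 ^ m) (hd : 2 * (k * a) = d + r)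
    (hc : 2 ^ (d + 1) + 2 ^ (r + 1) + 2 ^ r * m + m ≤ c) :
    ∃ C : Circuit (Wire k a e m c n), Circuit.tCount C ≤ 28 * c ∧
      ∀ P I Q v fl j, ∃ φ : (Fin m → Bool) → ℂ,
        φ (fun _ => false) =
          (2 * T (fun t => P t % 2 ^ a) (fun t => Q t % 2 ^ a) - 2 ^ m) / 2 ^ m ∧
        Circuit.mat C *ᵥ ket (st P I Q v (fun _ => false) fl j) =
          ∑ s, φ s • ket (st P I Q v s fl j) := by
  obtain ⟨C, hC, hC'⟩ := exists_compare_circuit (e := e) (n := n) T hT hd hc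
  refine ⟨(ampWires k a e m c n).map Gate.hadamard ++ C ++
    (ampWires k a e m c n).map Gate.hadamard, ?_, fun P I Q v fl j => ?_⟩
  · rw [Circuit.tCount_append, Circuit.tCount_append, hadamards_tCount]; omega
  · set t := T (fun t => P t % 2 ^ a) (fun t => Q t % 2 ^ a) with ht
    refine ⟨fun s => ∑ s' : Fin m → Bool, (1 / (Real.sqrt 2 : ℂ) ^ m *
      (if Nat.ofBits s' < t then (1 : ℂ) else -1)) *
      ((∏ b, sg (s b && s' b)) / (Real.sqrt 2 : ℂ) ^ m), ?_, ?_⟩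
    · have h2 : (Real.sqrt 2 : ℂ) ^ m * (Real.sqrt 2 : ℂ) ^ m = 2 ^ m := by
        rw [← mul_pow, ← Complex.ofReal_mul, Real.mul_self_sqrt (by norm_num)]; norm_num
      have h3 : ∀ s' : Fin m → Bool, ∏ b, sg (false && s' b) = 1 := fun s' => by simp [sg]
      simp only [h3]
      have h4 := sum_ofBits m fun i => if i < t then (1 : ℂ) else -1
      rw [sum_sign_lt _ _ (hT _ _).le] at h4
      push_cast at h4
      rw [← h4, Finset.sum_div]
      refine Finset.sum_congr rfl fun s' _ => ?_
      rw [← h2]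
      ring
    · rw [Circuit.mat_append_mulVec, Circuit.mat_append_mulVec, hadamards_amp_ket,
        Matrix.mulVec_sum, Matrix.mulVec_sum]
      simp only [Matrix.mulVec_smul, hC', hadamards_amp_ket, Finset.sum_smul, Finset.smul_sum,
        smul_smul]
      rw [Finset.sum_comm]
      refine Finset.sum_congr rfl fun s _ => Finset.sum_congr rfl fun s' _ => ?_
      congr 1
      simp [sg, ht]

end Amplitude

/-! ### The sparsity oracle -/

section Sparsity

variable {k a e m c n : ℕ}

/-- The function that says whether an index register contains the orbital `l`. -/
def orbF (τ : Bool × Fin k) (l : Fin n) : (Wire k a e m c n → Bool) → ZMod 2 :=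
  oneHot (fun b => coord (indexWire τ b)) fun b => (l : ℕ).testBit b

theorem orbF_st (hn : n ≤ 2 ^ a) (P I Q : Fin k → ℕ) (v : Bool) (s : Fin m → Bool) (fl : Bool)
    (j : Fin n → Bool) (τ : Bool × Fin k) (hτ : index P Q τ < 2 ^ a) (l : Fin n) :
    orbF τ l (st P I Q v s fl j : Wire k a e m c n → Bool) =
      ind (decide (index P Q τ = l)) := by
  rw [orbF, oneHot_apply]
  congr 1
  rw [decide_eq_decide]
  simp only [coord, st_indexWire, ind_injective.eq_iff]
  constructor
  · intro h
    refine Nat.eq_of_testBit_eq fun b => ?_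
    by_cases hb : b < a
    · exact h ⟨b, hb⟩
    · have h2 : 2 ^ a ≤ 2 ^ b := Nat.pow_le_pow_right (by norm_num) (not_lt.1 hb)
      rw [Nat.testBit_lt_two_pow (hτ.trans_le h2),
        Nat.testBit_lt_two_pow ((l.2.trans_le hn).trans_le h2)]
  · intro h b; rw [h]

theorem orbF_st_fin (hn : n ≤ 2 ^ a) (P Q : Fin k → Fin n) (I : Fin k → ℕ) (v : Bool)
    (s : Fin m → Bool) (fl : Bool) (j : Fin n → Bool) (τ : Bool × Fin k) (l : Fin n) :
    orbF τ l (st (fun t => P t) I (fun t => Q t) v s fl j : Wire k a e m c n → Bool) =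
      ind (decide (orbitals P Q τ = l)) := by
  have h : index (fun t => P t) (fun t => Q t) τ = orbitals P Q τ := by
    rcases τ with ⟨_ | _, t⟩ <;> rfl
  rw [orbF_st hn _ _ _ _ _ _ _ _ (by rw [h]; exact (orbitals P Q τ).2.trans_le hn), h]
  simp [Fin.ext_iff]

theorem Ext.orbF {V : Submodule (ZMod 2) ((Wire k a e m c n → Bool) → ZMod 2)} (h1 : 1 ∈ V)
    (hV : ∀ τ b, coord (indexWire τ b) ∈ V) :
    ∃ W, Ext (2 * k * 2 ^ (a + 1)) V W ∧ ∀ τ l, orbF τ l ∈ W := by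
  obtain ⟨W, hW, hm⟩ := Ext.family (c := 2 ^ (a + 1)) (V := V) Finset.univ
    (fun τ : Bool × Fin k => Set.range fun l => EtaParticle.orbF τ l) (by
    intro τ _
    obtain ⟨U, hU, hs⟩ := Ext.oneHot h1 a (fun b => coord (indexWire τ b)) fun b => hV τ b
    refine ⟨U, hU, ?_⟩
    rintro _ ⟨l, rfl⟩
    exact hs _)
  exact ⟨W, by simpa using hW, fun τ l => hm τ (Finset.mem_univ τ) ⟨l, rfl⟩⟩

/-- The function that is added to the validation qubit. -/
def validateF : Wire k a e m c n → (Wire k a e m c n → Bool) → ZMod 2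
  | Sum.inl Anc.valid => survivesF orbF occF (positions k)
  | _ => 0

/-- The functions that are added to the system: the orbitals of the monomial are flipped if the
validation qubit has been cleared. -/
def moveF : Wire k a e m c n → (Wire k a e m c n → Bool) → ZMod 2
  | Sum.inr l => (coord (Sum.inl Anc.valid) + 1) * flipsF orbF (positions k) l
  | _ => 0

theorem length_positions (k : ℕ) : (positions k).length = 2 * k := by
  simp [positions, two_mul]

/-- The sparsity circuit: the sign of the monomial as a phase, then the validation qubit, then the
flips of the orbitals. -/
theorem exists_sparsity_circuit (hn : n ≤ 2 ^ a)
    (hc : 2 * k * 2 ^ (a + 1) + 2 * k * (2 * n + 1) + n ≤ c) :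
    ∃ C : Circuit (Wire k a e m c n), Circuit.tCount C ≤ 56 * c ∧
      (∀ (P Q : Fin k → Fin n) (I : Fin k → ℕ) s fl j,
        Circuit.mat C *ᵥ ket (st (fun t => P t) I (fun t => Q t) true s fl j) =
          sg (negative (orbitals P Q) j (positions k)) •
          ket (st (fun t => P t) I (fun t => Q t) (!survives (orbitals P Q) j (positions k)) s fl
            (if survives (orbitals P Q) j (positions k) then
              moved (orbitals P Q) (positions k) j else j))) ∧
      (∀ (P I Q : Fin k → ℕ) s fl j t, P t < 2 ^ a → n ≤ P t → ∃ z : ℂ,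
        Circuit.mat C *ᵥ ket (st P I Q true s fl j) = z • ket (st P I Q true s fl j)) ∧
      ∀ (P I Q : Fin k → ℕ) v s fl j, ∃ (z : ℂ) (P' I' Q' : Fin k → ℕ) (v' : Bool)
        (s' : Fin m → Bool) (j' : Fin n → Bool),
        Circuit.mat C *ᵥ ket (st P I Q v s fl j) = z • ket (st P' I' Q' v' s' fl j') := by
  -- the sign and the validity of the monomial, from the index registers and the system
  set In : Set (Wire k a e m c n) :=
    {q | (∃ τ b, q = indexWire τ b) ∨ ∃ l, q = Sum.inr l} with hInd
  have hIn : ∀ b, Sum.inl (Anc.work b) ∉ In := by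
    rintro b (⟨⟨_ | _, t⟩, b, h⟩ | ⟨l, h⟩) <;> simp [indexWire] at h
  obtain ⟨W, hW, hm⟩ := Ext.orbF (one_mem_affine In)
    fun τ b => coord_mem_affine (Or.inl ⟨τ, b, rfl⟩)
  obtain ⟨W', hW', hs, hneg⟩ := Ext.ladder (o := orbF) (G := occF) (hW.le (one_mem_affine In)) hm
    (fun l => hW.le (coord_mem_affine (Or.inr ⟨l, rfl⟩))) (positions k)
  have hE := (hW.trans hW').mono (show _ ≤ c by rw [length_positions]; omega)
  obtain ⟨C₁, hC₁, hC₁'⟩ := exists_phase_circuit hE hIn _ hneg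
  obtain ⟨C₂, hC₂, hC₂'⟩ := exists_add_circuit hE hIn validateF (by
      rintro ((_ | _ | _ | _ | _ | _) | _)
      all_goals first | exact hs | exact zero_mem W')
    (by rintro q (⟨⟨_ | _, t⟩, b, rfl⟩ | ⟨l, rfl⟩) <;> rfl)
    (fun i hi r => rfl)
  -- the flips, from the index registers and the validation qubit
  set In₃ : Set (Wire k a e m c n) :=
    {q | (∃ τ b, q = indexWire τ b) ∨ q = Sum.inl Anc.valid} with hInd₃
  have hIn₃ : ∀ b, Sum.inl (Anc.work b) ∉ In₃ := by
    rintro b (⟨⟨_ | _, t⟩, b, h⟩ | h) <;> simp [indexWire] at h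
  obtain ⟨W₃, hW₃, hm₃⟩ := Ext.orbF (one_mem_affine In₃)
    fun τ b => coord_mem_affine (Or.inl ⟨τ, b, rfl⟩)
  obtain ⟨W₄, hW₄, hm₄⟩ := Ext.products (V := W₃) (fun l : Fin n =>
      (coord (Sum.inl Anc.valid) + 1) * flipsF orbF (positions k) l) fun l =>
    ⟨_, hW₃.le (add_mem (coord_mem_affine (Or.inr rfl)) (one_mem_affine In₃)), _,
      flipsF_mem hm₃ _ _, rfl⟩
  obtain ⟨C₃, hC₃, hC₃'⟩ := exists_add_circuit
    ((hW₃.trans hW₄).mono (show _ ≤ c by rw [Fintype.card_fin]; omega)) hIn₃ moveF (by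
      rintro ((_ | _ | _ | _ | _ | _) | l)
      all_goals first | exact hm₄ l | exact zero_mem W₄)
    (by rintro q (⟨⟨_ | _, t⟩, b, rfl⟩ | rfl) <;> rfl)
    (fun i hi r => rfl)
  have hocc : ∀ (P I Q : Fin k → ℕ) v s fl j l,
      occF l (st P I Q v s fl j : Wire k a e m c n → Bool) = ind (j l) := fun _ _ _ _ _ _ _ _ => rfl
  have step₂ : ∀ (P I Q : Fin k → ℕ) v s fl j, Circuit.mat C₂ *ᵥ ket (st P I Q v s fl j) =
      ket (st P I Q (v ^^ decide (survivesF orbF occF (positions k)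
        (st P I Q v s fl j : Wire k a e m c n → Bool) = 1)) s fl j) := by
    intro P I Q v s fl j
    rw [hC₂' _ fun i hi r => st_scratch _ _ _ _ _ _ _ hi r]
    congr 1
    refine addFun_eq_st ?_ ?_ ?_ ?_ ?_ ?_ ?_ ?_
    all_goals intros
    all_goals simp [validateF, flag, ind_decide_eq_one]
  have step₃ : ∀ (P I Q : Fin k → ℕ) v s fl j, Circuit.mat C₃ *ᵥ ket (st P I Q v s fl j) =
      ket (st P I Q v s fl fun l => j l ^^ (!v && decide (flipsF orbF (positions k) l
        (st P I Q v s fl j : Wire k a e m c n → Bool) = 1))) := by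
    intro P I Q v s fl j
    rw [hC₃' _ fun i hi r => st_scratch _ _ _ _ _ _ _ hi r]
    congr 1
    refine addFun_eq_st ?_ ?_ ?_ ?_ ?_ ?_ ?_ ?_
    all_goals intros
    case refine_8 =>
      rw [← Bool.xor_assoc, Bool.xor_self, Bool.false_xor, ind_and, ind_decide_eq_one, ind_not]
      rfl
    all_goals simp [moveF, flag]
  have total : ∀ (P I Q : Fin k → ℕ) v s fl j,
      Circuit.mat (C₁ ++ C₂ ++ C₃) *ᵥ ket (st P I Q v s fl j) = _ := fun P I Q v s fl j => by
    rw [Circuit.mat_append_mulVec, Circuit.mat_append_mulVec, hC₁', Matrix.mulVec_smul, step₂,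
      Matrix.mulVec_smul, step₃]
  refine ⟨C₁ ++ C₂ ++ C₃, ?_, ?_, ?_, ?_⟩
  · rw [Circuit.tCount_append, Circuit.tCount_append]; omega
  · intro P Q I s fl j
    rw [total]
    have ho := fun v => orbF_st_fin (c := c) (e := e) (m := m) hn P Q I v s fl j
    simp only [negativeF_apply (ho true) (hocc _ I _ true s fl j),
      survivesF_apply (ho true) (hocc _ I _ true s fl j), decide_ind_eq_one, Bool.true_xor]
    congr 3
    ext l
    rw [flipsF_apply (ho _), decide_ind_eq_one, Bool.not_not]
    cases survives (orbitals P Q) j (positions k) <;> simp [moved]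
  · intro P I Q s fl j t ht ht'
    have h0 : survivesF orbF occF (positions k)
        (st P I Q true s fl j : Wire k a e m c n → Bool) = 0 := by
      refine survivesF_eq_zero (τ := (true, t)) (fun l => ?_) (by simp [positions, List.mem_ofFn])
      rw [orbF_st hn P I Q true s fl j (true, t) ht l]
      have : ¬ index P Q (true, t) = l := fun h => by
        have h' : P t = l := h
        have := l.2
        omega
      simp [this]
    refine ⟨sg (decide (negativeF orbF occF (positions k)
      (st P I Q true s fl j : Wire k a e m c n → Bool) = 1)), ?_⟩
    rw [total, h0]
    simp
  · intro P I Q v s fl j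
    exact ⟨_, _, _, _, _, _, _, total P I Q v s fl j⟩

end Sparsity

/-! ### The uncompute oracle -/

section Uncompute

variable {k a e m c n : ℕ}

theorem exists_addFun_eq_st {f : Wire k a e m c n → (Wire k a e m c n → Bool) → ZMod 2}
    (hv : f (Sum.inl Anc.valid) = 0) (hs : ∀ b, f (Sum.inl (Anc.amp b)) = 0)
    (hw : ∀ b, f (Sum.inl (Anc.work b)) = 0) (hj : ∀ l, f (Sum.inr l) = 0)
    (P I Q : Fin k → ℕ) (v : Bool) (s : Fin m → Bool) (fl : Bool) (j : Fin n → Bool) :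
    ∃ P' I' Q', addFun f (st P I Q v s fl j) = st P' I' Q' v s fl j := by
  obtain ⟨P', I', Q', h⟩ := exists_eq_st (addFun f (st P I Q v s fl j)) (fun b hb => by
    simp [addFun, hw, hb, st])
  refine ⟨P', I', Q', ?_⟩
  rw [h]
  congr 1
  · simp [addFun, hv, st]
  · ext b; simp [addFun, hs, st]
  · simp [addFun, hw, st, flag]
  · ext l; simp [addFun, hj, st]

/-- The occupations of the orbitals, before the transition if `mv` is set. -/
def beforeF (mv : Bool) (l : Fin n) : (Wire k a e m c n → Bool) → ZMod 2 :=
  occF l + if mv then flipsF orbF (positions k) l else 0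

/-- The functions that are added to the label registers: the labels of the particles in the
orbitals of the creation registers (`cr = true`) or of the annihilation registers. -/
def relabelF (mv cr : Bool) : Wire k a e m c n → (Wire k a e m c n → Bool) → ZMod 2
  | Sum.inl (Anc.i t b) => rankF (beforeF mv) (orbF (cr, t)) b
  | _ => 0

theorem exists_relabel_circuit (mv cr : Bool) (hn : n ≤ 2 ^ a)
    (hc : 2 * k * 2 ^ (a + 1) + (n * e + k * (n * e)) ≤ c) :
    ∃ C : Circuit (Wire k a e m c n), Circuit.tCount C ≤ 14 * c ∧
      (∀ (P Q : Fin k → Fin n) (I I' : Fin k → ℕ) v s fl j j', (∀ t, I t < 2 ^ e) →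
        (∀ t, I' t < 2 ^ e) →
        j' = (if mv then moved (orbitals P Q) (positions k) j else j) →
        (∀ t, I' t = (I t ^^^ occupiedBelow j' (orbitals P Q (cr, t)))) →
        Circuit.mat C *ᵥ ket (st (fun t => P t) I (fun t => Q t) v s fl j) =
          ket (st (fun t => P t) I' (fun t => Q t) v s fl j)) ∧
      ∀ (P I Q : Fin k → ℕ) v s fl j, ∃ P' I' Q',
        Circuit.mat C *ᵥ ket (st P I Q v s fl j) = ket (st P' I' Q' v s fl j) := by
  set In : Set (Wire k a e m c n) :=
    {q | (∃ τ b, q = indexWire τ b) ∨ ∃ l, q = Sum.inr l} with hInd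
  have hIn : ∀ b, Sum.inl (Anc.work b) ∉ In := by
    rintro b (⟨⟨_ | _, t⟩, b, h⟩ | ⟨l, h⟩) <;> simp [indexWire] at h
  obtain ⟨W, hW, hm⟩ := Ext.orbF (one_mem_affine In)
    fun τ b => coord_mem_affine (Or.inl ⟨τ, b, rfl⟩)
  obtain ⟨W', hW', hm'⟩ := Ext.rankF (V := W) (e := e) (G := beforeF mv)
    (o := fun t => orbF (cr, t)) (fun l => by
      refine add_mem (hW.le (coord_mem_affine (Or.inr ⟨l, rfl⟩))) ?_
      split_ifs
      exacts [flipsF_mem hm _ _, zero_mem W]) fun t l => hm _ l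
  obtain ⟨C, hC, hC'⟩ := exists_add_circuit ((hW.trans hW').mono hc) hIn (relabelF mv cr) (by
      rintro ((_ | ⟨t, b⟩ | _ | _ | _ | _) | _)
      all_goals first | exact hm' t b | exact zero_mem W')
    (by rintro q (⟨⟨_ | _, t⟩, b, rfl⟩ | ⟨l, rfl⟩) <;> rfl)
    (fun i hi r => rfl)
  refine ⟨C, hC, fun P Q I I' v s fl j j' hI hI' hj hrel => ?_, fun P I Q v s fl j => ?_⟩
  · rw [hC' _ fun i hi r => st_scratch _ _ _ _ _ _ _ hi r]
    congr 1
    have ho := orbF_st_fin (c := c) (e := e) (m := m) hn P Q I v s fl j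
    have hG : ∀ l, beforeF mv l (st (fun t => P t) I (fun t => Q t) v s fl j :
        Wire k a e m c n → Bool) = ind (j' l) := by
      intro l
      rw [hj, beforeF, Pi.add_apply]
      cases mv
      · simp; rfl
      · rw [if_pos rfl, flipsF_apply ho, if_pos rfl, moved, ind_xor]; rfl
    refine addFun_eq_st ?_ ?_ ?_ ?_ ?_ ?_ ?_ ?_
    case refine_2 =>
      intro t b
      rw [relabelF, rankF_apply hG (ho (cr, t)), hrel, ← Nat.xor_assoc, Nat.xor_self,
        Nat.zero_xor]
    all_goals intros
    all_goals simp [relabelF, flag]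
  · rw [hC' _ fun i hi r => st_scratch _ _ _ _ _ _ _ hi r]
    obtain ⟨P', I', Q', h⟩ := exists_addFun_eq_st (f := relabelF mv cr) rfl (fun _ => rfl)
      (fun _ => rfl) (fun _ => rfl) P I Q v s fl j
    exact ⟨P', I', Q', by rw [h]⟩

/-- The functions that add the annihilation registers to the creation registers (`cr = true`), or
conversely. -/
def copyF (cr : Bool) : Wire k a e m c n → (Wire k a e m c n → Bool) → ZMod 2
  | Sum.inl (Anc.p t b) => if cr then coord (indexWire (false, t) b) else 0
  | Sum.inl (Anc.q t b) => if cr then 0 else coord (indexWire (true, t) b)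
  | _ => 0

theorem exists_copy_circuit (cr : Bool) :
    ∃ C : Circuit (Wire k a e m c n), Circuit.tCount C ≤ 14 * c ∧
      (∀ (P I Q : Fin k → ℕ) v s fl j, Circuit.mat C *ᵥ ket (st P I Q v s fl j) =
        ket (if cr then st (fun t => P t ^^^ Q t) I Q v s fl j else
          st P I (fun t => P t ^^^ Q t) v s fl j)) ∧
      ∀ (P I Q : Fin k → ℕ) v s fl j, ∃ P' I' Q',
        Circuit.mat C *ᵥ ket (st P I Q v s fl j) = ket (st P' I' Q' v s fl j) := by
  set In : Set (Wire k a e m c n) := {q | ∃ t b, q = indexWire (!cr, t) b} with hInd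
  have hIn : ∀ b, Sum.inl (Anc.work b) ∉ In := by
    rintro b ⟨t, b, h⟩; cases cr <;> simp [indexWire] at h
  obtain ⟨C, hC, hC'⟩ := exists_add_circuit ((Ext.refl (affine In)).mono (Nat.zero_le c)) hIn
    (copyF cr) (by
      rintro ((⟨t, b⟩ | _ | ⟨t, b⟩ | _ | _ | _) | _)
      all_goals try exact zero_mem (affine In)
      all_goals
        simp only [copyF]
        cases cr
        all_goals first
          | exact zero_mem (affine In)
          | exact coord_mem_affine ⟨t, b, rfl⟩)
    (by rintro q ⟨t, b, rfl⟩; cases cr <;> rfl)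
    (fun i hi r => rfl)
  refine ⟨C, hC, fun P I Q v s fl j => ?_, fun P I Q v s fl j => ?_⟩
  · rw [hC' _ fun i hi r => st_scratch _ _ _ _ _ _ _ hi r]
    congr 1
    cases cr
    all_goals
      simp only [Bool.false_eq_true, if_true, if_false]
      refine addFun_eq_st ?_ ?_ ?_ ?_ ?_ ?_ ?_ ?_
    all_goals intros
    all_goals simp [copyF, flag, coord, st_indexWire, index]
  · rw [hC' _ fun i hi r => st_scratch _ _ _ _ _ _ _ hi r]
    obtain ⟨P', I', Q', h⟩ := exists_addFun_eq_st (f := copyF cr) rfl (fun _ => rfl)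
      (fun _ => rfl) (fun _ => rfl) P I Q v s fl j
    exact ⟨P', I', Q', by rw [h]⟩

theorem moved_moved (r : Bool × Fin k → Fin n) (L : List (Bool × Fin k)) (j : Fin n → Bool) :
    moved r L (moved r L j) = j := by
  ext l; simp [moved]

/-- The uncompute circuit: the labels `I` are computed again from the initial state, which is
recovered from the final one by flipping orbitals, and erased; then the labels of the created
particles are written, the index registers are exchanged, and the creation indices, which are
determined by the new labels, are erased. -/
theorem exists_uncompute_circuit (hn : n ≤ 2 ^ a)
    (hc : 2 * k * 2 ^ (a + 1) + (n * e + k * (n * e)) ≤ c)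
    (hc' : n * e + k * (n * (e + 1)) + k ≤ c) :
    ∃ C : Circuit (Wire k a e m c n), Circuit.tCount C ≤ 84 * c ∧
      (∀ (P Q : Fin k → Fin n) (I I' : Fin k → ℕ) v s fl j j', particles j ≤ 2 ^ e →
        monomial P Q j' j ≠ 0 → (∀ t, IsAddr j (I t) (Q t)) → (∀ t, IsAddr j' (I' t) (P t)) →
        Circuit.mat C *ᵥ ket (st (fun t => P t) I (fun t => Q t) v s fl j') =
          ket (st (fun t => Q t) I' (fun _ => 0) v s fl j')) ∧
      ∀ (P I Q : Fin k → ℕ) v s fl j, ∃ P' I' Q',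
        Circuit.mat C *ᵥ ket (st P I Q v s fl j) = ket (st P' I' Q' v s fl j) := by
  obtain ⟨C₁, h₁, f₁, g₁⟩ := exists_relabel_circuit (m := m) true false hn hc
  obtain ⟨C₂, h₂, f₂, g₂⟩ := exists_relabel_circuit (m := m) false true hn hc
  obtain ⟨C₃, h₃, f₃, g₃⟩ := exists_copy_circuit (k := k) (a := a) (e := e) (m := m) (c := c)
    (n := n) true
  obtain ⟨C₄, h₄, f₄, g₄⟩ := exists_copy_circuit (k := k) (a := a) (e := e) (m := m) (c := c)
    (n := n) false
  obtain ⟨C₅, h₅, f₅, -, g₅⟩ := exists_detect_circuit (a := a) (m := m) false hc'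
  refine ⟨C₁ ++ C₂ ++ C₃ ++ C₄ ++ C₃ ++ C₅, ?_, ?_, ?_⟩
  · simp only [Circuit.tCount_append]; omega
  · intro P Q I I' v s fl j j' hj hM hI hI'
    obtain ⟨hsv, hj'⟩ := (monomial_ne_zero_iff ..).1 hM
    have hpart := particles_of_monomial_ne_zero hM
    simp only [Circuit.mat_append_mulVec]
    rw [f₁ P Q I (fun _ => 0) v s fl j' j (fun t => (hI t).lt_particles.trans_le hj)
      (fun t => by positivity) (by rw [if_pos rfl, hj', moved_moved])
      (fun t => by
        have : orbitals P Q (false, t) = Q t := rfl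
        rw [this, (hI t).2, Nat.xor_self]),
      f₂ P Q (fun _ => 0) I' v s fl j' j' (fun t => by positivity)
        (fun t => (hI' t).lt_particles.trans_le (hpart ▸ hj)) rfl
      (fun t => by
        have : orbitals P Q (true, t) = P t := rfl
        rw [this, (hI' t).2, Nat.zero_xor]),
      f₃, if_pos rfl, f₄, if_neg (by decide), f₃, if_pos rfl]
    have e1 : ∀ p q : ℕ, (p ^^^ q ^^^ q) = p := fun p q => by simp
    have e2 : ∀ p q : ℕ, (p ^^^ q ^^^ p) = q := fun p q => by
      rw [Nat.xor_comm p q, e1]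
    simp only [e1, e2]
    rw [f₅ (fun t => Q t) I' (fun t => P t) P v s fl j' (hpart ▸ hj) hI']
    simp
  · intro P I Q v s fl j
    simp only [Circuit.mat_append_mulVec]
    obtain ⟨P, I, Q, h⟩ := g₁ P I Q v s fl j
    rw [h]
    obtain ⟨P, I, Q, h⟩ := g₂ P I Q v s fl j
    rw [h]
    obtain ⟨P, I, Q, h⟩ := g₃ P I Q v s fl j
    rw [h]
    obtain ⟨P, I, Q, h⟩ := g₄ P I Q v s fl j
    rw [h]
    obtain ⟨P, I, Q, h⟩ := g₃ P I Q v s fl j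
    rw [h]
    exact g₅ rfl P I Q v s fl j

end Uncompute

/-! ### The complete circuit -/

section Block

variable {k a e m c n : ℕ}

/-- What is needed of the four circuits, on valid and on invalid register contents. The table of
amplitudes is `β`. -/
structure OracleSpec (η : ℕ) (β : (Fin k → Fin n) → (Fin k → Fin n) → ℤ)
    (occ amplitude sparsity uncompute : Circuit (Wire k a e m c n)) : Prop where
  occ_apply : ∀ (P I Q : Fin k → ℕ) (L : Fin k → Fin n) v s fl j, particles j = η →
    (∀ t, IsAddr j (I t) (L t)) → Circuit.mat occ *ᵥ ket (st P I Q v s fl j) =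
      ket (st P I (fun t => Q t ^^^ L t) v s fl j)
  occ_invalid : ∀ (P I Q : Fin k → ℕ) v s fl j t, particles j = η → I t < 2 ^ e → η ≤ I t →
    ∃ P' I' Q', Circuit.mat occ *ᵥ ket (st P I Q v s fl j) = ket (st P' I' Q' v s (!fl) j)
  amplitude_apply : ∀ (P I Q : Fin k → ℕ) v fl j, ∃ φ : (Fin m → Bool) → ℂ,
    (∀ P' Q' : Fin k → Fin n, (P = fun t => (P' t : ℕ)) → (Q = fun t => (Q' t : ℕ)) →
      φ (fun _ => false) = (β P' Q' : ℂ) / 2 ^ (m - 1)) ∧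
    Circuit.mat amplitude *ᵥ ket (st P I Q v (fun _ => false) fl j) =
      ∑ s, φ s • ket (st P I Q v s fl j)
  sparsity_apply : ∀ (P Q : Fin k → Fin n) (I : Fin k → ℕ) s fl j,
    Circuit.mat sparsity *ᵥ ket (st (fun t => P t) I (fun t => Q t) true s fl j) =
      sg (negative (orbitals P Q) j (positions k)) •
      ket (st (fun t => P t) I (fun t => Q t) (!survives (orbitals P Q) j (positions k)) s fl
        (if survives (orbitals P Q) j (positions k) then
          moved (orbitals P Q) (positions k) j else j))
  sparsity_invalid : ∀ (P I Q : Fin k → ℕ) s fl j t, P t < 2 ^ a → n ≤ P t → ∃ z : ℂ,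
    Circuit.mat sparsity *ᵥ ket (st P I Q true s fl j) = z • ket (st P I Q true s fl j)
  sparsity_flag : ∀ (P I Q : Fin k → ℕ) v s fl j, ∃ (z : ℂ) (P' I' Q' : Fin k → ℕ) (v' : Bool)
    (s' : Fin m → Bool) (j' : Fin n → Bool),
    Circuit.mat sparsity *ᵥ ket (st P I Q v s fl j) = z • ket (st P' I' Q' v' s' fl j')
  uncompute_apply : ∀ (P Q : Fin k → Fin n) (I I' : Fin k → ℕ) v s fl j j', particles j = η →
    monomial P Q j' j ≠ 0 → (∀ t, IsAddr j (I t) (Q t)) → (∀ t, IsAddr j' (I' t) (P t)) →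
    Circuit.mat uncompute *ᵥ ket (st (fun t => P t) I (fun t => Q t) v s fl j') =
      ket (st (fun t => Q t) I' (fun _ => 0) v s fl j')
  uncompute_keep : ∀ (P I Q : Fin k → ℕ) v s fl j, ∃ P' I' Q',
    Circuit.mat uncompute *ᵥ ket (st P I Q v s fl j) = ket (st P' I' Q' v s fl j)

/-- The qubits of the creation index and particle label registers. -/
def diffWire : (Fin k × Fin a) ⊕ (Fin k × Fin e) → Wire k a e m c n
  | .inl (t, b) => Sum.inl (Anc.p t b)
  | .inr (t, b) => Sum.inl (Anc.i t b)

theorem diffWire_injective :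
    Function.Injective (diffWire : (Fin k × Fin a) ⊕ (Fin k × Fin e) → Wire k a e m c n) := by
  rintro (⟨t, b⟩ | ⟨t, b⟩) (⟨t', b'⟩ | ⟨t', b'⟩) h <;> simp [diffWire] at h ⊢ <;> exact h

/-- The list of the qubits of the creation index and particle label registers. -/
def diffWires (k a e m c n : ℕ) : List (Wire k a e m c n) :=
  ((List.finRange k).flatMap fun t => (List.finRange a).map fun b => Sum.inl (Anc.p t b)) ++
    (List.finRange k).flatMap fun t => (List.finRange e).map fun b => Sum.inl (Anc.i t b)

theorem diffusion_eq : diffusion k a e m (3 * c + 2) n =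
    (diffWires k a e m c n).map Gate.hadamard := by
  simp [diffusion, diffWires, List.map_flatMap, Function.comp_def]

theorem mem_diffWires (q : Wire k a e m c n) :
    q ∈ diffWires k a e m c n ↔ ∃ b, diffWire b = q := by
  simp [diffWires, diffWire]

theorem nodup_diffWires : (diffWires k a e m c n).Nodup := by
  have key : ∀ (d : ℕ) (f : Fin k → Fin d → Wire k a e m c n),
      (∀ t b t' b', f t b = f t' b' → t = t' ∧ b = b') →
      ((List.finRange k).flatMap fun t => (List.finRange d).map fun b => f t b).Nodup := by
    intro d f hf
    rw [List.nodup_flatMap]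
    refine ⟨fun t _ => (List.nodup_finRange d).map fun b b' h => (hf t b t b' h).2, ?_⟩
    refine (List.nodup_finRange k).imp fun {t t'} hne => ?_
    rw [Function.onFun, List.disjoint_left]
    intro q hq hq'
    obtain ⟨b, -, rfl⟩ := List.mem_map.1 hq
    obtain ⟨b', -, h⟩ := List.mem_map.1 hq'
    exact hne (hf _ _ _ _ h).1.symm
  rw [diffWires, List.nodup_append]
  refine ⟨key a _ fun t b t' b' h => by simpa using h, key e _ fun t b t' b' h => by simpa using h,
    ?_⟩
  intro q hq q' hq' h
  subst h
  simp only [List.mem_flatMap, List.mem_map] at hq hq'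
  obtain ⟨t, -, b, -, rfl⟩ := hq
  obtain ⟨t', -, b', -, h⟩ := hq'
  simp at h

/-- The number of qubits that are acted upon by the Hadamard gates. -/
def numDiff (k a e : ℕ) : ℕ := k * a + k * e

theorem diffusion_ket_zero (v : Bool) (s : Fin m → Bool) (fl : Bool) (j : Fin n → Bool) :
    Circuit.mat (diffusion k a e m (3 * c + 2) n) *ᵥ
        ket (st (fun _ => 0) (fun _ => 0) (fun _ => 0) v s fl j) =
      ∑ z : (Fin k × Fin a) ⊕ (Fin k × Fin e) → Bool, (1 / (Real.sqrt 2 : ℂ) ^ numDiff k a e) •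
        ket (st (fun t => Nat.ofBits fun b => z (.inl (t, b)))
          (fun t => Nat.ofBits fun b => z (.inr (t, b))) (fun _ => 0) v s fl j) := by
  rw [diffusion_eq, hadamards_ket diffWire_injective _ nodup_diffWires mem_diffWires]
  refine Finset.sum_congr rfl fun z _ => ?_
  have h1 : ∀ b : (Fin k × Fin a) ⊕ (Fin k × Fin e), (st (fun _ => 0) (fun _ => 0) (fun _ => 0) v
      s fl j : Wire k a e m c n → Bool) (diffWire b) = false := by
    rintro (⟨t, b⟩ | ⟨t, b⟩) <;> simp [st, diffWire]
  congr 1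
  · simp [h1, sg, numDiff]
  · congr 1
    symm
    rw [eq_extend_iff diffWire_injective]
    constructor
    · intro q hq
      rcases q with q | l
      · cases q with
        | p t b => exact absurd rfl (hq (.inl (t, b)))
        | i t b => exact absurd rfl (hq (.inr (t, b)))
        | _ => rfl
      · rfl
    · ext b
      rcases b with ⟨t, b⟩ | ⟨t, b⟩ <;> simp [st, diffWire]

/-- The amplitude of a basis state in the uniform superposition over the registers that are acted
upon by the Hadamard gates. -/
theorem diffusion_apply (x : Fin n → Bool) (P I Q : Fin k → ℕ) (v : Bool) (s : Fin m → Bool)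
    (fl : Bool) (j : Fin n → Bool) :
    (Circuit.mat (diffusion k a e m (3 * c + 2) n) *ᵥ ket (st P I Q v s fl j))
        (st (fun _ => 0) (fun _ => 0) (fun _ => 0) false (fun _ => false) false x) =
      if (∀ t, ∀ b : Fin a, (Q t).testBit b = false) ∧ v = false ∧ s = (fun _ => false) ∧
        fl = false ∧ j = x then 1 / (Real.sqrt 2 : ℂ) ^ numDiff k a e else 0 := by
  refine (mulVec_ket_apply _ _ _).trans ?_
  rw [diffusion_eq, hadamards_apply _ nodup_diffWires]
  have hlen : (diffWires k a e m c n).length = numDiff k a e := by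
    simp [diffWires, List.length_flatMap, numDiff]
  have hprod : ((diffWires k a e m c n).map fun q =>
      sg ((st (fun _ => 0) (fun _ => 0) (fun _ => 0) false (fun _ => false) false x :
        Wire k a e m c n → Bool) q && st P I Q v s fl j q)).prod = 1 := by
    refine List.prod_eq_one fun z hz => ?_
    obtain ⟨q, hq, rfl⟩ := List.mem_map.1 hz
    obtain ⟨⟨t, b⟩ | ⟨t, b⟩, rfl⟩ := (mem_diffWires q).1 hq <;> simp [st, diffWire, sg]
  rw [hlen, hprod]
  suffices key : (∀ q, q ∉ diffWires k a e m c n → (st (fun _ => 0) (fun _ => 0) (fun _ => 0) false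
      (fun _ => false) false x : Wire k a e m c n → Bool) q = st P I Q v s fl j q) ↔
      (∀ t, ∀ b : Fin a, (Q t).testBit b = false) ∧ v = false ∧ s = (fun _ => false) ∧
          fl = false ∧ j = x by
    simp only [key]
  simp only [mem_diffWires]
  constructor
  · intro h
    refine ⟨fun t b => ?_, ?_, ?_, ?_, ?_⟩
    · have := h (Sum.inl (Anc.q t b)) (by rintro ⟨⟨t, b⟩ | ⟨t, b⟩, h⟩ <;> simp [diffWire] at h)
      simpa [st] using this.symm
    · have := h (Sum.inl Anc.valid) (by rintro ⟨⟨t, b⟩ | ⟨t, b⟩, h⟩ <;> simp [diffWire] at h)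
      simpa [st] using this.symm
    · ext b
      have := h (Sum.inl (Anc.amp b)) (by rintro ⟨⟨t, b⟩ | ⟨t, b⟩, h⟩ <;> simp [diffWire] at h)
      simpa [st] using this.symm
    · have := h flag (by rintro ⟨⟨t, b⟩ | ⟨t, b⟩, h⟩ <;> simp [diffWire, flag] at h)
      simpa [st, flag] using this.symm
    · ext l
      have := h (Sum.inr l) (by rintro ⟨⟨t, b⟩ | ⟨t, b⟩, h⟩ <;> simp [diffWire] at h)
      simpa [st] using this.symm
  · rintro ⟨hQ, rfl, rfl, rfl, rfl⟩ q hq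
    rcases q with q | l
    · cases q with
      | p t b => exact absurd ⟨.inl (t, b), rfl⟩ hq
      | i t b => exact absurd ⟨.inr (t, b), rfl⟩ hq
      | q t b => simp [st, hQ t b]
      | _ => simp [st]
    · rfl

variable {η : ℕ} {β : (Fin k → Fin n) → (Fin k → Fin n) → ℤ}
  {occ amplitude sparsity uncompute : Circuit (Wire k a e m c n)}

/-- The contribution of valid indices and labels to the block. -/
theorem OracleSpec.contribution (h : OracleSpec η β occ amplitude sparsity uncompute)
    {x y : Fin n → Bool} (hy : particles y = η) (P Q : Fin k → Fin n) (I : Fin k → ℕ)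
    (hI : ∀ t, IsAddr y (I t) (Q t)) :
    (Circuit.mat (occ ++ amplitude ++ sparsity ++ uncompute ++
        diffusion k a e m (3 * c + 2) n) *ᵥ
        ket (st (fun t => P t) I (fun _ => 0) true (fun _ => false) false y))
        (st (fun _ => 0) (fun _ => 0) (fun _ => 0) false (fun _ => false) false x) =
      1 / (Real.sqrt 2 : ℂ) ^ numDiff k a e *
        ((β P Q : ℂ) / 2 ^ (m - 1) * monomial P Q x y) := by
  simp only [Circuit.mat_append_mulVec]
  rw [h.occ_apply _ _ _ Q _ _ _ _ hy hI]
  simp only [Nat.zero_xor]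
  obtain ⟨φ, hφ, hφ'⟩ := h.amplitude_apply (fun t => P t) I (fun t => Q t) true false y
  rw [hφ', Matrix.mulVec_sum, Matrix.mulVec_sum, Matrix.mulVec_sum]
  simp only [Matrix.mulVec_smul, h.sparsity_apply, Finset.sum_apply, Pi.smul_apply, smul_eq_mul]
  rw [← hφ P Q rfl rfl, monomial_apply]
  by_cases hs : survives (orbitals P Q) y (positions k) = true
  · simp only [hs, if_true, Bool.not_true, true_and]
    set y' := moved (orbitals P Q) (positions k) y with hy'
    have hM : monomial P Q y' y ≠ 0 := (monomial_ne_zero_iff ..).2 ⟨hs, rfl⟩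
    have hunc := fun s => h.uncompute_apply P Q I (fun t => occupiedBelow y' (P t)) false s false y
      y' hy hM hI fun t => ⟨(occupied_of_monomial_ne_zero hM t).2, rfl⟩
    simp only [hunc, diffusion_apply, Nat.zero_testBit, true_and, implies_true]
    rw [Finset.sum_eq_single (fun _ => false)]
    · by_cases hx : x = y'
      · simp only [hx, and_self, if_true]; ring
      · simp [hx, Ne.symm hx]
    · intro s _ hs; simp [hs]
    · simp
  · simp only [eq_false hs, false_and, if_false, mul_zero]
    rw [Bool.not_eq_true] at hs
    refine Finset.sum_eq_zero fun s _ => ?_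
    obtain ⟨P', I', Q', hk⟩ := h.uncompute_keep (fun t => P t) I (fun t => Q t) true s false y
    simp only [hs, Bool.not_false, hk, diffusion_apply]
    simp

/-- Invalid indices or labels do not contribute to the block. -/
theorem OracleSpec.contribution_invalid (h : OracleSpec η β occ amplitude sparsity uncompute)
    {x y : Fin n → Bool} (hy : particles y = η) (P I : Fin k → ℕ) (hP : ∀ t, P t < 2 ^ a)
    (hI : ∀ t, I t < 2 ^ e) (hbad : ¬ ((∀ t, P t < n) ∧ ∀ t, I t < η)) :
    (Circuit.mat (occ ++ amplitude ++ sparsity ++ uncompute ++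
        diffusion k a e m (3 * c + 2) n) *ᵥ
        ket (st P I (fun _ => 0) true (fun _ => false) false y))
        (st (fun _ => 0) (fun _ => 0) (fun _ => 0) false (fun _ => false) false x) = 0 := by
  simp only [Circuit.mat_append_mulVec]
  by_cases hI' : ∀ t, I t < η
  · obtain ⟨t, ht⟩ : ∃ t, n ≤ P t := by
      by_contra! hcon
      exact hbad ⟨hcon, hI'⟩
    choose Q hQ using fun t => exists_isAddr (hy.symm ▸ hI' t : I t < particles y)
    rw [h.occ_apply _ _ _ Q _ _ _ _ hy hQ]
    obtain ⟨φ, -, hφ'⟩ := h.amplitude_apply P I (fun t => 0 ^^^ (Q t : ℕ)) true false y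
    rw [hφ', Matrix.mulVec_sum, Matrix.mulVec_sum, Matrix.mulVec_sum, Finset.sum_apply]
    refine Finset.sum_eq_zero fun s _ => ?_
    obtain ⟨z, hz⟩ := h.sparsity_invalid P I (fun t => 0 ^^^ (Q t : ℕ)) s false y t (hP t) ht
    obtain ⟨P', I', Q', hk⟩ := h.uncompute_keep P I (fun t => 0 ^^^ (Q t : ℕ)) true s false y
    simp only [Matrix.mulVec_smul, hz, hk, Pi.smul_apply, diffusion_apply]
    simp
  · obtain ⟨t, ht⟩ : ∃ t, η ≤ I t := by
      by_contra! hcon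
      exact hI' hcon
    obtain ⟨P', I', Q', ho⟩ := h.occ_invalid P I (fun _ => 0) true (fun _ => false) false y t hy
      (hI t) ht
    rw [ho]
    obtain ⟨φ, -, hφ'⟩ := h.amplitude_apply P' I' Q' true true y
    rw [Bool.not_false, hφ', Matrix.mulVec_sum, Matrix.mulVec_sum, Matrix.mulVec_sum,
      Finset.sum_apply]
    refine Finset.sum_eq_zero fun s _ => ?_
    obtain ⟨z, P₁, I₁, Q₁, v₁, s₁, j₁, hz⟩ := h.sparsity_flag P' I' Q' true s true y
    obtain ⟨P₂, I₂, Q₂, hk⟩ := h.uncompute_keep P₁ I₁ Q₁ v₁ s₁ true j₁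
    simp only [Matrix.mulVec_smul, hz, hk, Pi.smul_apply, diffusion_apply]
    simp

/-- The block of the complete circuit: valid pairs of creation indices and labels correspond to
pairs of creation and annihilation indices with occupied annihilation indices. -/
theorem OracleSpec.zeroBlock_apply (h : OracleSpec η β occ amplitude sparsity uncompute)
    (hn : n ≤ 2 ^ a) (hη : η ≤ 2 ^ e) (x y : Fin n → Bool) (hy : particles y = η) :
    zeroBlock (Circuit.mat ([Gate.pauliX (Sum.inl Anc.valid)] ++ diffusion k a e m (3 * c + 2) n ++
      occ ++ amplitude ++ sparsity ++ uncompute ++ diffusion k a e m (3 * c + 2) n)) x y =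
      1 / 2 ^ numDiff k a e *
        ∑ P : Fin k → Fin n, ∑ Q : Fin k → Fin n, (β P Q : ℂ) / 2 ^ (m - 1) * monomial P Q x y := by
  have hz : ∀ w : Fin n → Bool, (Sum.elim (fun _ => false) w : Wire k a e m c n → Bool) =
      st (fun _ => 0) (fun _ => 0) (fun _ => 0) false (fun _ => false) false w := by
    intro w; ext r
    rcases r with r | l
    · cases r <;> simp [st]
    · rfl
  have hX : Function.update (st (fun _ => 0) (fun _ => 0) (fun _ => 0) false (fun _ => false) false
      y : Wire k a e m c n → Bool) (Sum.inl Anc.valid) (!(st (fun _ => 0) (fun _ => 0) (fun _ => 0)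
      false (fun _ => false) false y : Wire k a e m c n → Bool) (Sum.inl Anc.valid)) =
      st (fun _ => 0) (fun _ => 0) (fun _ => 0) true (fun _ => false) false y := by
    ext r
    by_cases hr : r = Sum.inl Anc.valid
    · subst hr; simp [st]
    · rw [Function.update_of_ne hr]
      rcases r with r | l
      · cases r <;> first | rfl | exact absurd rfl hr
      · rfl
  set R := occ ++ amplitude ++ sparsity ++ uncompute ++ diffusion k a e m (3 * c + 2) n with hR
  have hcirc : [Gate.pauliX (Sum.inl Anc.valid)] ++ diffusion k a e m (3 * c + 2) n ++
      occ ++ amplitude ++ sparsity ++ uncompute ++ diffusion k a e m (3 * c + 2) n =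
      [Gate.pauliX (Sum.inl Anc.valid)] ++ diffusion k a e m (3 * c + 2) n ++ R := by
    simp [hR, List.append_assoc]
  rw [hcirc, zeroBlock, Matrix.of_apply, hz, hz]
  refine (mulVec_ket_apply _ _ _).symm.trans ?_
  rw [Circuit.mat_append_mulVec _ R, Circuit.mat_append_mulVec [_], Circuit.mat_singleton,
    pauliX_ket, hX, diffusion_ket_zero, Matrix.mulVec_sum, Finset.sum_apply]
  simp only [Matrix.mulVec_smul, Pi.smul_apply, smul_eq_mul]
  rw [← Finset.mul_sum]
  have hsq : (1 : ℂ) / 2 ^ numDiff k a e =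
      1 / (Real.sqrt 2 : ℂ) ^ numDiff k a e * (1 / (Real.sqrt 2 : ℂ) ^ numDiff k a e) := by
    rw [div_mul_div_comm, ← mul_pow, ← Complex.ofReal_mul, Real.mul_self_sqrt (by norm_num)]
    norm_num
  rw [hsq, mul_assoc]
  congr 1
  rw [← Fintype.sum_prod_type' (f := fun P Q => (β P Q : ℂ) / 2 ^ (m - 1) * monomial P Q x y),
    Finset.mul_sum]
  -- only occupied annihilation indices contribute
  rw [← Finset.sum_filter_of_ne (p := fun p : (Fin k → Fin n) × (Fin k → Fin n) =>
    ∀ t, y (p.2 t) = true) fun p _ hp t => (occupied_of_monomial_ne_zero (P := p.1) (x := x)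
      (fun h0 => hp (by rw [h0, mul_zero, mul_zero])) t).1]
  symm
  set enc : (Fin k → Fin n) × (Fin k → Fin n) → (Fin k × Fin a) ⊕ (Fin k × Fin e) → Bool :=
    fun p => Sum.elim (fun tb => (p.1 tb.1 : ℕ).testBit tb.2)
      (fun tb => (occupiedBelow y (p.2 tb.1)).testBit tb.2) with henc
  have dec₁ : ∀ p t, Nat.ofBits (fun b => enc p (.inl (t, b))) = p.1 t := by
    intro p t
    simp only [henc, Sum.elim_inl]
    rw [Nat.ofBits_testBit, Nat.mod_eq_of_lt ((p.1 t).2.trans_le hn)]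
  have dec₂ : ∀ p : (Fin k → Fin n) × (Fin k → Fin n), (∀ t, y (p.2 t) = true) →
      ∀ t, Nat.ofBits (fun b => enc p (.inr (t, b))) = occupiedBelow y (p.2 t) := by
    intro p hp t
    simp only [henc, Sum.elim_inr]
    rw [Nat.ofBits_testBit,
      Nat.mod_eq_of_lt ((hy ▸ occupiedBelow_lt_particles (hp t)).trans_le hη)]
  refine Finset.sum_of_injOn enc ?_ (fun _ _ => Finset.mem_coe.2 (Finset.mem_univ _)) ?_ ?_
  · intro p hp p' hp' hpp
    have hp := (Finset.mem_filter.1 (Finset.mem_coe.1 hp)).2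
    have hp' := (Finset.mem_filter.1 (Finset.mem_coe.1 hp')).2
    refine Prod.ext (funext fun t => Fin.ext ?_) (funext fun t => ?_)
    · rw [← dec₁, ← dec₁, hpp]
    · refine IsAddr.unique (j := y) ⟨hp t, rfl⟩ ⟨hp' t, ?_⟩
      rw [← dec₂ p hp, ← dec₂ p' hp', hpp]
  · intro z _ hz
    refine h.contribution_invalid hy _ _ (fun t => Nat.ofBits_lt_two_pow _)
      (fun t => Nat.ofBits_lt_two_pow _) ?_
    rintro ⟨hP, hI⟩
    choose Q hQ using fun t => exists_isAddr (hy.symm ▸ hI t :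
      Nat.ofBits (fun b => z (.inr (t, b))) < particles y)
    refine hz ⟨(fun t => ⟨_, hP t⟩, Q), by simpa using fun t => (hQ t).1, ?_⟩
    ext q
    rcases q with ⟨t, b⟩ | ⟨t, b⟩
    · simp [henc]
    · simp [henc, (hQ t).2]
  · intro p hp
    have hp := (Finset.mem_filter.1 hp).2
    simp only [dec₁, dec₂ p hp]
    exact (h.contribution hy p.1 p.2 _ fun t => ⟨hp t, rfl⟩).symm

end Block

/-! ### The approximation error -/

/-- The Schur test: a matrix whose absolute row and column sums are at most `R` has spectral norm
at most `R`. -/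
theorem norm_le_of_sum_le {ι κ : Type*} [Fintype ι] [Fintype κ] [DecidableEq κ]
    (A : Matrix ι κ ℂ) {R : ℝ} (hR : 0 ≤ R) (hrow : ∀ x, ∑ y, ‖A x y‖ ≤ R)
    (hcol : ∀ y, ∑ x, ‖A x y‖ ≤ R) : ‖A‖ ≤ R := by
  rw [Matrix.l2_opNorm_def]
  refine ContinuousLinearMap.opNorm_le_bound _ hR fun v => ?_
  refine le_of_sq_le_sq ?_ (by positivity)
  rw [mul_pow, EuclideanSpace.norm_sq_eq, EuclideanSpace.norm_sq_eq]
  have h1 : ∀ x, ‖(A *ᵥ v.ofLp) x‖ ^ 2 ≤ R * ∑ y, ‖A x y‖ * ‖v y‖ ^ 2 := by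
    intro x
    calc ‖(A *ᵥ v.ofLp) x‖ ^ 2 ≤ (∑ y, ‖A x y‖ * ‖v y‖) ^ 2 := by
          gcongr
          refine (norm_sum_le _ _).trans (le_of_eq ?_)
          exact Finset.sum_congr rfl fun y _ => norm_mul _ _
      _ ≤ (∑ y, ‖A x y‖) * ∑ y, ‖A x y‖ * ‖v y‖ ^ 2 :=
          Finset.sum_sq_le_sum_mul_sum_of_sq_le_mul _ (fun y _ => norm_nonneg _)
            (fun y _ => by positivity) fun y _ => le_of_eq (by ring)
      _ ≤ _ := by
          gcongr
          exact hrow x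
  calc _ ≤ ∑ x, R * ∑ y, ‖A x y‖ * ‖v y‖ ^ 2 := Finset.sum_le_sum fun x _ => h1 x
    _ = R * ∑ y, (∑ x, ‖A x y‖) * ‖v y‖ ^ 2 := by
        rw [← Finset.mul_sum, Finset.sum_comm]
        simp only [Finset.sum_mul]
    _ ≤ R * ∑ y, R * ‖v y‖ ^ 2 := by
        gcongr with y
        exact hcol y
    _ = _ := by rw [← Finset.mul_sum]; ring

section Error

variable {n k : ℕ}

theorem card_occupied (y : Fin n → Bool) :
    (Finset.univ.filter fun Q : Fin k → Fin n => ∀ t, y (Q t) = true).card = particles y ^ k := by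
  have : (Finset.univ.filter fun Q : Fin k → Fin n => ∀ t, y (Q t) = true) =
      Fintype.piFinset fun _ => Finset.univ.filter fun l => y l = true := by
    ext Q; simp
  rw [this, Fintype.card_piFinset_const, particles]

theorem sum_norm_monomial_col_le (P Q : Fin k → Fin n) (y : Fin n → Bool) :
    ∑ x, ‖monomial P Q x y‖ ≤ if ∀ t, y (Q t) = true then 1 else 0 := by
  have h0 : ∀ x, x ≠ moved (orbitals P Q) (positions k) y → ‖monomial P Q x y‖ = 0 := by
    intro x hx
    rw [norm_eq_zero]
    by_contra h
    exact hx ((monomial_ne_zero_iff ..).1 h).2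
  rw [Finset.sum_eq_single _ (fun x _ hx => h0 x hx) (by simp)]
  split_ifs with h
  · exact norm_monomial_apply_le ..
  · refine le_of_eq (norm_eq_zero.2 ?_)
    by_contra h'
    exact h fun t => (occupied_of_monomial_ne_zero h' t).1

theorem sum_norm_monomial_row_le (η : ℕ) (P Q : Fin k → Fin n) (x : Fin n → Bool) :
    ∑ y : {j : Fin n → Bool // particles j = η}, ‖monomial P Q x y‖ ≤
      if (∀ t, x (P t) = true) ∧ particles x = η then 1 else 0 := by
  split_ifs with h
  · have h0 : ∀ y : Fin n → Bool, monomial P Q x y ≠ 0 →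
        y = moved (orbitals P Q) (positions k) x := by
      intro y hy
      rw [((monomial_ne_zero_iff ..).1 hy).2, moved_moved]
    by_cases hz : ∃ y : {j : Fin n → Bool // particles j = η}, monomial P Q x y ≠ 0
    · obtain ⟨y, hy⟩ := hz
      rw [Finset.sum_eq_single y]
      · exact norm_monomial_apply_le ..
      · intro y' _ hne
        rw [norm_eq_zero]
        by_contra h'
        exact hne (Subtype.ext ((h0 _ h').trans (h0 _ hy).symm))
      · simp
    · push Not at hz
      rw [Finset.sum_eq_zero fun y _ => by rw [hz y, norm_zero]]
      norm_num
  · refine le_of_eq (Finset.sum_eq_zero fun y _ => norm_eq_zero.2 ?_)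
    by_contra h'
    exact h ⟨fun t => (occupied_of_monomial_ne_zero h' t).2,
      (particles_of_monomial_ne_zero h').trans y.2⟩

/-- A `k`-body operator with coefficients of modulus at most `d` has norm at most `d (nη)^k` on the
`η`-particle subspace: each row and each column has at most `(nη)^k` contributions. -/
theorem norm_restrict_le (η : ℕ) {d : ℝ} (hd : 0 ≤ d)
    (δ : (Fin k → Fin n) → (Fin k → Fin n) → ℂ) (hδ : ∀ P Q, ‖δ P Q‖ ≤ d) :
    ‖(∑ P, ∑ Q, δ P Q • monomial P Q).submatrix id
      (Subtype.val : {j : Fin n → Bool // particles j = η} → (Fin n → Bool))‖ ≤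
      d * ((n : ℝ) * η) ^ k := by
  have hentry : ∀ x y, ‖(∑ P, ∑ Q, δ P Q • monomial P Q) x y‖ ≤
      ∑ P : Fin k → Fin n, ∑ Q : Fin k → Fin n, d * ‖monomial P Q x y‖ := by
    intro x y
    simp only [Matrix.sum_apply, Matrix.smul_apply, smul_eq_mul]
    refine (norm_sum_le _ _).trans (Finset.sum_le_sum fun P _ => (norm_sum_le _ _).trans
      (Finset.sum_le_sum fun Q _ => ?_))
    rw [norm_mul]
    exact mul_le_mul_of_nonneg_right (hδ P Q) (norm_nonneg _)
  refine norm_le_of_sum_le _ (by positivity) (fun x => ?_) fun y => ?_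
  · calc _ ≤ ∑ y : {j : Fin n → Bool // particles j = η},
          ∑ P : Fin k → Fin n, ∑ Q : Fin k → Fin n, d * ‖monomial P Q x y‖ :=
          Finset.sum_le_sum fun y _ => hentry x y
      _ = d * ∑ P : Fin k → Fin n, ∑ Q : Fin k → Fin n,
          ∑ y : {j : Fin n → Bool // particles j = η}, ‖monomial P Q x y‖ := by
          rw [Finset.sum_comm, Finset.mul_sum]
          refine Finset.sum_congr rfl fun P _ => ?_
          rw [Finset.sum_comm, Finset.mul_sum]
          refine Finset.sum_congr rfl fun Q _ => ?_
          rw [Finset.mul_sum]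
      _ ≤ d * ∑ P : Fin k → Fin n, ∑ Q : Fin k → Fin n,
          if (∀ t, x (P t) = true) ∧ particles x = η then (1 : ℝ) else 0 := by
          gcongr with P _ Q _
          exact sum_norm_monomial_row_le η P Q x
      _ ≤ d * ((n : ℝ) * η) ^ k := by
          gcongr
          simp only [Finset.sum_const, Finset.card_univ, Fintype.card_pi, Fintype.card_fin,
            Finset.prod_const, nsmul_eq_mul]
          rw [← Finset.mul_sum, mul_pow]
          push_cast
          gcongr
          by_cases hx : particles x = η
          · simp only [hx, and_true]
            rw [Finset.sum_boole, card_occupied, hx]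
            push_cast
            exact le_rfl
          · simp [hx]
  · calc _ ≤ ∑ x, ∑ P : Fin k → Fin n, ∑ Q : Fin k → Fin n, d * ‖monomial P Q x y‖ :=
          Finset.sum_le_sum fun x _ => hentry x y
      _ = d * ∑ P : Fin k → Fin n, ∑ Q : Fin k → Fin n, ∑ x, ‖monomial P Q x y‖ := by
          rw [Finset.sum_comm, Finset.mul_sum]
          refine Finset.sum_congr rfl fun P _ => ?_
          rw [Finset.sum_comm, Finset.mul_sum]
          refine Finset.sum_congr rfl fun Q _ => ?_
          rw [Finset.mul_sum]
      _ ≤ d * ∑ P : Fin k → Fin n, ∑ Q : Fin k → Fin n,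
          if ∀ t, (y : Fin n → Bool) (Q t) = true then (1 : ℝ) else 0 := by
          gcongr with P _ Q _
          exact sum_norm_monomial_col_le P Q y
      _ ≤ d * ((n : ℝ) * η) ^ k := by
          gcongr
          rw [Finset.sum_boole, card_occupied, y.2]
          simp [mul_pow]

end Error

/-! ### The block encoding -/

section Encoding

variable {k a e m c n η : ℕ} {β : (Fin k → Fin n) → (Fin k → Fin n) → ℤ}
  {occ amplitude sparsity uncompute : Circuit (Wire k a e m c n)}

theorem OracleSpec.isBlockEncodingOn (h : OracleSpec η β occ amplitude sparsity uncompute)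
    (hn : n ≤ 2 ^ a) (hη : η ≤ 2 ^ e) {Λ ε : ℝ} (hΛ : 0 < Λ)
    (co : (Fin k → Fin n) → (Fin k → Fin n) → ℝ)
    (hβ : ∀ P Q, |co P Q / Λ - (β P Q : ℝ) / 2 ^ (m - 1)| ≤ 1 / 2 ^ (m - 1))
    (hε : Λ / 2 ^ (m - 1) * ((n : ℝ) * η) ^ k ≤ ε) :
    IsBlockEncodingOn η (Circuit.mat ([Gate.pauliX (Sum.inl Anc.valid)] ++
      diffusion k a e m (3 * c + 2) n ++ occ ++ amplitude ++ sparsity ++ uncompute ++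
      diffusion k a e m (3 * c + 2) n)) (Λ * 2 ^ numDiff k a e) ε (hamiltonian co) := by
  refine ⟨Circuit.mat_mem_unitaryGroup _, ?_⟩
  refine le_trans (le_of_eq ?_) ((norm_restrict_le η (d := Λ / 2 ^ (m - 1)) (by positivity)
    (fun P Q => (co P Q : ℂ) - Λ * ((β P Q : ℂ) / 2 ^ (m - 1))) fun P Q => ?_).trans hε)
  · congr 1
    ext x y
    simp only [Matrix.submatrix_apply, id, Matrix.sub_apply, Matrix.smul_apply, smul_eq_mul,
      h.zeroBlock_apply hn hη x y y.2, hamiltonian, Matrix.sum_apply, sub_mul,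
      Finset.sum_sub_distrib]
    congr 1
    push_cast
    have h2 : (2 : ℂ) ^ numDiff k a e ≠ 0 := pow_ne_zero _ two_ne_zero
    rw [← mul_assoc, mul_assoc (Λ : ℂ), mul_one_div_cancel h2, mul_one, Finset.mul_sum]
    refine Finset.sum_congr rfl fun P _ => ?_
    rw [Finset.mul_sum]
    exact Finset.sum_congr rfl fun Q _ => (mul_assoc _ _ _).symm
  · have e1 : ((co P Q : ℂ) - Λ * ((β P Q : ℂ) / 2 ^ (m - 1))) =
        ((Λ * (co P Q / Λ - (β P Q : ℝ) / 2 ^ (m - 1)) : ℝ) : ℂ) := by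
      rw [mul_sub, mul_div_cancel₀ _ hΛ.ne']
      push_cast
      ring
    rw [e1, Complex.norm_real, Real.norm_eq_abs, abs_mul, abs_of_pos hΛ]
    calc _ ≤ Λ * (1 / 2 ^ (m - 1)) := by
          gcongr
          exact hβ P Q
      _ = _ := by ring

/-- Rounding towards zero, except at the end points of the interval. -/
theorem exists_round {N : ℤ} (hN : 0 < N) {x : ℝ} (hx : |x| ≤ 1) :
    ∃ b : ℤ, |b| < N ∧ |x - b / N| ≤ 1 / N := by
  have hN' : (0 : ℝ) < N := by exact_mod_cast hN
  have pos : ∀ x : ℝ, 0 ≤ x → x ≤ 1 → ∃ b : ℤ, |b| < N ∧ |x - b / N| ≤ 1 / N := by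
    intro x h0 h1
    have hf0 : 0 ≤ ⌊x * N⌋ := Int.floor_nonneg.2 (by positivity)
    by_cases h : ⌊x * N⌋ < N
    · refine ⟨⌊x * N⌋, by rwa [abs_of_nonneg hf0], ?_⟩
      have h2 := Int.floor_le (x * N)
      have h3 := Int.lt_floor_add_one (x * N)
      have e : x - ⌊x * N⌋ / N = (x * N - ⌊x * N⌋) / N := by field_simp
      rw [e, abs_of_nonneg (div_nonneg (by linarith) hN'.le)]
      gcongr
      linarith
    · refine ⟨N - 1, by rw [abs_of_nonneg] <;> omega, ?_⟩
      have h2 := Int.floor_le (x * N)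
      have h4 : (N : ℝ) ≤ ⌊x * N⌋ := by exact_mod_cast not_lt.1 h
      have h5 : x = 1 := le_antisymm h1 (by
        by_contra! hlt
        nlinarith)
      rw [h5]
      push_cast
      have : (1 : ℝ) - (N - 1) / N = 1 / N := by field_simp; ring
      rw [this, abs_of_pos (by positivity)]
  rcases le_total 0 x with h | h
  · exact pos x h ((le_abs_self x).trans hx)
  · obtain ⟨b, hb, hb'⟩ := pos (-x) (by linarith) ((neg_le_abs x).trans hx)
    refine ⟨-b, by rwa [abs_neg], ?_⟩
    push_cast
    rw [← abs_neg]
    convert hb' using 2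
    ring

theorem exists_oracles {d r : ℕ} (hn : n ≤ 2 ^ a) (hη : η ≤ 2 ^ e) (hm : 1 ≤ m)
    (hβ : ∀ P Q, |β P Q| < 2 ^ (m - 1)) (hd : 2 * (k * a) = d + r)
    (hc₁ : n * e + k * (n * (e + 1)) + k ≤ c)
    (hc₂ : 2 ^ (d + 1) + 2 ^ (r + 1) + 2 ^ r * m + m ≤ c)
    (hc₃ : 2 * k * 2 ^ (a + 1) + 2 * k * (2 * n + 1) + n ≤ c)
    (hc₄ : 2 * k * 2 ^ (a + 1) + (n * e + k * (n * e)) ≤ c) :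
    ∃ occ amplitude sparsity uncompute : Circuit (Wire k a e m c n),
      OracleSpec η β occ amplitude sparsity uncompute ∧
      Circuit.tCount occ + Circuit.tCount amplitude + Circuit.tCount sparsity +
        Circuit.tCount uncompute ≤ 182 * c := by
  classical
  obtain ⟨C₁, h₁, f₁, g₁, -⟩ := exists_detect_circuit (a := a) (m := m) true hc₁
  have h2m : (2 : ℤ) ^ m = 2 * 2 ^ (m - 1) := by
    rw [← pow_succ', Nat.sub_add_cancel hm]
  -- the table holds the shifted numbers `2 ^ (m - 1) + β P Q`
  set T : (Fin k → ℕ) → (Fin k → ℕ) → ℕ := fun P Q =>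
    if h : (∀ t, P t < n) ∧ ∀ t, Q t < n then
      ((2 : ℤ) ^ (m - 1) + β (fun t => ⟨P t, h.1 t⟩) fun t => ⟨Q t, h.2 t⟩).toNat else 0 with hT
  have hTlt : ∀ P Q, T P Q < 2 ^ m := by
    intro P Q
    simp only [hT]
    split_ifs with h
    · have := abs_lt.1 (hβ (fun t => ⟨P t, h.1 t⟩) fun t => ⟨Q t, h.2 t⟩)
      zify
      rw [Int.toNat_of_nonneg (by omega)]
      omega
    · positivity
  obtain ⟨C₂, h₂, f₂⟩ := exists_amplitude_circuit (e := e) (n := n) T hTlt hd hc₂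
  obtain ⟨C₃, h₃, f₃, f₃', f₃''⟩ := exists_sparsity_circuit (e := e) (m := m) hn hc₃
  obtain ⟨C₄, h₄, f₄, f₄'⟩ := exists_uncompute_circuit (m := m) hn hc₄ hc₁
  refine ⟨C₁, C₂, C₃, C₄, ⟨?_, ?_, ?_, f₃, f₃', f₃'', ?_, f₄'⟩, by omega⟩
  · intro P I Q L v s fl j hj hL
    exact f₁ P I Q L v s fl j (hj ▸ hη) hL
  · intro P I Q v s fl j t hj hI hI'
    exact g₁ rfl P I Q v s fl j t (hj ▸ hη) hI (hj ▸ hI')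
  · intro P I Q v fl j
    obtain ⟨φ, hφ, hφ'⟩ := f₂ P I Q v fl j
    refine ⟨φ, ?_, hφ'⟩
    rintro P' Q' rfl rfl
    rw [hφ]
    have e1 : (fun t => (P' t : ℕ) % 2 ^ a) = fun t => (P' t : ℕ) :=
      funext fun t => Nat.mod_eq_of_lt ((P' t).2.trans_le hn)
    have e2 : (fun t => (Q' t : ℕ) % 2 ^ a) = fun t => (Q' t : ℕ) :=
      funext fun t => Nat.mod_eq_of_lt ((Q' t).2.trans_le hn)
    have e3 : ((T (fun t => P' t) (fun t => Q' t) : ℕ) : ℂ) = 2 ^ (m - 1) + β P' Q' := by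
      have hb := (abs_lt.1 (hβ P' Q')).1
      have hnn : (0 : ℤ) ≤ 2 ^ (m - 1) + β P' Q' := by omega
      have : ((T (fun t => P' t) (fun t => Q' t) : ℕ) : ℤ) = 2 ^ (m - 1) + β P' Q' := by
        simp only [hT]
        rw [dif_pos ⟨fun t => (P' t).2, fun t => (Q' t).2⟩]
        exact Int.toNat_of_nonneg hnn
      exact_mod_cast congrArg (fun z : ℤ => (z : ℂ)) this
    have e4 : (2 : ℂ) ^ m = 2 * 2 ^ (m - 1) := by exact_mod_cast congrArg (fun z : ℤ => (z : ℂ)) h2m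
    rw [e1, e2, e3, e4]
    have : (2 : ℂ) ^ (m - 1) ≠ 0 := pow_ne_zero _ two_ne_zero
    field_simp
    ring
  · intro P Q I I' v s fl j j' hj hM hI hI'
    exact f₄ P Q I I' v s fl j j' (hj ▸ hη) hM hI hI'

end Encoding

theorem OracleSpec.implements {k n η m c : ℕ} {β : (Fin k → Fin n) → (Fin k → Fin n) → ℤ}
    {occ amplitude sparsity uncompute : Circuit (Wire k (Nat.clog 2 n) (Nat.clog 2 η) m c n)}
    (h : OracleSpec η β occ amplitude sparsity uncompute) {Λ : ℝ}
    {co : (Fin k → Fin n) → (Fin k → Fin n) → ℝ}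
    (hβ : ∀ P Q, |β P Q| < 2 ^ (m - 1) ∧
      |co P Q / Λ - (β P Q : ℝ) / 2 ^ (m - 1)| ≤ 1 / 2 ^ (m - 1)) :
    (⟨3 * c + 2, occ, amplitude, sparsity, uncompute⟩ : EtaCircuit k n η m).Implements co Λ := by
  refine ⟨?_, ⟨β, hβ, ?_⟩, ?_, ?_⟩
  · intro P I Q v s j hj hQ
    simp only [config_eq_st]
    rw [h.occ_apply _ _ _ Q _ _ _ _ hj hQ, h.occ_apply _ _ _ Q _ _ _ _ hj hQ]
    simp
  · intro P Q I v j
    simp only [config_eq_st]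
    obtain ⟨φ, hφ, hφ'⟩ := h.amplitude_apply (fun t => P t) I (fun t => Q t) v false j
    exact ⟨φ, hφ P Q rfl rfl, hφ'⟩
  · intro P Q I s j
    simp only [config_eq_st, h.sparsity_apply]
    constructor
    · intro hM
      have hs : survives (orbitals P Q) j (positions k) = true := by
        rw [ne_eq, monomial_ket_eq_zero_iff, Bool.not_eq_false] at hM
        exact hM
      rw [Finset.sum_eq_single (moved (orbitals P Q) (positions k) j)]
      · simp [monomial_apply, hs]
      · intro j' _ hj'
        rw [monomial_apply, if_neg fun h => hj' h.2, zero_smul]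
      · simp
    · intro hM
      rw [monomial_ket_eq_zero_iff] at hM
      refine ⟨sg (negative (orbitals P Q) j (positions k)), ?_, ?_⟩
      · cases negative (orbitals P Q) j (positions k) <;> simp [sg]
      · simp [hM]
  · intro P Q I I' s j j' hj hM hI hI'
    simp only [config_eq_st]
    exact h.uncompute_apply P Q I I' false s false j j' hj hM hI hI'

theorem le_two_pow_bits {k n η : ℕ} {Λ ε : ℝ} (hε : 0 < ε) :
    Λ / 2 ^ (bits k n η Λ ε - 1) * ((n : ℝ) * η) ^ k ≤ ε := by
  have h1 : Λ * ((n : ℝ) * η) ^ k / ε ≤ 2 ^ (bits k n η Λ ε - 1) := by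
    refine (Nat.le_ceil _).trans ?_
    have := Nat.le_pow_clog one_lt_two ⌈Λ * ((n : ℝ) * η) ^ k / ε⌉₊
    rw [bits, Nat.add_sub_cancel]
    exact_mod_cast this
  rw [div_le_iff₀ hε] at h1
  rw [div_mul_eq_mul_div, div_le_iff₀ (by positivity)]
  linarith

theorem EtaCircuit.tCount_circuit {k n η m : ℕ} (E : EtaCircuit k n η m) :
    Circuit.tCount E.circuit = Circuit.tCount E.occ + Circuit.tCount E.amplitude +
      Circuit.tCount E.sparsity + Circuit.tCount E.uncompute := by
  obtain ⟨w, C₁, C₂, C₃, C₄⟩ := E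
  have h : Circuit.tCount (diffusion k (Nat.clog 2 n) (Nat.clog 2 η) m w n) = 0 := by
    refine List.sum_eq_zero fun x hx => ?_
    obtain ⟨g, hg, rfl⟩ := List.mem_map.1 hx
    simp only [diffusion, List.mem_append, List.mem_flatMap, List.mem_map] at hg
    rcases hg with ⟨t, -, b, -, rfl⟩ | ⟨t, -, b, -, rfl⟩ <;> rfl
  simp only [EtaCircuit.circuit, Circuit.tCount_append, h]
  simp [Circuit.tCount, Gate.tCount]

/-- The block encoding with its costs in terms of the number `c` of AND gates that suffices for
each of the oracles. -/
theorem exists_etaBlockEncodes {k n η d r c : ℕ} {Λ ε : ℝ} (hΛ : 0 < Λ) (hε : 0 < ε)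
    (co : (Fin k → Fin n) → (Fin k → Fin n) → ℝ) (hco : ∀ P Q, |co P Q| ≤ Λ)
    (hd : 2 * (k * Nat.clog 2 n) = d + r)
    (hc₁ : n * Nat.clog 2 η + k * (n * (Nat.clog 2 η + 1)) + k ≤ c)
    (hc₂ : 2 ^ (d + 1) + 2 ^ (r + 1) + 2 ^ r * bits k n η Λ ε + bits k n η Λ ε ≤ c)
    (hc₃ : 2 * k * 2 ^ (Nat.clog 2 n + 1) + 2 * k * (2 * n + 1) + n ≤ c)
    (hc₄ : 2 * k * 2 ^ (Nat.clog 2 n + 1) + (n * Nat.clog 2 η + k * (n * Nat.clog 2 η)) ≤ c) :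
    EtaBlockEncodes k n η co Λ ε (Λ * 2 ^ numDiff k (Nat.clog 2 n) (Nat.clog 2 η)) (182 * c) := by
  set m := bits k n η Λ ε with hm
  have hround : ∀ P Q, ∃ b : ℤ, |b| < 2 ^ (m - 1) ∧
      |co P Q / Λ - (b : ℝ) / 2 ^ (m - 1)| ≤ 1 / 2 ^ (m - 1) := by
    intro P Q
    have := exists_round (N := 2 ^ (m - 1)) (by positivity) (x := co P Q / Λ) (by
      rw [abs_div, abs_of_pos hΛ, div_le_one hΛ]
      exact hco P Q)
    simpa using this
  choose β hβ using hround
  have hn := Nat.le_pow_clog one_lt_two n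
  have hη := Nat.le_pow_clog one_lt_two η
  obtain ⟨C₁, C₂, C₃, C₄, hspec, hT⟩ := exists_oracles (m := m) hn hη (by simp [hm, bits])
    (fun P Q => (hβ P Q).1) hd hc₁ hc₂ hc₃ hc₄
  refine ⟨Λ * 2 ^ numDiff k (Nat.clog 2 n) (Nat.clog 2 η), ⟨3 * c + 2, C₁, C₂, C₃, C₄⟩,
    by positivity, le_rfl, hspec.implements hβ,
    hspec.isBlockEncodingOn hn hη hΛ co (fun P Q => (hβ P Q).2) (le_two_pow_bits hε), ?_⟩
  rw [EtaCircuit.tCount_circuit]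
  exact_mod_cast hT

/-! ### Gate counts -/

theorem EtaBlockEncodes.mono {k n η : ℕ} {h : (Fin k → Fin n) → (Fin k → Fin n) → ℝ}
    {Λ ε A A' T T' : ℝ} (H : EtaBlockEncodes k n η h Λ ε A T) (hA : A ≤ A') (hT : T ≤ T') :
    EtaBlockEncodes k n η h Λ ε A' T' := by
  obtain ⟨α, E, h0, h1, h2, h3, h4⟩ := H
  exact ⟨α, E, h0, h1.trans hA, h2, h3, h4.trans hT⟩

theorem BlockEncodes.mono {n η : ℕ} {H : Matrix (Fin n → Bool) (Fin n → Bool) ℂ}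
    {ε A A' T T' : ℝ} (h : BlockEncodes n η H ε A T) (hA : A ≤ A') (hT : T ≤ T') :
    BlockEncodes n η H ε A' T' := by
  obtain ⟨α, w, c, h0, h1, h2, h3⟩ := h
  exact ⟨α, w, c, h0, h1.trans hA, h2, h3.trans hT⟩

theorem two_pow_clog_le {n : ℕ} (hn : 1 ≤ n) : 2 ^ Nat.clog 2 n ≤ 2 * n := by
  rcases hn.eq_or_lt with rfl | h
  · simp
  · have h1 := Nat.pow_pred_clog_lt_self one_lt_two h
    have h2 : 2 ^ Nat.clog 2 n = 2 * 2 ^ (Nat.clog 2 n).pred := by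
      rw [← pow_succ', Nat.pred_eq_sub_one, Nat.sub_add_cancel (Nat.clog_pos one_lt_two h)]
    omega

theorem clog_le_two_mul_logb {η : ℕ} (hη : 1 ≤ η) : (Nat.clog 2 η : ℝ) ≤ 2 * Real.logb 2 η := by
  rcases hη.eq_or_lt with rfl | h
  · simp
  · have h1 : (2 : ℝ) ≤ η := by exact_mod_cast h
    have h2 : (1 : ℝ) ≤ Real.logb 2 η := by
      rw [Real.le_logb_iff_rpow_le one_lt_two (by linarith)]
      simpa using h1
    rw [← Real.natCeil_logb_natCast]
    have := Nat.ceil_lt_add_one (a := Real.logb ((2 : ℕ) : ℝ) η) (by push_cast; linarith)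
    push_cast at this ⊢
    linarith

/-- A number `n` with `n ^ 2 ≤ N` is at most one of `lam` and `N / lam`. -/
theorem le_div_add_mul {n N lam b : ℝ} (hn : 0 ≤ n) (hlam : 0 < lam) (hb : 1 ≤ b)
    (hN : n ^ 2 ≤ N) : n ≤ N / lam + lam * b := by
  rcases le_total n lam with h | h
  · have : 0 ≤ N / lam := div_nonneg ((sq_nonneg n).trans hN) hlam.le
    nlinarith
  · have : n ≤ N / lam := by
      rw [le_div_iff₀ hlam]
      nlinarith
    nlinarith

/-- The choice of `lam` that balances `N / lam` and `lam * b`. -/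
theorem exists_balanced {N b : ℕ} (hb : 1 ≤ b) (hbN : b ≤ N) :
    ∃ lam : ℕ, 1 ≤ lam ∧ lam ≤ N ∧ (N : ℝ) / lam + lam * b ≤ 3 * Real.sqrt (N * b) := by
  have hb' : (1 : ℝ) ≤ b := by exact_mod_cast hb
  have hbN' : (b : ℝ) ≤ N := by exact_mod_cast hbN
  have hN0 : (0 : ℝ) < N := by linarith
  set s : ℝ := Real.sqrt (N / b) with hs
  have hs1 : 1 ≤ s := by
    rw [hs, Real.one_le_sqrt, le_div_iff₀ (by linarith)]
    linarith
  have hsb : s * b = Real.sqrt (N * b) := by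
    have h1 : (N : ℝ) * b = N / b * b ^ 2 := by field_simp
    rw [h1, Real.sqrt_mul (by positivity), Real.sqrt_sq (by linarith)]
  have hss : (N : ℝ) = s * (s * b) := by
    rw [← mul_assoc, hs, Real.mul_self_sqrt (by positivity)]
    field_simp
  have h2 : s ≤ ⌈s⌉₊ := Nat.le_ceil s
  have h3 := Nat.ceil_lt_add_one (a := s) (by linarith)
  refine ⟨⌈s⌉₊, Nat.one_le_iff_ne_zero.2 (Nat.ceil_pos.2 (by linarith)).ne', ?_, ?_⟩
  · rw [Nat.ceil_le, hss]
    exact le_mul_of_one_le_right (by linarith) (one_le_mul_of_one_le_of_one_le hs1 hb')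
  · have h4 : (N : ℝ) / ⌈s⌉₊ ≤ s * b := by
      rw [div_le_iff₀ (by linarith)]
      nlinarith [mul_nonneg (by linarith : 0 ≤ s) (by linarith : (0 : ℝ) ≤ b)]
    rw [← hsb]
    nlinarith

theorem one_le_bits {k n η : ℕ} {Λ ε : ℝ} : 1 ≤ bits k n η Λ ε := Nat.le_add_left ..

/-- One number that bounds the numbers of AND gates of all the oracles, `Y` being that of the
amplitude oracle. -/
theorem costs_le {k n ℓ a Y : ℕ} (hk : k = 1 ∨ k = 2) (hn : 1 ≤ n) (ha : 2 ^ a ≤ 2 * n) :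
    n * ℓ + k * (n * (ℓ + 1)) + k ≤ 6 * (n * ℓ) + 49 * n + Y ∧
    Y ≤ 6 * (n * ℓ) + 49 * n + Y ∧
    2 * k * 2 ^ (a + 1) + 2 * k * (2 * n + 1) + n ≤ 6 * (n * ℓ) + 49 * n + Y ∧
    2 * k * 2 ^ (a + 1) + (n * ℓ + k * (n * ℓ)) ≤ 6 * (n * ℓ) + 49 * n + Y := by
  rw [mul_add n, pow_succ]
  generalize n * ℓ = x
  generalize 2 ^ a = y at *
  rcases hk with rfl | rfl <;> omega

theorem etaBlockEncodes_of_lam {k n η lam : ℕ} {Λ ε : ℝ} (hk : k = 1 ∨ k = 2) (hη : 1 ≤ η)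
    (hηn : η ≤ n) (hΛ : 0 < Λ) (hε : 0 < ε) (h : (Fin k → Fin n) → (Fin k → Fin n) → ℝ)
    (hh : ∀ P Q, |h P Q| ≤ Λ) (hlam : 1 ≤ lam) (hlam' : lam ≤ n ^ (2 * k)) :
    EtaBlockEncodes k n η h Λ ε (16 * (Λ * ((n : ℝ) * η) ^ k))
      (20566 * (n * Real.logb 2 η + (n : ℝ) ^ (2 * k) / lam + lam * bits k n η Λ ε)) := by
  have hn : 1 ≤ n := hη.trans hηn
  have h2n := two_pow_clog_le hn
  have h2η := two_pow_clog_le hη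
  have hnk : n ^ (2 * k) ≤ 2 ^ (2 * (k * Nat.clog 2 n)) := by
    rw [← mul_assoc, mul_comm (2 * k), pow_mul 2]
    exact Nat.pow_le_pow_left (Nat.le_pow_clog one_lt_two n) _
  have hnk' : 2 ^ (2 * (k * Nat.clog 2 n)) ≤ 16 * n ^ (2 * k) := by
    rw [← mul_assoc, mul_comm (2 * k), pow_mul 2]
    refine (Nat.pow_le_pow_left h2n _).trans ?_
    rw [mul_pow]
    refine Nat.mul_le_mul_right _ ?_
    rcases hk with rfl | rfl <;> norm_num
  -- the second group of index bits has `r` of them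
  set r := Nat.log 2 lam with hr
  have hr1 : 2 ^ r ≤ lam := Nat.pow_log_le_self 2 (by omega)
  have hr2 : lam < 2 ^ (r + 1) := Nat.lt_pow_succ_log_self one_lt_two lam
  have hrd : r ≤ 2 * (k * Nat.clog 2 n) := by
    rw [← Nat.pow_le_pow_iff_right one_lt_two]
    exact hr1.trans (hlam'.trans hnk)
  obtain ⟨d, hd⟩ := Nat.exists_eq_add_of_le' hrd
  set b := bits k n η Λ ε with hb
  set ℓ := Nat.clog 2 η with hℓ
  set a := Nat.clog 2 n with ha
  have hb1 : 1 ≤ b := one_le_bits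
  obtain ⟨hc₁, hc₂, hc₃, hc₄⟩ := costs_le (ℓ := ℓ)
    (Y := 2 ^ (d + 1) + 2 ^ (r + 1) + 2 ^ r * b + b) hk hn h2n
  refine (exists_etaBlockEncodes hΛ hε h hh hd hc₁ hc₂ hc₃ hc₄).mono ?_ ?_
  · have e : (2 : ℝ) ^ numDiff k a ℓ ≤ 16 * ((n : ℝ) * η) ^ k := by
      have : 2 ^ numDiff k a ℓ ≤ 16 * (n * η) ^ k := by
        rw [numDiff, pow_add, mul_comm k, mul_comm k, pow_mul, pow_mul, ← mul_pow]
        refine (Nat.pow_le_pow_left (Nat.mul_le_mul h2n h2η) k).trans ?_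
        have : 2 * n * (2 * η) = 4 * (n * η) := by ring
        rw [this, mul_pow]
        refine Nat.mul_le_mul_right _ ?_
        rcases hk with rfl | rfl <;> norm_num
      exact_mod_cast this
    calc _ ≤ Λ * (16 * ((n : ℝ) * η) ^ k) := by gcongr
      _ = _ := by ring
  · -- `20566 = 182 * 113`, where `113 = 49 + 64` is the coefficient of `n ^ (2 * k) / lam`
    have hlam0 : (1 : ℝ) ≤ lam := by exact_mod_cast hlam
    have hb1' : (1 : ℝ) ≤ b := by exact_mod_cast hb1
    have hn1 : (1 : ℝ) ≤ n := by exact_mod_cast hn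
    have e1 : (2 : ℝ) ^ (d + 1) ≤ 64 * ((n : ℝ) ^ (2 * k) / lam) := by
      rw [← mul_div_assoc, le_div_iff₀ (by linarith)]
      have : 2 ^ (d + 1) * lam ≤ 64 * n ^ (2 * k) :=
        calc 2 ^ (d + 1) * lam ≤ 2 ^ (d + 1) * 2 ^ (r + 1) := Nat.mul_le_mul_left _ hr2.le
          _ = 4 * 2 ^ (2 * (k * a)) := by rw [hd]; ring
          _ ≤ _ := by omega
      exact_mod_cast this
    have e2 : (2 : ℝ) ^ r ≤ lam := by exact_mod_cast hr1
    have e3 : (n : ℝ) * ℓ ≤ n * (2 * Real.logb 2 η) := by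
      gcongr
      exact clog_le_two_mul_logb hη
    have e4 := le_div_add_mul (n := n) (N := (n : ℝ) ^ (2 * k)) (lam := lam) (b := b)
      (by linarith) (by linarith) hb1' (pow_le_pow_right₀ hn1 (by omega))
    have e5 : (2 : ℝ) ^ r * b ≤ lam * b := by gcongr
    have e6 : (lam : ℝ) ≤ lam * b := le_mul_of_one_le_right (by linarith) hb1'
    have e7 : (b : ℝ) ≤ lam * b := le_mul_of_one_le_left (by linarith) hlam0
    have e8 : 0 ≤ (n : ℝ) * Real.logb 2 η := by
      have : 0 ≤ Real.logb 2 (η : ℝ) :=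
        Real.logb_nonneg one_lt_two (by exact_mod_cast hη)
      positivity
    push_cast
    rw [pow_succ (2 : ℝ) r]
    linarith

/-! ### Renaming the ancilla qubits -/

section Rename

variable {ι κ : Type}

/-- The same gate on renamed qubits. -/
def Gate.rename (e : ι ≃ κ) : Gate ι → Gate κ
  | .hadamard q => .hadamard (e q)
  | .phaseS q => .phaseS (e q)
  | .pauliX q => .pauliX (e q)
  | .cnot c t h => .cnot (e c) (e t) (e.injective.ne h)
  | .tGate q => .tGate (e q)
  | .tDagger q => .tDagger (e q)

theorem Circuit.tCount_rename (e : ι ≃ κ) (c : Circuit ι) :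
    Circuit.tCount (c.map (Gate.rename e)) = Circuit.tCount c := by
  simp only [Circuit.tCount, List.map_map]
  congr 2
  ext g
  cases g <;> rfl

theorem eq_update_comp_iff [DecidableEq ι] [DecidableEq κ] (e : ι ≃ κ) (x y : κ → Bool) (q : ι)
    (b : Bool) :
    x ∘ e = Function.update (y ∘ e) q b ↔ x = Function.update y (e q) b := by
  rw [← Function.update_comp_eq_of_injective _ e.injective,
    e.surjective.injective_comp_right.eq_iff]

variable [Fintype ι] [DecidableEq ι] [Fintype κ] [DecidableEq κ]

theorem Gate.mat_rename (e : ι ≃ κ) (g : Gate ι) :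
    (g.rename e).mat =
      g.mat.submatrix (e.symm.arrowCongr (Equiv.refl Bool))
        (e.symm.arrowCongr (Equiv.refl Bool)) := by
  have hE : ∀ x : κ → Bool, e.symm.arrowCongr (Equiv.refl Bool) x = x ∘ e := fun x => rfl
  ext x y
  cases g with
  | hadamard q =>
    have h : (∀ r, r ≠ e q → x r = y r) ↔ ∀ r, r ≠ q → x (e r) = y (e r) := by
      rw [← e.forall_congr_right]
      simp
    simp [Gate.rename, Gate.mat, h]
  | pauliX q => simp [Gate.rename, Gate.mat, hE, eq_update_comp_iff]
  | cnot c t h => simp [Gate.rename, Gate.mat, hE, eq_update_comp_iff]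
  | phaseS q => simp [Gate.rename, Gate.mat, Matrix.diagonal_apply]
  | tGate q => simp [Gate.rename, Gate.mat, Matrix.diagonal_apply]
  | tDagger q => simp [Gate.rename, Gate.mat, Matrix.diagonal_apply]

theorem Circuit.mat_rename (e : ι ≃ κ) (c : Circuit ι) :
    Circuit.mat (c.map (Gate.rename e)) =
      (Circuit.mat c).submatrix (e.symm.arrowCongr (Equiv.refl Bool))
        (e.symm.arrowCongr (Equiv.refl Bool)) := by
  induction c with
  | nil => simp [Circuit.mat]
  | cons g c ih =>
    simp only [List.map_cons, Circuit.mat, ih, Gate.mat_rename, Matrix.submatrix_mul_equiv]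

end Rename

theorem EtaBlockEncodes.blockEncodes {k n η : ℕ} {h : (Fin k → Fin n) → (Fin k → Fin n) → ℝ}
    {Λ ε A T : ℝ} (H : EtaBlockEncodes k n η h Λ ε A T) :
    BlockEncodes n η (hamiltonian h) ε A T := by
  obtain ⟨α, E, h0, h1, -, ⟨-, h3⟩, h4⟩ := H
  set e := (Fintype.equivFin (Anc k (Nat.clog 2 n) (Nat.clog 2 η) (bits k n η Λ ε) E.w)).sumCongr
    (Equiv.refl (Fin n)) with he
  refine ⟨α, _, E.circuit.map (Gate.rename e), h0, h1, ⟨Circuit.mat_mem_unitaryGroup _, ?_⟩, ?_⟩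
  · have : zeroBlock (Circuit.mat (E.circuit.map (Gate.rename e))) =
        zeroBlock (Circuit.mat E.circuit) := by
      ext x y
      have hx : ∀ x : Fin n → Bool, e.symm.arrowCongr (Equiv.refl Bool)
          (Sum.elim (fun _ => false) x) = Sum.elim (fun _ => false) x := by
        intro x
        ext (q | q) <;> rfl
      simp only [zeroBlock, Circuit.mat_rename, Matrix.of_apply, Matrix.submatrix_apply, hx]
    rwa [this]
  · rwa [Circuit.tCount_rename]

/-- Only the restriction of an operator to the `η`-particle subspace matters. -/
theorem BlockEncodes.congr {n η : ℕ} {H H' : Matrix (Fin n → Bool) (Fin n → Bool) ℂ} {ε A T : ℝ}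
    (h : BlockEncodes n η H ε A T) (hH : ∀ x j, particles j = η → H x j = H' x j) :
    BlockEncodes n η H' ε A T := by
  obtain ⟨α, w, c, h0, h1, ⟨h2, h3⟩, h4⟩ := h
  refine ⟨α, w, c, h0, h1, ⟨h2, ?_⟩, h4⟩
  convert h3 using 2
  ext x j
  simp [hH x j j.2]

/-! ### One-body operators as two-body operators -/

section OneBody

variable {n : ℕ}

theorem annihilate_ket (q : Fin n) (j : Fin n → Bool) :
    annihilate q *ᵥ ket j = (if j q = true then sg (decide (occupiedBelow j q % 2 = 1)) else 0) •
      ket (Function.update j q false) := by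
  simpa [ladder] using ladder_ket false q j

theorem create_ket (q : Fin n) (j : Fin n → Bool) :
    create q *ᵥ ket j = (if j q = false then sg (decide (occupiedBelow j q % 2 = 1)) else 0) •
      ket (Function.update j q true) := by
  simpa [ladder] using ladder_ket true q j

/-- The particle number operator. -/
theorem sum_create_mul_annihilate_ket (j : Fin n → Bool) :
    (∑ r, create r * annihilate r) *ᵥ ket j = (particles j : ℂ) • ket j := by
  have h : ∀ r : Fin n, (create r * annihilate r) *ᵥ ket j =
      (if j r = true then 1 else 0 : ℂ) • ket j := by
    intro r
    rw [← Matrix.mulVec_mulVec, annihilate_ket, Matrix.mulVec_smul, create_ket, smul_smul,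
      occupiedBelow_update, Function.update_idem]
    by_cases hr : j r = true
    · rw [show Function.update j r true = j by rw [← hr, Function.update_eq_self]]
      cases decide (occupiedBelow j r % 2 = 1) <;> simp [hr, sg]
    · simp [hr]
  rw [Matrix.sum_mulVec]
  simp only [h]
  rw [← Finset.sum_smul, Finset.sum_boole, particles]

theorem monomial_one (p q : Fin n) :
    monomial (fun _ : Fin 1 => p) (fun _ : Fin 1 => q) = create p * annihilate q := by
  simp [monomial]

theorem monomial_two (p p' q q' : Fin n) :
    monomial ![p, p'] ![q, q'] = create p * (create p' * annihilate q) * annihilate q' := by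
  simp [monomial, mul_assoc]

/-- On a state with `s + 1` particles, `s a†_p a_q = ∑ r, a†_p a†_r a_r a_q`. -/
theorem sum_monomial_two_apply {s : ℕ} (p q : Fin n) (x j : Fin n → Bool)
    (hj : particles j = s + 1) :
    ∑ r, monomial ![p, r] ![r, q] x j =
      s * monomial (fun _ : Fin 1 => p) (fun _ : Fin 1 => q) x j := by
  have h : (∑ r, monomial ![p, r] ![r, q]) *ᵥ ket j =
      (s : ℂ) • (monomial (fun _ : Fin 1 => p) (fun _ : Fin 1 => q) *ᵥ ket j) := by
    simp only [monomial_two, monomial_one, ← Finset.sum_mul, ← Finset.mul_sum]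
    rw [← Matrix.mulVec_mulVec, ← Matrix.mulVec_mulVec, ← Matrix.mulVec_mulVec, annihilate_ket,
      Matrix.mulVec_smul, sum_create_mul_annihilate_ket]
    by_cases hq : j q = true
    · have : particles (Function.update j q false) = s := by
        have := particles_update_false j q hq
        omega
      rw [this, Matrix.mulVec_smul, Matrix.mulVec_smul, Matrix.mulVec_smul, smul_comm]
    · simp [hq]
  have := congrFun h x
  rw [mulVec_ket_apply, Pi.smul_apply, mulVec_ket_apply, Matrix.sum_apply] at this
  exact this

/-- On states with `s + 1 ≥ 2` particles, the one-body operator with coefficients `h₁` agrees with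
a two-body operator. -/
noncomputable def liftOneBody (s : ℕ) (h₁ : (Fin 1 → Fin n) → (Fin 1 → Fin n) → ℝ)
    (P Q : Fin 2 → Fin n) : ℝ :=
  if P 1 = Q 0 then h₁ (fun _ => P 0) (fun _ => Q 1) / s else 0

theorem hamiltonian_one_apply (h₁ : (Fin 1 → Fin n) → (Fin 1 → Fin n) → ℝ)
    (x j : Fin n → Bool) :
    hamiltonian h₁ x j = ∑ p : Fin n, ∑ q : Fin n, (h₁ (fun _ => p) (fun _ => q) : ℂ) *
      monomial (fun _ : Fin 1 => p) (fun _ : Fin 1 => q) x j := by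
  simp only [hamiltonian, Matrix.sum_apply, Matrix.smul_apply, smul_eq_mul]
  rw [← (Equiv.funUnique (Fin 1) (Fin n)).symm.sum_comp]
  refine Finset.sum_congr rfl fun p _ => ?_
  rw [← (Equiv.funUnique (Fin 1) (Fin n)).symm.sum_comp]
  rfl

theorem hamiltonian_two_apply (h₂ : (Fin 2 → Fin n) → (Fin 2 → Fin n) → ℝ)
    (x j : Fin n → Bool) :
    hamiltonian h₂ x j = ∑ p : Fin n, ∑ p' : Fin n, ∑ q : Fin n, ∑ q' : Fin n,
      (h₂ ![p, p'] ![q, q'] : ℂ) * monomial ![p, p'] ![q, q'] x j := by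
  simp only [hamiltonian, Matrix.sum_apply, Matrix.smul_apply, smul_eq_mul]
  rw [← (finTwoArrowEquiv (Fin n)).symm.sum_comp, Fintype.sum_prod_type]
  refine Finset.sum_congr rfl fun p _ => Finset.sum_congr rfl fun p' _ => ?_
  rw [← (finTwoArrowEquiv (Fin n)).symm.sum_comp, Fintype.sum_prod_type]
  rfl

theorem hamiltonian_liftOneBody_apply {s : ℕ} (hs : s ≠ 0)
    (h₁ : (Fin 1 → Fin n) → (Fin 1 → Fin n) → ℝ) (x j : Fin n → Bool)
    (hj : particles j = s + 1) :
    hamiltonian (liftOneBody s h₁) x j = hamiltonian h₁ x j := by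
  rw [hamiltonian_one_apply, hamiltonian_two_apply]
  refine Finset.sum_congr rfl fun p _ => ?_
  have : ∀ p' q q' : Fin n, (liftOneBody s h₁ ![p, p'] ![q, q'] : ℂ) *
      monomial ![p, p'] ![q, q'] x j = if p' = q then
        ((h₁ (fun _ => p) (fun _ => q') / s : ℝ) : ℂ) * monomial ![p, q] ![q, q'] x j else 0 := by
    intro p' q q'
    by_cases h : p' = q
    · subst h; simp [liftOneBody]
    · simp [liftOneBody, h]
  simp only [this]
  simp only [Finset.sum_ite_irrel, Finset.sum_const_zero, Finset.sum_ite_eq, Finset.mem_univ,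
    if_true]
  rw [Finset.sum_comm]
  refine Finset.sum_congr rfl fun q _ => ?_
  rw [← Finset.mul_sum, sum_monomial_two_apply p q x j hj]
  have : (s : ℂ) ≠ 0 := Nat.cast_ne_zero.2 hs
  push_cast
  field_simp

theorem abs_liftOneBody_le {s : ℕ} (hs : s ≠ 0) {h₁ : (Fin 1 → Fin n) → (Fin 1 → Fin n) → ℝ}
    {Λ : ℝ} (hh : ∀ P Q, |h₁ P Q| ≤ Λ) (P Q : Fin 2 → Fin n) : |liftOneBody s h₁ P Q| ≤ Λ := by
  have hs' : (1 : ℝ) ≤ s := by exact_mod_cast Nat.one_le_iff_ne_zero.2 hs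
  rw [liftOneBody]
  split_ifs
  · rw [abs_div, Nat.abs_cast]
    exact (div_le_self (abs_nonneg _) hs').trans (hh _ _)
  · rw [abs_zero]
    exact (abs_nonneg _).trans (hh (fun _ => P 0) fun _ => Q 0)

theorem hamiltonian_add {k : ℕ} (h h' : (Fin k → Fin n) → (Fin k → Fin n) → ℝ) :
    hamiltonian (fun P Q => h P Q + h' P Q) = hamiltonian h + hamiltonian h' := by
  simp [hamiltonian, add_smul, Finset.sum_add_distrib]

/-- Two-body operators vanish on one-particle states. -/
theorem hamiltonian_two_apply_eq_zero (h₂ : (Fin 2 → Fin n) → (Fin 2 → Fin n) → ℝ)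
    (x j : Fin n → Bool) (hj : particles j = 1) : hamiltonian h₂ x j = 0 := by
  rw [hamiltonian_two_apply]
  refine Finset.sum_eq_zero fun p _ => Finset.sum_eq_zero fun p' _ => Finset.sum_eq_zero fun q _ =>
    Finset.sum_eq_zero fun q' _ => mul_eq_zero_of_right _ ?_
  have h : monomial ![p, p'] ![q, q'] *ᵥ ket j = 0 := by
    rw [monomial_two, ← Matrix.mulVec_mulVec, ← Matrix.mulVec_mulVec, ← Matrix.mulVec_mulVec,
      annihilate_ket, Matrix.mulVec_smul, annihilate_ket]
    by_cases hq : j q' = true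
    · have h0 : particles (Function.update j q' false) = 0 := by
        have := particles_update_false j q' hq
        omega
      rw [particles, Finset.card_eq_zero, Finset.filter_eq_empty_iff] at h0
      simp [h0 (Finset.mem_univ q)]
    · simp [hq]
  rw [← mulVec_ket_apply (monomial ![p, p'] ![q, q']), h, Pi.zero_apply]

end OneBody

/-! ### Sums of one-body and two-body operators -/

theorem bits_two_mul_le {k n η : ℕ} {Λ ε : ℝ} :
    bits k n η (2 * Λ) ε ≤ 2 * bits k n η Λ ε := by
  have h : Nat.clog 2 ⌈2 * Λ * ((n : ℝ) * η) ^ k / ε⌉₊ ≤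
      Nat.clog 2 ⌈Λ * ((n : ℝ) * η) ^ k / ε⌉₊ + 1 := by
    rw [Nat.clog_le_iff_le_pow one_lt_two, Nat.ceil_le, pow_succ]
    have h1 := Nat.le_ceil (Λ * ((n : ℝ) * η) ^ k / ε)
    have h2 := Nat.le_pow_clog one_lt_two ⌈Λ * ((n : ℝ) * η) ^ k / ε⌉₊
    have h3 : ((⌈Λ * ((n : ℝ) * η) ^ k / ε⌉₊ : ℕ) : ℝ) ≤
        (2 : ℝ) ^ Nat.clog 2 ⌈Λ * ((n : ℝ) * η) ^ k / ε⌉₊ := by exact_mod_cast h2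
    push_cast
    have h4 : 2 * Λ * ((n : ℝ) * η) ^ k / ε = Λ * ((n : ℝ) * η) ^ k / ε * 2 := by ring
    rw [h4]
    linarith
  unfold bits
  omega

theorem bits_one_le_bits_two {n : ℕ} {Λ ε : ℝ} (hn : 1 ≤ n) (hΛ : 0 < Λ) (hε : 0 < ε) :
    bits 1 n 1 Λ ε ≤ bits 2 n 1 Λ ε := by
  have hn' : (1 : ℝ) ≤ n := by exact_mod_cast hn
  refine Nat.add_le_add_right (Nat.clog_mono_right 2 (Nat.ceil_le_ceil ?_)) 1
  gcongr
  · simpa using hn'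
  · norm_num

theorem blockEncodes_add {n η lam : ℕ} {Λ ε : ℝ} (hη : 1 ≤ η) (hηn : η ≤ n) (hΛ : 0 < Λ)
    (hε : 0 < ε) (h₁ : (Fin 1 → Fin n) → (Fin 1 → Fin n) → ℝ)
    (h₂ : (Fin 2 → Fin n) → (Fin 2 → Fin n) → ℝ) (hh₁ : ∀ P Q, |h₁ P Q| ≤ Λ)
    (hh₂ : ∀ P Q, |h₂ P Q| ≤ Λ) (hlam : 1 ≤ lam) (hlam' : lam ≤ n ^ 4) :
    BlockEncodes n η (hamiltonian h₁ + hamiltonian h₂) ε (32 * (Λ * ((n : ℝ) * η) ^ 2))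
      (41132 * (n * Real.logb 2 η + (n : ℝ) ^ 4 / lam + lam * bits 2 n η Λ ε)) := by
  have hn : 1 ≤ n := hη.trans hηn
  have hn' : (1 : ℝ) ≤ n := by exact_mod_cast hn
  have hlam0 : (1 : ℝ) ≤ lam := by exact_mod_cast hlam
  rcases hη.eq_or_lt with rfl | hη2
  · -- the one-body table has only `n ^ 2` entries, so that `lam` may have to be decreased
    have H := (etaBlockEncodes_of_lam (k := 1) (lam := min lam (n ^ 2)) (Or.inl rfl) le_rfl hn hΛ hε
      h₁ hh₁ (le_min hlam (Nat.one_le_pow _ _ hn)) (min_le_right _ _)).blockEncodes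
    refine (H.congr fun x j hj => ?_).mono ?_ ?_
    · rw [Matrix.add_apply, hamiltonian_two_apply_eq_zero h₂ x j hj, add_zero]
    · have : (n : ℝ) ≤ n ^ 2 := by nlinarith
      simp only [Nat.cast_one, mul_one, pow_one]
      nlinarith [mul_le_mul_of_nonneg_left this hΛ.le, mul_pos hΛ (by linarith : (0 : ℝ) < n)]
    · have hb : ((bits 1 n 1 Λ ε : ℕ) : ℝ) ≤ bits 2 n 1 Λ ε := by
        exact_mod_cast bits_one_le_bits_two hn hΛ hε
      have hb1 : (1 : ℝ) ≤ bits 2 n 1 Λ ε := by exact_mod_cast one_le_bits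
      have hm : ((min lam (n ^ 2) : ℕ) : ℝ) ≤ lam := by exact_mod_cast min_le_left _ _
      have e1 : ((min lam (n ^ 2) : ℕ) : ℝ) * bits 1 n 1 Λ ε ≤ lam * bits 2 n 1 Λ ε := by
        gcongr
      have e2 : (n : ℝ) ^ (2 * 1) / ((min lam (n ^ 2) : ℕ) : ℝ) ≤
          (n : ℝ) ^ 4 / lam + lam * bits 2 n 1 Λ ε := by
        have hpos : 0 ≤ (n : ℝ) ^ 4 / lam := by positivity
        rcases le_total lam (n ^ 2) with h | h
        · rw [min_eq_left h]
          have : (n : ℝ) ^ (2 * 1) / lam ≤ (n : ℝ) ^ 4 / lam := by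
            exact div_le_div_of_nonneg_right (pow_le_pow_right₀ hn' (by norm_num)) (by linarith)
          have : 0 ≤ (lam : ℝ) * bits 2 n 1 Λ ε := by positivity
          linarith
        · rw [min_eq_right h]
          push_cast
          rw [div_self (by positivity)]
          nlinarith
      have e3 : (0 : ℝ) ≤ (n : ℝ) ^ 4 / lam := by positivity
      simp only [Nat.cast_one, Real.logb_one, mul_zero, zero_add]
      linarith
  · obtain ⟨s, rfl⟩ : ∃ s, η = s + 1 := ⟨η - 1, by omega⟩
    have hs : s ≠ 0 := by omega
    have H := (etaBlockEncodes_of_lam (k := 2) (lam := lam) (Or.inr rfl) hη hηn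
      (by positivity : 0 < 2 * Λ) hε (fun P Q => liftOneBody s h₁ P Q + h₂ P Q) (fun P Q => by
        have := abs_add_le (liftOneBody s h₁ P Q) (h₂ P Q)
        have := abs_liftOneBody_le hs hh₁ P Q
        have := hh₂ P Q
        linarith) hlam hlam').blockEncodes
    refine (H.congr fun x j hj => ?_).mono (le_of_eq (by ring)) ?_
    · rw [hamiltonian_add, Matrix.add_apply, Matrix.add_apply,
        hamiltonian_liftOneBody_apply hs h₁ x j hj]
    · have hb : ((bits 2 n (s + 1) (2 * Λ) ε : ℕ) : ℝ) ≤ 2 * bits 2 n (s + 1) Λ ε := by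
        exact_mod_cast bits_two_mul_le
      have e1 : (lam : ℝ) * bits 2 n (s + 1) (2 * Λ) ε ≤ lam * (2 * bits 2 n (s + 1) Λ ε) := by
        gcongr
      have e2 : 0 ≤ (n : ℝ) * Real.logb 2 ((s + 1 : ℕ) : ℝ) :=
        mul_nonneg (by linarith) (Real.logb_nonneg one_lt_two (by exact_mod_cast hη))
      have e3 : 0 ≤ (n : ℝ) ^ 4 / lam := by positivity
      have e4 : (n : ℝ) ^ (2 * 2) = (n : ℝ) ^ 4 := by norm_num
      rw [e4]
      linarith

end EtaParticle


open EtaParticle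
theorem mainTheorem3 :
    ∃ C : ℝ, 0 < C ∧ ∀ (n η : ℕ) (Λ ε : ℝ), 1 ≤ η → η ≤ n → 0 < Λ → 0 < ε →
      -- one-body (k = 1) and two-body (k = 2) Hamiltonians, with L = n ^ (2k) coefficients
      (∀ k : ℕ, k = 1 ∨ k = 2 →
        ∀ h : (Fin k → Fin n) → (Fin k → Fin n) → ℝ, (∀ P Q, |h P Q| ≤ Λ) →
          (∀ lam : ℕ, 1 ≤ lam → lam ≤ n ^ (2 * k) →
            EtaBlockEncodes k n η h Λ ε (C * (Λ * ((n : ℝ) * η) ^ k))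
              (C * (n * Real.logb 2 η + (n : ℝ) ^ (2 * k) / lam + lam * bits k n η Λ ε))) ∧
          (bits k n η Λ ε ≤ n ^ (2 * k) →
            EtaBlockEncodes k n η h Λ ε (C * (Λ * ((n : ℝ) * η) ^ k))
              (C * (n * Real.logb 2 η +
                Real.sqrt ((n : ℝ) ^ (2 * k) * bits k n η Λ ε))))) ∧
      -- Hamiltonians with one-body and two-body terms, with L = n ^ 4
      (∀ (h₁ : (Fin 1 → Fin n) → (Fin 1 → Fin n) → ℝ)
          (h₂ : (Fin 2 → Fin n) → (Fin 2 → Fin n) → ℝ),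
        (∀ P Q, |h₁ P Q| ≤ Λ) → (∀ P Q, |h₂ P Q| ≤ Λ) →
          (∀ lam : ℕ, 1 ≤ lam → lam ≤ n ^ 4 →
            BlockEncodes n η (hamiltonian h₁ + hamiltonian h₂) ε
              (C * (Λ * ((n : ℝ) * η) ^ 2))
              (C * (n * Real.logb 2 η + (n : ℝ) ^ 4 / lam + lam * bits 2 n η Λ ε))) ∧
          (bits 2 n η Λ ε ≤ n ^ 4 →
            BlockEncodes n η (hamiltonian h₁ + hamiltonian h₂) ε
              (C * (Λ * ((n : ℝ) * η) ^ 2))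
              (C * (n * Real.logb 2 η +
                Real.sqrt ((n : ℝ) ^ 4 * bits 2 n η Λ ε))))) := by
  have hlog : ∀ n η : ℕ, 1 ≤ η → 0 ≤ (n : ℝ) * Real.logb 2 η := fun n η hη =>
    mul_nonneg n.cast_nonneg (Real.logb_nonneg one_lt_two (by exact_mod_cast hη))
  -- `123396 = 3 * 41132`, the factor `3` being that of `exists_balanced`
  refine ⟨123396, by norm_num, fun n η Λ ε hη hηn hΛ hε => ⟨fun k hk h hh => ⟨?_, ?_⟩,
    fun h₁ h₂ hh₁ hh₂ => ⟨?_, ?_⟩⟩⟩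
  · intro lam hlam hlam'
    have := hlog n η hη
    refine (etaBlockEncodes_of_lam hk hη hηn hΛ hε h hh hlam hlam').mono ?_ ?_
    · gcongr; norm_num
    · gcongr; norm_num
  · intro hb
    obtain ⟨lam, hlam, hlam', hsq⟩ := exists_balanced one_le_bits hb
    have := hlog n η hη
    refine (etaBlockEncodes_of_lam hk hη hηn hΛ hε h hh hlam hlam').mono ?_ ?_
    · gcongr; norm_num
    · push_cast at hsq
      linarith [Real.sqrt_nonneg ((n : ℝ) ^ (2 * k) * bits k n η Λ ε)]
  · intro lam hlam hlam'
    have := hlog n η hη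
    refine (blockEncodes_add hη hηn hΛ hε h₁ h₂ hh₁ hh₂ hlam hlam').mono ?_ ?_
    · gcongr; norm_num
    · gcongr; norm_num
  · intro hb
    obtain ⟨lam, hlam, hlam', hsq⟩ := exists_balanced one_le_bits hb
    have := hlog n η hη
    refine (blockEncodes_add hη hηn hΛ hε h₁ h₂ hh₁ hh₂ hlam hlam').mono ?_ ?_
    · gcongr; norm_num
    · push_cast at hsq
      linarith
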